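/- Conventions. Let $G$ be a (real, finite-dimensional, not necessarily connected) Lie group. All locally convex spaces are Hausdorff, real and quasi-complete (every closed bounded subset is complete). For a finite-dimensional smooth manifold $M$ without boundary and a locally convex space $V$, a map $f\colon M\to V$ is smooth if, in every smooth chart, all its iterated directional derivatives exist and are continuous functions of the point and the directions; smoothness of a map between locally convex spaces is defined in the same way. $\mathcal C^\infty(M,V)$ is the space of smooth maps $M\to V$ with the $\mathcal C^\infty$-topology, i.e. uniform convergence on compact sets of all derivatives in charts. A continuous $G$-module is a locally convex space $V$ with a linear action of $G$ for which $G\times V\to V$ is continuous. It is a differentiable $G$-module if moreover for each $v\in V$ the orbit map $o_v\colon G\to V$, $g\mapsto g\cdot v$, is smooth, and the map $V\to\mathcal C^\infty(G,V)$, $v\mapsto o_v$, is smooth. For a continuous $G$-module $W$ let $C^r(G;W)$ be the space of continuous maps $G^r\to W$, let $C^r_d(G;W)=\mathcal C^\infty(G^r,W)$, and let $$\partial\lambda(\alpha_1,\dots,\alpha_{r+1})=\alpha_1\cdot\lambda(\alpha_2,\dots,\alpha_{r+1})+\sum_{i=1}^r(-1)^i\lambda(\alpha_1,\dots,\alpha_i\alpha_{i+1},\dots,\alpha_{r+1})+(-1)^{r+1}\lambda(\alpha_1,\dots,\alpha_r).$$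 For $r\ge 1$ the continuous cohomology $H^r(G,W)$ is the space of $\lambda\in C^r(G;W)$ with $\partial\lambda=0$ modulo $\partial\,C^{r-1}(G;W)$; for a differentiable $G$-module $W$, the differentiable cohomology $H^r_d(G,W)$ is the space of $\lambda\in C^r_d(G;W)$ with $\partial\lambda=0$ modulo $\partial\,C^{r-1}_d(G;W)$. Theorem. Let $X$ be a finite-dimensional smooth manifold (Hausdorff, paracompact, without boundary) on which $G$ acts smoothly and properly, and let $V$ be a differentiable $G$-module. Let $G$ act on $\mathcal C^\infty(X,V)$ by $(\alpha\cdot f)(x)=\alpha\cdot f(\alpha^{-1}\cdot x)$. Then $$H^r_d\bigl(G,\mathcal C^\infty(X,V)\bigr)=H^r\bigl(G,\mathcal C^\infty(X,V)\bigr)=\{0\}\qquad\text{for all } r\ge 1.$$ In particular, for the trivial $G$-module $\mathbb R$, $H^r_d\bigl(G,\mathcal C^\infty(X,\mathbb R)\bigr)=\{0\}$ for all $r\ge 1$. -/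

import Mathlib

open Set Filter Topology
open scoped Manifold ContDiff

noncomputable section

namespace EquivCoh

/-! ### Smooth maps with values in a topological vector space -/

section Calculus

variable {E F F' : Type*} [AddCommGroup E] [Module ℝ E] [TopologicalSpace E]
  [AddCommGroup F] [Module ℝ F] [TopologicalSpace F]
  [AddCommGroup F'] [Module ℝ F'] [TopologicalSpace F']

/-- `f'` is the directional derivative of `f` at `x` in the direction `h`, that is, the limit of
`(f (x + t h) - f x) / t` as `t → 0`, `t ≠ 0`. -/
def HasDirDerivAt (f : E → F) (f' : F) (x h : E) : Prop :=
  Tendsto (fun t : ℝ => t⁻¹ • (f (x + t • h) - f x)) (𝓝[≠] 0) (𝓝 f')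

/-- `D k x (h₁, …, hₖ)` are the iterated directional derivatives of `f` at the points `x` of
the open set `U`, and each of them is a continuous function on `U × Eᵏ`. -/
structure HasDirDerivsOn (U : Set E) (f : E → F) (D : ∀ k : ℕ, E → (Fin k → E) → F) : Prop where
  zero : ∀ x ∈ U, ∀ v, D 0 x v = f x
  succ : ∀ k, ∀ x ∈ U, ∀ (v : Fin k → E) (h : E),
    HasDirDerivAt (fun y => D k y v) (D (k + 1) x (Fin.cons h v)) x h
  cont : ∀ k, ContinuousOn (fun p : E × (Fin k → E) => D k p.1 p.2) (U ×ˢ univ)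

/-- `f` is smooth on the open set `U`: all iterated directional derivatives exist and are
continuous on `U × Eᵏ`, for every `k` (smoothness in the sense of Michal and Bastiani). -/
def SmoothOn (U : Set E) (f : E → F) : Prop :=
  ∃ D : ∀ k : ℕ, E → (Fin k → E) → F, HasDirDerivsOn U f D

theorem HasDirDerivsOn.unique [ContinuousAdd E] [ContinuousSMul ℝ E] [T2Space F] {U : Set E}
    (hU : IsOpen U) {f : E → F} {D D' : ∀ k : ℕ, E → (Fin k → E) → F}
    (hD : HasDirDerivsOn U f D) (hD' : HasDirDerivsOn U f D') (k : ℕ) :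
    ∀ x ∈ U, ∀ v, D k x v = D' k x v := by
  induction k with
  | zero => intro x hx v; rw [hD.zero x hx, hD'.zero x hx]
  | succ k ih =>
    intro x hx v
    have h1 := hD.succ k x hx (Fin.tail v) (v 0)
    have h2 := hD'.succ k x hx (Fin.tail v) (v 0)
    rw [Fin.cons_self_tail] at h1 h2
    refine tendsto_nhds_unique h1 (Tendsto.congr' ?_ h2)
    have hc : Tendsto (fun t : ℝ => x + t • v 0) (𝓝[≠] 0) (𝓝 x) := by
      have : Continuous fun t : ℝ => x + t • v 0 := by fun_prop
      have := this.tendsto 0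
      simp only [zero_smul, add_zero] at this
      exact this.mono_left nhdsWithin_le_nhds
    filter_upwards [hc (hU.mem_nhds hx)] with t ht
    rw [ih _ ht, ih _ hx]

theorem HasDirDerivsOn.clm_comp {U : Set E} {f : E → F} {D : ∀ k : ℕ, E → (Fin k → E) → F}
    (hD : HasDirDerivsOn U f D) (L : F →L[ℝ] F') :
    HasDirDerivsOn U (fun x => L (f x)) (fun k x v => L (D k x v)) where
  zero x hx v := by rw [hD.zero x hx]
  succ k x hx v h := by
    have := (L.continuous.tendsto _).comp (hD.succ k x hx v h)
    simpa [HasDirDerivAt, Function.comp_def] using this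
  cont k := L.continuous.comp_continuousOn (hD.cont k)

theorem HasDirDerivsOn.add [ContinuousAdd F] {U : Set E} {f g : E → F}
    {D D' : ∀ k : ℕ, E → (Fin k → E) → F}
    (hD : HasDirDerivsOn U f D) (hD' : HasDirDerivsOn U g D') :
    HasDirDerivsOn U (fun x => f x + g x) (fun k x v => D k x v + D' k x v) where
  zero x hx v := by rw [hD.zero x hx, hD'.zero x hx]
  succ k x hx v h := by
    refine Tendsto.congr (fun t => ?_) (Tendsto.add (hD.succ k x hx v h) (hD'.succ k x hx v h))
    rw [← smul_add, add_sub_add_comm]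
  cont k := (hD.cont k).add (hD'.cont k)

theorem HasDirDerivsOn.zero_fun (U : Set E) :
    HasDirDerivsOn U (fun _ => (0 : F)) (fun _ _ _ => 0) where
  zero _ _ _ := rfl
  succ k x hx v h := by simpa [HasDirDerivAt] using tendsto_const_nhds
  cont k := continuousOn_const

end Calculus

/-! ### The space `C^∞(M, V)` -/

section SmoothMaps

variable {E H : Type*} [NormedAddCommGroup E] [NormedSpace ℝ E] [TopologicalSpace H]
  (I : ModelWithCorners ℝ E H) {M : Type*} [TopologicalSpace M] [ChartedSpace H M]
  {V : Type*} [AddCommGroup V] [Module ℝ V] [TopologicalSpace V]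

/-- A map from a manifold without boundary to a topological vector space is smooth if it is smooth
in every chart of the maximal smooth atlas. -/
def IsSmooth (f : M → V) : Prop :=
  ∀ e ∈ IsManifold.maximalAtlas I ∞ M,
    SmoothOn (e.extend I).target (fun x => f ((e.extend I).symm x))

variable (M V) in
/-- The smooth maps, as a linear subspace of all maps `M → V`. -/
def smoothSubmodule [ContinuousAdd V] [ContinuousSMul ℝ V] : Submodule ℝ (M → V) where
  carrier := {f | IsSmooth I f}
  add_mem' := by
    intro f g hf hg e he
    obtain ⟨D, hD⟩ := hf e he
    obtain ⟨D', hD'⟩ := hg e he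
    exact ⟨_, hD.add hD'⟩
  zero_mem' := fun e he => ⟨_, HasDirDerivsOn.zero_fun _⟩
  smul_mem' := by
    intro c f hf e he
    obtain ⟨D, hD⟩ := hf e he
    exact ⟨_, hD.clm_comp (c • ContinuousLinearMap.id ℝ V)⟩

variable [ContinuousAdd V] [ContinuousSMul ℝ V]

variable (M V) in
/-- The vector space `C^∞(M, V)`. It does not carry the topology of pointwise convergence,
but the `C^∞`-topology defined below. -/
def SmoothMap : Type _ := smoothSubmodule I M V

instance : AddCommGroup (SmoothMap I M V) := inferInstanceAs (AddCommGroup (smoothSubmodule I M V))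

instance : Module ℝ (SmoothMap I M V) := inferInstanceAs (Module ℝ (smoothSubmodule I M V))

variable {I} in
/-- The element of `C^∞(M, V)` given by a smooth map `f`. -/
def SmoothMap.mk (f : M → V) (hf : IsSmooth I f) : SmoothMap I M V := ⟨f, hf⟩

instance : CoeFun (SmoothMap I M V) (fun _ => M → V) := ⟨fun f => f.1⟩

variable {I}

/-- The iterated directional derivatives of a smooth map in the chart `e` (they are unique if `V`
is Hausdorff). -/
def SmoothMap.chartDeriv (e : IsManifold.maximalAtlas I ∞ M) (f : SmoothMap I M V) :
    ∀ k : ℕ, E → (Fin k → E) → V :=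
  (f.2 e.1 e.2).choose

theorem SmoothMap.hasDirDerivsOn_chartDeriv (e : IsManifold.maximalAtlas I ∞ M)
    (f : SmoothMap I M V) : HasDirDerivsOn (e.1.extend I).target
      (fun x => f ((e.1.extend I).symm x)) (f.chartDeriv e) :=
  (f.2 e.1 e.2).choose_spec

/-- The `k`-th derivative of a smooth map in the chart `e`, as a continuous map on
(image of the chart) `× Eᵏ`. -/
def SmoothMap.jet (e : IsManifold.maximalAtlas I ∞ M) (k : ℕ) (f : SmoothMap I M V) :
    C((e.1.extend I).target × (Fin k → E), V) where
  toFun p := f.chartDeriv e k p.1 p.2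
  continuous_toFun := ((f.hasDirDerivsOn_chartDeriv e).cont k).comp_continuous
    (f := fun p : (e.1.extend I).target × (Fin k → E) => ((p.1 : E), p.2))
    (by fun_prop) (fun p => ⟨p.1.2, mem_univ _⟩)

/-- The `C^∞`-topology: uniform convergence on compact sets of all derivatives in all charts.
It is the coarsest topology for which all the maps `SmoothMap.jet e k` into spaces of continuous
maps with the compact-open topology are continuous. -/
instance : TopologicalSpace (SmoothMap I M V) :=
  ⨅ (e : IsManifold.maximalAtlas I ∞ M) (k : ℕ),
    TopologicalSpace.induced (SmoothMap.jet e k) ContinuousMap.compactOpen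

section Linear

variable [I.Boundaryless] [T2Space V]

/-- `SmoothMap.jet` as a linear map. -/
def SmoothMap.jetₗ (e : IsManifold.maximalAtlas I ∞ M) (k : ℕ) :
    SmoothMap I M V →ₗ[ℝ] C((e.1.extend I).target × (Fin k → E), V) where
  toFun := SmoothMap.jet e k
  map_add' f g := by
    ext p
    exact HasDirDerivsOn.unique e.1.isOpen_extend_target ((f + g).hasDirDerivsOn_chartDeriv e)
      ((f.hasDirDerivsOn_chartDeriv e).add (g.hasDirDerivsOn_chartDeriv e)) k p.1 p.1.2 p.2
  map_smul' c f := by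
    ext p
    exact HasDirDerivsOn.unique e.1.isOpen_extend_target ((c • f).hasDirDerivsOn_chartDeriv e)
      ((f.hasDirDerivsOn_chartDeriv e).clm_comp (c • ContinuousLinearMap.id ℝ V)) k p.1 p.1.2 p.2

end Linear

instance {V : Type*} [AddCommGroup V] [Module ℝ V] [TopologicalSpace V]
    [IsTopologicalAddGroup V] [ContinuousSMul ℝ V] [I.Boundaryless] [T2Space V] :
    IsTopologicalAddGroup (SmoothMap I M V) :=
  topologicalAddGroup_iInf fun e => topologicalAddGroup_iInf fun k =>
    topologicalAddGroup_induced (SmoothMap.jetₗ (I := I) (M := M) (V := V) e k)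

instance [I.Boundaryless] [T2Space V] : ContinuousSMul ℝ (SmoothMap I M V) :=
  continuousSMul_iInf fun e => continuousSMul_iInf fun k =>
    continuousSMul_induced (SmoothMap.jetₗ (I := I) (M := M) (V := V) e k)

end SmoothMaps

/-! ### Modules over a Lie group -/

section Modules

variable {E H G : Type*} [NormedAddCommGroup E] [NormedSpace ℝ E] [TopologicalSpace H]
  (I : ModelWithCorners ℝ E H) [TopologicalSpace G] [ChartedSpace H G] [Group G]
  {V : Type*} [AddCommGroup V] [Module ℝ V] [TopologicalSpace V]

/-- A continuous `G`-module: the action map `G × V → V` is continuous. -/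
def IsContinuousModule (ρ : Representation ℝ G V) : Prop :=
  Continuous fun p : G × V => ρ p.1 p.2

/-- A differentiable `G`-module: a continuous `G`-module `V` whose orbit maps `o_v : g ↦ g • v`
are smooth and for which `v ↦ o_v` is a smooth map `V → C^∞(G, V)`. -/
structure IsDifferentiableModule [ContinuousAdd V] [ContinuousSMul ℝ V]
    (ρ : Representation ℝ G V) : Prop where
  continuous : IsContinuousModule ρ
  smooth_orbit : ∀ v : V, IsSmooth I fun g : G => ρ g v
  smooth_orbitMap : SmoothOn (F := SmoothMap I G V) univ
    fun v : V => SmoothMap.mk (fun g => ρ g v) (smooth_orbit v)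

variable {I} {E' H' : Type*} [NormedAddCommGroup E'] [NormedSpace ℝ E'] [TopologicalSpace H']
  {J : ModelWithCorners ℝ E' H'} {X : Type*} [TopologicalSpace X] [ChartedSpace H' X]

theorem IsSmooth.comp_diffeomorph [IsManifold J ∞ X] {f : X → V} (hf : IsSmooth J f)
    (Φ : X ≃ₘ^∞⟮J, J⟯ X) : IsSmooth J (fun x => f (Φ x)) := by
  intro e he
  have he' : Φ.symm.toHomeomorph.toOpenPartialHomeomorph.trans e ∈
      IsManifold.maximalAtlas J ∞ X := by
    refine OpenPartialHomeomorph.mem_maximalAtlas_of_contMDiffOn _ ?_ ?_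
    · exact (contMDiffOn_of_mem_maximalAtlas he).comp Φ.symm.contMDiff.contMDiffOn (by simp)
    · exact Φ.contMDiff.comp_contMDiffOn
        ((contMDiffOn_symm_of_mem_maximalAtlas he).mono (by simp))
  have h := hf _ he'
  have ht : ((Φ.symm.toHomeomorph.toOpenPartialHomeomorph.trans e).extend J).target =
      (e.extend J).target := by simp
  rw [ht] at h
  exact h

variable (I J X) in
/-- The `G`-module `C^∞(X, V)`, where `G` acts by `(α • f) x = α • f (α⁻¹ • x)`. -/
def smoothRep [IsTopologicalAddGroup V] [ContinuousSMul ℝ V] [IsManifold J ∞ X] [MulAction G X]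
    [ContMDiffSMul I J ∞ G X] (ρ : Representation ℝ G V) (hρ : IsContinuousModule ρ) :
    Representation ℝ G (SmoothMap J X V) where
  toFun α :=
    { toFun := fun f => SmoothMap.mk (fun x => ρ α (f (α⁻¹ • x))) fun e he => by
        obtain ⟨D, hD⟩ := IsSmooth.comp_diffeomorph f.2 (Diffeomorph.smul I J ∞ α⁻¹) e he
        exact ⟨_, hD.clm_comp
          ⟨ρ α, (show Continuous fun p : G × V => ρ p.1 p.2 from hρ).comp
            (continuous_const.prodMk continuous_id)⟩⟩
      map_add' := fun f g => Subtype.ext <| funext fun x => map_add (ρ α) _ _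
      map_smul' := fun c f => Subtype.ext <| funext fun x => map_smul (ρ α) _ _ }
  map_one' := by
    ext f
    refine Subtype.ext (funext fun x => ?_)
    change ρ 1 (f ((1 : G)⁻¹ • x)) = f x
    simp
  map_mul' α β := by
    ext f
    refine Subtype.ext (funext fun x => ?_)
    change ρ (α * β) (f ((α * β)⁻¹ • x)) = ρ α (ρ β (f (β⁻¹ • α⁻¹ • x)))
    simp [mul_smul]

end Modules

/-! ### Continuous and differentiable cohomology -/

section Cohomology

variable {G W : Type*} [Group G] [AddCommGroup W] [Module ℝ W]

/-- The coboundary operator on inhomogeneous cochains: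
`(∂ c)(α₁, …, αᵣ₊₁) = α₁ • c(α₂, …, αᵣ₊₁) + ∑_{i=1}^r (-1)^i c(α₁, …, αᵢ αᵢ₊₁, …, αᵣ₊₁)
  + (-1)^(r+1) c(α₁, …, αᵣ)`. -/
def coboundary (σ : Representation ℝ G W) (r : ℕ) :
    ((Fin r → G) → W) →ₗ[ℝ] ((Fin (r + 1) → G) → W) where
  toFun c α := σ (α 0) (c fun i => α i.succ)
    + ∑ i : Fin r, (-1 : ℝ) ^ ((i : ℕ) + 1) • c (Fin.contractNth i.castSucc (· * ·) α)
    + (-1 : ℝ) ^ (r + 1) • c fun i => α i.castSucc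
  map_add' c d := by
    ext α
    simp only [Pi.add_apply, map_add, smul_add, Finset.sum_add_distrib]
    abel
  map_smul' a c := by
    ext α
    simp only [Pi.smul_apply, map_smul, smul_add, Finset.smul_sum, RingHom.id_apply]
    simp only [smul_comm a]

/-- The `r`-cocycles among the cochains in `C`. -/
def cocycles (σ : Representation ℝ G W) (C : ∀ r : ℕ, Submodule ℝ ((Fin r → G) → W)) (r : ℕ) :
    Submodule ℝ ((Fin r → G) → W) :=
  C r ⊓ LinearMap.ker (coboundary σ r)

/-- The `r`-coboundaries of the cochains in `C`: the image of `C (r - 1)` under `∂`, and `0` if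
`r = 0`. -/
def coboundaries (σ : Representation ℝ G W) (C : ∀ r : ℕ, Submodule ℝ ((Fin r → G) → W)) :
    ∀ r : ℕ, Submodule ℝ ((Fin r → G) → W)
  | 0 => ⊥
  | r + 1 => (C r).map (coboundary σ r)

/-- The `r`-th cohomology group of the complex `C` of inhomogeneous cochains, the quotient of the
`r`-cocycles by the `r`-coboundaries (`submoduleOf` regards the coboundaries as a submodule of the
space of cocycles). -/
abbrev Cohomology (σ : Representation ℝ G W) (C : ∀ r : ℕ, Submodule ℝ ((Fin r → G) → W))
    (r : ℕ) : Type _ :=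
  cocycles σ C r ⧸ (coboundaries σ C r).submoduleOf (cocycles σ C r)

variable [TopologicalSpace G] [TopologicalSpace W] [ContinuousAdd W] [ContinuousSMul ℝ W]

variable (G W) in
/-- Continuous inhomogeneous cochains: the continuous maps `G^r → W`. -/
def continuousCochains (r : ℕ) : Submodule ℝ ((Fin r → G) → W) where
  carrier := {c | Continuous c}
  add_mem' hc hd := Continuous.add hc hd
  zero_mem' := continuous_const
  smul_mem' a _ hc := Continuous.const_smul hc a

variable {E H : Type*} [NormedAddCommGroup E] [NormedSpace ℝ E] [TopologicalSpace H]
  (I : ModelWithCorners ℝ E H) [ChartedSpace H G]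

variable (G W) in
/-- Differentiable inhomogeneous cochains: the smooth maps from the product manifold `G^r`
to `W`. -/
def smoothCochains (r : ℕ) : Submodule ℝ ((Fin r → G) → W) :=
  smoothSubmodule (ModelWithCorners.pi fun _ : Fin r => I) (Fin r → G) W

/-- The continuous cohomology group `H^r(G, W)`. -/
abbrev ContinuousCohomology (σ : Representation ℝ G W) (r : ℕ) : Type _ :=
  Cohomology σ (continuousCochains G W) r

/-- The differentiable cohomology group `H^r_d(G, W)`. -/
abbrev DifferentiableCohomology (σ : Representation ℝ G W) (r : ℕ) : Type _ :=
  Cohomology σ (smoothCochains G W I) r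

end Cohomology

/-- The trivial `G`-module `ℝ` is a continuous module. -/
theorem isContinuousModule_trivial (G : Type*) [TopologicalSpace G] [Group G] :
    IsContinuousModule (Representation.trivial ℝ G ℝ) :=
  continuous_snd

end EquivCoh

end

set_option linter.unusedSectionVars false

noncomputable section

namespace EquivCoh

/-! ### Locally convex spaces: seminorms, functionals and the mean value inequality -/

section LocallyConvex

variable {V : Type*} [AddCommGroup V] [Module ℝ V]

/-! Properness makes it possible to average over `G` although `G` need not be compact. There is a
smooth `φ` on `X` with `∫ φ(g⁻¹x) dg = 1` for every `x` (left Haar measure) such that, for `x` in a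
given compact set, the integrand vanishes off a compact set of `g` (`exists_cutoff`). For a cocycle
`c` of degree `n + 1` put `(Tc)(α₁,…,αₙ)(x) = ∫ φ(h⁻¹(α₁⋯αₙ)⁻¹x) c(α₁,…,αₙ,h)(x) dh`. Integrate the
cocycle identity at `(α₁,…,αₙ₊₁,h)` against `φ(h⁻¹(α₁⋯αₙ₊₁)⁻¹x)`. Left invariance turns the term
containing `αₙ₊₁h` into a value of `Tc`, the term without `h` has total weight `1`, and the result
is `∂(Tc) = (-1)^(n+1) c` (`coboundary_cochainHomotopy`). Hence `c` is a coboundary.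

What remains is analysis: `Tc` must be a cochain of the same kind as `c`. Integrals are weak
integrals, which exist because closed absolutely convex hulls of compact sets are compact in a
quasi-complete space. Smoothness can be tested with continuous functionals: weakly bounded families
are bounded, so difference quotients are Cauchy and quasi-completeness supplies their limits
(`ScalarSmoothOn.hasDirDerivsOn`). This reduces the exponential law, which identifies smooth maps `N
→ C^∞(M, V)` with smooth maps `N × M → V`, largely to calculus of real functions, and differentiable
cochains follow. A continuous cochain is smooth in `x` but only continuous in the group variables;
for it, derivatives depending continuously on a parameter are followed through products and
integrals (`ParamDiff`).

The cutoff is built on `X/G`, which is Hausdorff and locally compact: a locally finite cover by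
images of supports of bump functions gives a sum `φ`, which is then divided by its integrals along
orbits. -/

theorem seminorm_bounded_of_forall_functional {ι : Type*} (p : Seminorm ℝ V) (b : ι → V)
    (h : ∀ f : V →ₗ[ℝ] ℝ, (∃ C, ∀ x, |f x| ≤ C * p x) → ∃ c, ∀ i, |f (b i)| ≤ c) :
    ∃ c, ∀ i, p (b i) ≤ c := by
  let : SeminormedAddCommGroup V := AddGroupSeminorm.toSeminormedAddCommGroup p.toAddGroupSeminorm
  let : NormedSpace ℝ V := ⟨fun a x => (map_smul_eq_mul p a x).le⟩
  have hn : ∀ x : V, ‖x‖ = p x := fun _ => rfl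
  -- The `b i` act by evaluation on the dual of the space seminormed by `p`. That dual is a Banach
  -- space even if `V` is not complete, so uniform boundedness applies there.
  obtain ⟨c, hc⟩ := banach_steinhaus (𝕜 := ℝ) (𝕜₂ := ℝ) (σ₁₂ := RingHom.id ℝ)
    (E := StrongDual ℝ V) (F := ℝ)
    (g := fun i => ContinuousLinearMap.apply ℝ ℝ (b i)) (fun f => by
      obtain ⟨c, hc⟩ := h f.toLinearMap ⟨‖f‖, fun x => f.le_opNorm x⟩
      exact ⟨c, fun i => hc i⟩)
  refine ⟨c, fun i => ?_⟩
  obtain ⟨g, hg1, hg2⟩ := exists_dual_vector'' ℝ (b i)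
  have h1 : ‖g (b i)‖ ≤ c * 1 := by
    have := (ContinuousLinearMap.apply ℝ ℝ (b i)).le_opNorm g
    refine this.trans (mul_le_mul (hc i) hg1 (norm_nonneg _) ((norm_nonneg _).trans (hc i)))
  rw [hg2] at h1
  have h2 : (‖b i‖ : ℝ) ≤ c := by simpa only [mul_one, norm_norm, RCLike.ofReal_real_eq_id, id] using h1
  exact h2

variable [TopologicalSpace V] [IsTopologicalAddGroup V] [ContinuousSMul ℝ V]
  [LocallyConvexSpace ℝ V]

theorem exists_dual_eq_seminorm {p : Seminorm ℝ V} (hp : Continuous p) (v : V) :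
    ∃ l : StrongDual ℝ V, (∀ x, |l x| ≤ p x) ∧ l v = p v := by
  let S : Submodule ℝ V := ℝ ∙ v
  by_cases hv : v = 0
  · exact ⟨0, fun x => by simp, by simp [hv]⟩
  let f : Module.Dual ℝ S := (p v) • (LinearEquiv.coord ℝ V v hv : S →ₗ[ℝ] ℝ)
  obtain ⟨g, hg, hg'⟩ := Module.Dual.exists_continuous_extension_of_le_seminorm_real S f hp
    (fun x => by
      obtain ⟨a, ha⟩ := Submodule.mem_span_singleton.1 x.2
      have hx : x = a • (⟨v, Submodule.mem_span_singleton_self v⟩ : S) := Subtype.ext ha.symm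
      rw [hx, map_smul]
      have : f ⟨v, Submodule.mem_span_singleton_self v⟩ = p v := by
        simp only [f, LinearMap.smul_apply]
        erw [LinearEquiv.coord_self]
        simp
      rw [this]
      simp only [Submodule.coe_smul, map_smul_eq_mul, Real.norm_eq_abs, smul_eq_mul]
      exact mul_le_mul_of_nonneg_right (le_abs_self a) (apply_nonneg p v))
  refine ⟨g, hg', ?_⟩
  have h2 := hg ⟨v, Submodule.mem_span_singleton_self v⟩
  have h3 : f ⟨v, Submodule.mem_span_singleton_self v⟩ = p v := by
    simp only [f, LinearMap.smul_apply]
    erw [LinearEquiv.coord_self]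
    simp
  exact h2.trans h3

theorem eq_of_forall_dual_eq [T2Space V] {x y : V} (h : ∀ l : StrongDual ℝ V, l x = l y) :
    x = y := by
  by_contra hxy
  obtain ⟨f, hf⟩ := geometric_hahn_banach_point_point hxy
  exact hf.ne (h f)

theorem tendsto_iff_seminorm {α : Type*} {l : Filter α} {f : α → V} {v : V} :
    Tendsto f l (𝓝 v) ↔
      ∀ p : Seminorm ℝ V, Continuous p → ∀ ε > 0, ∀ᶠ a in l, p (f a - v) < ε := by
  rw [(PolynormableSpace.withSeminorms ℝ V).tendsto_nhds]
  exact ⟨fun h p hp => h ⟨p, hp⟩, fun h p => h p.1 p.2⟩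

theorem isVonNBounded_iff_seminorm {s : Set V} :
    Bornology.IsVonNBounded ℝ s ↔ ∀ p : Seminorm ℝ V, Continuous p → ∃ c, ∀ x ∈ s, p x ≤ c := by
  rw [(PolynormableSpace.withSeminorms ℝ V).isVonNBounded_iff_seminorm_bddAbove]
  constructor
  · intro h p hp
    obtain ⟨c, hc⟩ := h ⟨p, hp⟩
    exact ⟨c, fun x hx => hc ⟨x, hx, rfl⟩⟩
  · intro h p
    obtain ⟨c, hc⟩ := h p.1 p.2
    exact ⟨c, by rintro _ ⟨x, hx, rfl⟩; exact hc x hx⟩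

/-- Weakly bounded families are bounded (Mackey). -/
theorem seminorm_bounded_of_weakly_bounded {ι : Type*} {b : ι → V}
    (h : ∀ l : StrongDual ℝ V, ∃ c, ∀ i, |l (b i)| ≤ c) {p : Seminorm ℝ V} (hp : Continuous p) :
    ∃ c, ∀ i, p (b i) ≤ c := by
  refine seminorm_bounded_of_forall_functional p b fun f ⟨C, hC⟩ => ?_
  have hf : Continuous f := by
    refine continuous_of_continuousAt_zero f ?_
    rw [ContinuousAt, map_zero]
    refine squeeze_zero_norm (a := fun x => C * p x) (fun x => hC x) ?_
    have h0 : Tendsto p (𝓝 0) (𝓝 0) := by simpa only [map_zero] using hp.tendsto 0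
    simpa only [mul_zero] using h0.const_mul C
  exact h ⟨f, hf⟩

theorem HasDirDerivAt.comp_line {E F : Type*} [AddCommGroup E] [Module ℝ E] [AddCommGroup F]
    [Module ℝ F] [TopologicalSpace F] {f : E → F} {f' : F} {x h : E} {s : ℝ}
    (hf : HasDirDerivAt f f' (x + s • h) h) :
    HasDirDerivAt (fun t : ℝ => f (x + t • h)) f' s 1 := by
  refine Tendsto.congr (fun t => ?_) hf
  simp [add_smul, add_assoc]

theorem HasDirDerivAt.clm_comp {E F F' : Type*} [AddCommGroup E] [Module ℝ E] [AddCommGroup F]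
    [Module ℝ F] [TopologicalSpace F] [AddCommGroup F'] [Module ℝ F'] [TopologicalSpace F']
    {f : E → F} {f' : F} {x h : E} (hf : HasDirDerivAt f f' x h) (L : F →L[ℝ] F') :
    HasDirDerivAt (fun y => L (f y)) (L f') x h := by
  have := (L.continuous.tendsto _).comp hf
  simpa [HasDirDerivAt, Function.comp_def] using this

theorem hasDirDerivAt_real_iff {F : Type*} [NormedAddCommGroup F] [NormedSpace ℝ F] {f : ℝ → F}
    {f' : F} {s : ℝ} : HasDirDerivAt f f' s 1 ↔ HasDerivAt f f' s := by
  rw [hasDerivAt_iff_tendsto_slope_zero]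
  simp [HasDirDerivAt]

/-- The mean value inequality for the difference quotients of a curve. -/
theorem seminorm_slope_sub_le {p : Seminorm ℝ V} (hp : Continuous p) {f f' : ℝ → V} {d : V}
    {c t : ℝ} (ht : t ≠ 0) (hf : ∀ s ∈ uIcc 0 t, HasDirDerivAt f (f' s) s 1)
    (hc : ∀ s ∈ uIcc 0 t, p (f' s - d) ≤ c) : p (t⁻¹ • (f t - f 0) - d) ≤ c := by
  -- A functional dominated by `p` and attaining it at the error vector reduces the claim to the
  -- real mean value inequality for `l ∘ f` minus its linear part.
  obtain ⟨l, hl, hlv⟩ := exists_dual_eq_seminorm hp (t⁻¹ • (f t - f 0) - d)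
  rw [← hlv]
  have h1 : ∀ s ∈ uIcc 0 t, HasDerivWithinAt (fun s => l (f s) - s * l d) (l (f' s) - l d)
      (uIcc 0 t) s := fun s hs => by
    have h2 := (hasDirDerivAt_real_iff.1 ((hf s hs).clm_comp l))
    have h3 : HasDerivAt (fun s : ℝ => s * l d) (l d) s := by
      simpa using (hasDerivAt_id s).mul_const (l d)
    exact (h2.sub h3).hasDerivWithinAt
  have h2 := Convex.norm_image_sub_le_of_norm_hasDerivWithin_le (C := c) h1 (fun s hs => by
    rw [← map_sub, Real.norm_eq_abs]
    exact (hl _).trans (hc s hs)) (convex_uIcc 0 t) left_mem_uIcc right_mem_uIcc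
  have h3 : l (t⁻¹ • (f t - f 0) - d) = t⁻¹ * ((l (f t) - t * l d) - (l (f 0) - 0 * l d)) := by
    simp only [map_sub, map_smul, smul_eq_mul]
    field_simp
    ring
  rw [h3]
  refine (le_abs_self _).trans ?_
  rw [abs_mul, abs_inv, inv_mul_le_iff₀ (abs_pos.2 ht)]
  simpa [mul_comm] using h2

end LocallyConvex

/-! ### Integrals of compactly supported continuous functions with values in a locally convex space -/

section Integral

open MeasureTheory

variable {V : Type*} [AddCommGroup V] [Module ℝ V] [UniformSpace V] [IsUniformAddGroup V]
  [ContinuousSMul ℝ V] [LocallyConvexSpace ℝ V]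
  {G : Type*} [TopologicalSpace G] [MeasurableSpace G] (μ : Measure G)

open Classical in
/-- The weak integral of `f`, the vector `I` with `l I = ∫ l ∘ f` for all continuous linear
functionals `l` (and `0` if there is none). -/
def weakIntegral (f : G → V) : V :=
  if h : ∃ I : V, ∀ l : StrongDual ℝ V, l I = ∫ g, l (f g) ∂μ then h.choose else 0

variable {μ}

theorem weakIntegral_eq [T2Space V] {f : G → V} {I : V}
    (h : ∀ l : StrongDual ℝ V, l I = ∫ g, l (f g) ∂μ) : weakIntegral μ f = I := by
  have h' : ∃ I : V, ∀ l : StrongDual ℝ V, l I = ∫ g, l (f g) ∂μ := ⟨I, h⟩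
  rw [weakIntegral, dif_pos h']
  exact eq_of_forall_dual_eq fun l => (h'.choose_spec l).trans (h l).symm

variable [OpensMeasurableSpace G] [IsFiniteMeasureOnCompacts μ] [T2Space G]

theorem integrable_dual {f : G → V} (hf : Continuous f) {K : Set G} (hK : IsCompact K)
    (h0 : ∀ g ∉ K, f g = 0) (l : StrongDual ℝ V) : Integrable (fun g => l (f g)) μ :=
  (l.continuous.comp hf).integrable_of_hasCompactSupport
    (HasCompactSupport.intro hK fun g hg => by simp [h0 g hg])

variable [QuasiCompleteSpace ℝ V]

/-- The average of `f` over `K` should lie in the closed absolutely convex hull of `f(K) ∪ {0}`,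
which is compact by quasi-completeness. Finitely many functionals can be satisfied there by
averaging in a finite-dimensional space; compactness then yields one vector serving all of them. -/
theorem exists_weakIntegral {f : G → V} (hf : Continuous f) {K : Set G} (hK : IsCompact K)
    (h0 : ∀ g ∉ K, f g = 0) : ∃ I : V, ∀ l : StrongDual ℝ V, l I = ∫ g, l (f g) ∂μ := by
  let S : Set V := insert 0 (f '' K)
  have hS : IsCompact S := (hK.image hf).insert 0
  let C : Set V := closedAbsConvexHull ℝ S
  have hC : IsCompact C := isCompact_closedAbsConvexHull_of_totallyBounded hS.totallyBounded
  have hSC : S ⊆ C := subset_closedAbsConvexHull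
  have hCc : Convex ℝ C := absConvex_convexClosedHull.2
  have hint := integrable_dual (μ := μ) hf hK h0
  have hfin : ∀ u : Finset (StrongDual ℝ V),
      (C ∩ ⋂ l ∈ u, {v : V | (μ K).toReal * l v = ∫ g, l (f g) ∂μ}).Nonempty := by
    intro u
    have hKf : μ K ≠ ⊤ := hK.measure_lt_top.ne
    have hset : ∀ l : StrongDual ℝ V, ∫ g in K, l (f g) ∂μ = ∫ g, l (f g) ∂μ := fun l =>
      setIntegral_eq_integral_of_forall_compl_eq_zero fun g hg => by simp [h0 g hg]
    -- The average over a null set is meaningless; there all the integrals vanish and `0` serves.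
    by_cases hK0 : μ K = 0
    · refine ⟨0, hSC (mem_insert _ _), ?_⟩
      simp only [mem_iInter]
      intro l _
      change (μ K).toReal * l 0 = _
      rw [← hset l, Measure.restrict_eq_zero.2 hK0]
      simp
    -- The image of the hull under finitely many functionals is convex and compact, hence contains
    -- the average of `T ∘ f` over `K`.
    let T : V →L[ℝ] (u → ℝ) := ContinuousLinearMap.pi fun l => l.1
    have hT := Convex.set_average_mem (μ := μ) (t := K) (s := T '' C) (f := fun g => T (f g))
      (hCc.linear_image T.toLinearMap) (hC.image T.continuous).isClosed hK0 hKf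
      (Eventually.of_forall fun g => ⟨f g, by
        by_cases hg : g ∈ K
        · exact hSC (mem_insert_of_mem _ ⟨g, hg, rfl⟩)
        · rw [h0 g hg]; exact hSC (mem_insert _ _), rfl⟩)
      (Integrable.integrableOn (Integrable.of_eval fun l => hint l.1))
    obtain ⟨v, hv, hTv⟩ := hT
    refine ⟨v, hv, ?_⟩
    simp only [mem_iInter]
    intro l hl
    have h1 := congrFun hTv ⟨l, hl⟩
    rw [setAverage_eq] at h1
    have h2 : (∫ g in K, T (f g) ∂μ) ⟨l, hl⟩ = ∫ g in K, l (f g) ∂μ :=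
      
      eval_integral (f := fun g (i : u) => (i : StrongDual ℝ V) (f g)) (μ := μ.restrict K)
        (fun i => (hint i.1).integrableOn) ⟨l, hl⟩
    simp only [Pi.smul_apply, h2, hset, smul_eq_mul] at h1
    change (μ K).toReal * l v = _
    have h3 : l v = (μ.real K)⁻¹ * ∫ g, l (f g) ∂μ := h1
    rw [h3, ← measureReal_def, mul_inv_cancel_left₀]
    exact (ENNReal.toReal_ne_zero.2 ⟨hK0, hKf⟩)
  obtain ⟨v, -, hv⟩ := hC.inter_iInter_nonempty
    (fun l : StrongDual ℝ V => {v : V | (μ K).toReal * l v = ∫ g, l (f g) ∂μ})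
    (fun l => isClosed_eq (continuous_const.mul l.continuous) continuous_const) hfin
  refine ⟨(μ K).toReal • v, fun l => ?_⟩
  rw [map_smul]
  exact mem_iInter.1 hv l

theorem dual_weakIntegral {f : G → V} (hf : Continuous f) {K : Set G} (hK : IsCompact K)
    (h0 : ∀ g ∉ K, f g = 0) (l : StrongDual ℝ V) :
    l (weakIntegral μ f) = ∫ g, l (f g) ∂μ := by
  have h' := exists_weakIntegral (μ := μ) hf hK h0
  rw [weakIntegral, dif_pos h']
  exact h'.choose_spec l

theorem seminorm_weakIntegral_sub_le {f f' : G → V} (hf : Continuous f) (hf' : Continuous f')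
    {K : Set G} (hK : IsCompact K) (h0 : ∀ g ∉ K, f g = 0) (h0' : ∀ g ∉ K, f' g = 0)
    {p : Seminorm ℝ V} (hp : Continuous p) {c : ℝ} (hc : ∀ g ∈ K, p (f g - f' g) ≤ c) :
    p (weakIntegral μ f - weakIntegral μ f') ≤ c * (μ K).toReal := by
  obtain ⟨l, hl, hlv⟩ := exists_dual_eq_seminorm hp (weakIntegral μ f - weakIntegral μ f')
  rw [← hlv, map_sub, dual_weakIntegral (μ := μ) hf hK h0, dual_weakIntegral (μ := μ) hf' hK h0',
    ← integral_sub (integrable_dual (μ := μ) hf hK h0 l) (integrable_dual (μ := μ) hf' hK h0' l),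
    ← setIntegral_eq_integral_of_forall_compl_eq_zero (s := K)
      (fun g hg => by simp [h0 g hg, h0' g hg])]
  refine (le_abs_self _).trans ?_
  refine norm_setIntegral_le_of_norm_le_const (μ := μ) (f := fun g => l (f g) - l (f' g))
    hK.measure_lt_top fun g hg => ?_
  rw [← map_sub]
  exact (hl _).trans (hc g hg)

/-- Continuity of integrals with respect to a parameter. -/
theorem continuousAt_weakIntegral {P : Type*} [TopologicalSpace P] {f : P → G → V}
    (hf : Continuous fun q : P × G => f q.1 q.2) {p₀ : P} {N : Set P} (hN : N ∈ 𝓝 p₀)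
    {K : Set G} (hK : IsCompact K) (h0 : ∀ p ∈ N, ∀ g ∉ K, f p g = 0) :
    ContinuousAt (fun p => weakIntegral μ (f p)) p₀ := by
  rw [ContinuousAt, tendsto_iff_seminorm]
  intro p hp ε hε
  have hfc : ∀ p, Continuous (f p) := fun p => hf.comp (by fun_prop : Continuous fun g => (p, g))
  -- The summand `1` covers the case `μ K = 0` and makes the final bound strict.
  let δ : ℝ := ε / ((μ K).toReal + 1)
  have hm : 0 ≤ (μ K).toReal := ENNReal.toReal_nonneg
  have hδ : 0 < δ := div_pos hε (by linarith)
  have h1 : ∀ᶠ a in 𝓝 p₀, ∀ g ∈ K, p (f a g - f p₀ g) < δ := by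
    refine hK.eventually_forall_of_forall_eventually fun g _ => ?_
    have h2 : Continuous fun z : P × G => p (f z.1 z.2 - f p₀ z.2) :=
      hp.comp (hf.sub ((hfc p₀).comp continuous_snd))
    refine h2.continuousAt.eventually_lt continuousAt_const ?_
    simpa using hδ
  filter_upwards [h1, hN] with a ha haN
  refine (seminorm_weakIntegral_sub_le (μ := μ) (hfc a) (hfc p₀) hK (h0 a haN) (h0 p₀ (mem_of_mem_nhds hN))
    hp fun g hg => (ha g hg).le).trans_lt ?_
  rw [div_mul_eq_mul_div, div_lt_iff₀ (by linarith)]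
  nlinarith

end Integral

/-! ### Iterated directional derivatives of real functions -/

section IterDeriv

variable {E : Type*} [NormedAddCommGroup E] [NormedSpace ℝ E]

/-- The iterated directional derivatives of a real-valued function. -/
def iterDeriv (f : E → ℝ) : ∀ k : ℕ, E → (Fin k → E) → ℝ
  | 0, x, _ => f x
  | k + 1, x, v => fderiv ℝ (fun y => iterDeriv f k y (Fin.tail v)) x (v 0)

theorem iterDeriv_succ (f : E → ℝ) (k : ℕ) (x : E) (v : Fin (k + 1) → E) :
    iterDeriv f (k + 1) x v = fderiv ℝ (fun y => iterDeriv f k y (Fin.tail v)) x (v 0) := rfl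

theorem iterDeriv_congr {f g : E → ℝ} (k : ℕ) {x : E} (h : f =ᶠ[𝓝 x] g) (v : Fin k → E) :
    iterDeriv f k x v = iterDeriv g k x v := by
  induction k generalizing x with
  | zero => exact h.eq_of_nhds
  | succ k ih =>
    rw [iterDeriv_succ, iterDeriv_succ]
    have h1 : (fun y => iterDeriv f k y (Fin.tail v)) =ᶠ[𝓝 x]
        fun y => iterDeriv g k y (Fin.tail v) := by
      filter_upwards [h.eventuallyEq_nhds] with y hy using ih hy _
    rw [h1.fderiv_eq]

/-- The claim includes the directions among the variables, so that the inductive step, which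
differentiates in the point with the remaining directions as further parameters, is again of the
same form. -/
theorem contDiffAt_iterDeriv_param {A : Type*} [NormedAddCommGroup A] [NormedSpace ℝ A]
    {F : A → E → ℝ} (k : ℕ) {a : A} {x : E} (v : Fin k → E)
    (h : ContDiffAt ℝ ∞ (fun p : A × E => F p.1 p.2) (a, x)) :
    ContDiffAt ℝ ∞ (fun p : A × E × (Fin k → E) => iterDeriv (F p.1) k p.2.1 p.2.2)
      (a, x, v) := by
  induction k generalizing a x with
  | zero =>
    exact ContDiffAt.comp (a, x, v) (g := fun p : A × E => F p.1 p.2)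
      (f := fun p : A × E × (Fin 0 → E) => (p.1, p.2.1)) h (by fun_prop)
  | succ k ih =>
    simp only [iterDeriv_succ]
    refine ContDiffAt.clm_apply (ContDiffAt.fderiv (n := ∞)
      (f := fun (p : A × E × (Fin (k + 1) → E)) y => iterDeriv (F p.1) k y (Fin.tail p.2.2))
      (g := fun p => p.2.1) ?_ (by fun_prop) (by simp)) (by fun_prop)
    have h1 := ih (Fin.tail v) h
    refine ContDiffAt.comp (((a, x, v), x) : (A × E × (Fin (k + 1) → E)) × E)
      (g := fun p : A × E × (Fin k → E) => iterDeriv (F p.1) k p.2.1 p.2.2)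
      (f := fun q : (A × E × (Fin (k + 1) → E)) × E => (q.1.1, q.2, Fin.tail q.1.2.2)) h1 ?_
    unfold Fin.tail
    fun_prop

theorem contDiffAt_iterDeriv {f : E → ℝ} (k : ℕ) {x : E} (v : Fin k → E)
    (h : ContDiffAt ℝ ∞ f x) :
    ContDiffAt ℝ ∞ (fun p : E × (Fin k → E) => iterDeriv f k p.1 p.2) (x, v) := by
  have h1 := contDiffAt_iterDeriv_param (A := ℝ) (F := fun _ => f) k (a := 0) v
    (ContDiffAt.comp ((0 : ℝ), x) (g := f) (f := Prod.snd) h contDiffAt_snd)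
  exact ContDiffAt.comp (x, v)
    (g := fun p : ℝ × E × (Fin k → E) => iterDeriv f k p.2.1 p.2.2)
    (f := fun p : E × (Fin k → E) => ((0 : ℝ), p)) h1 (by fun_prop)

/-- Partial derivatives in different variables commute. -/
theorem fderiv_fderiv_comm {A : Type*} [NormedAddCommGroup A] [NormedSpace ℝ A]
    {F : A → E → ℝ} {a : A} {x : E} (h : ContDiffAt ℝ ∞ (fun p : A × E => F p.1 p.2) (a, x))
    (b : A) (w : E) :
    fderiv ℝ (fun a' => fderiv ℝ (F a') x w) a b =
      fderiv ℝ (fun x' => fderiv ℝ (fun a' => F a' x') a b) x w := by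
  set f : A × E → ℝ := fun p => F p.1 p.2 with hf
  have hev : ∀ᶠ p in 𝓝 (a, x), DifferentiableAt ℝ f p :=
    (h.of_le (m := 1) (by simp)).eventually (by decide) |>.mono fun p hp => hp.differentiableAt (by simp)
  have h2 : ∀ p, DifferentiableAt ℝ f p → fderiv ℝ (F p.1) p.2 w = fderiv ℝ f p (0, w) := by
    intro p hp
    have h3 : HasFDerivAt (F p.1) ((fderiv ℝ f p).comp (ContinuousLinearMap.inr ℝ A E)) p.2 :=
      HasFDerivAt.comp (g := f) (f := fun y => (p.1, y)) p.2 hp.hasFDerivAt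
        (hasFDerivAt_prodMk_right p.1 p.2)
    rw [h3.fderiv]; simp
  have h2' : ∀ p, DifferentiableAt ℝ f p →
      fderiv ℝ (fun a' => F a' p.2) p.1 b = fderiv ℝ f p (b, 0) := by
    intro p hp
    have h3 : HasFDerivAt (fun a' => F a' p.2)
        ((fderiv ℝ f p).comp (ContinuousLinearMap.inl ℝ A E)) p.1 :=
      HasFDerivAt.comp (g := f) (f := fun y => (y, p.2)) p.1 hp.hasFDerivAt
        (hasFDerivAt_prodMk_left p.1 p.2)
    rw [h3.fderiv]; simp
  have hd : DifferentiableAt ℝ (fderiv ℝ f) (a, x) :=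
    (h.fderiv_right (m := ∞) (by simp)).differentiableAt (by simp)
  have e1 : (fun a' => fderiv ℝ (F a') x w) =ᶠ[𝓝 a] fun a' => fderiv ℝ f (a', x) (0, w) := by
    have hc : Tendsto (fun a' : A => (a', x)) (𝓝 a) (𝓝 (a, x)) := by
      have : Continuous fun a' : A => (a', x) := by fun_prop
      exact this.tendsto a
    filter_upwards [hc.eventually hev] with a' ha' using h2 (a', x) ha'
  have e2 : (fun x' => fderiv ℝ (fun a' => F a' x') a b) =ᶠ[𝓝 x]
      fun x' => fderiv ℝ f (a, x') (b, 0) := by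
    have hc : Tendsto (fun x' : E => (a, x')) (𝓝 x) (𝓝 (a, x)) := by
      have : Continuous fun x' : E => (a, x') := by fun_prop
      exact this.tendsto x
    filter_upwards [hc.eventually hev] with x' hx' using h2' (a, x') hx'
  rw [e1.fderiv_eq, e2.fderiv_eq]
  have d1 : HasFDerivAt (fun a' => fderiv ℝ f (a', x) (0, w))
      (((ContinuousLinearMap.apply ℝ ℝ ((0, w) : A × E)).comp (fderiv ℝ (fderiv ℝ f) (a, x))).comp
        (ContinuousLinearMap.inl ℝ A E)) a :=
    ((ContinuousLinearMap.apply ℝ ℝ ((0, w) : A × E)).hasFDerivAt.comp a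
      (HasFDerivAt.comp (g := fderiv ℝ f) (f := fun y => (y, x)) a hd.hasFDerivAt
        (hasFDerivAt_prodMk_left a x)))
  have d2 : HasFDerivAt (fun x' => fderiv ℝ f (a, x') (b, 0))
      (((ContinuousLinearMap.apply ℝ ℝ ((b, 0) : A × E)).comp (fderiv ℝ (fderiv ℝ f) (a, x))).comp
        (ContinuousLinearMap.inr ℝ A E)) x :=
    ((ContinuousLinearMap.apply ℝ ℝ ((b, 0) : A × E)).hasFDerivAt.comp x
      (HasFDerivAt.comp (g := fderiv ℝ f) (f := fun y => (a, y)) x hd.hasFDerivAt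
        (hasFDerivAt_prodMk_right a x)))
  rw [d1.fderiv, d2.fderiv]
  have hs : IsSymmSndFDerivAt ℝ f (a, x) := h.isSymmSndFDerivAt (by simpa using ENat.LEInfty.out)
  simpa using hs (b, 0) (0, w)

/-- Symmetry of the second derivative moves the parameter derivative past one directional derivative
at a time. Smoothness is required at all `x'` near `x` because the inductive identity is itself
differentiated in `x`. -/
theorem fderiv_iterDeriv_comm {A : Type*} [NormedAddCommGroup A] [NormedSpace ℝ A]
    {F : A → E → ℝ} (k : ℕ) {a : A} {x : E}
    (h : ∀ᶠ x' in 𝓝 x, ContDiffAt ℝ ∞ (fun p : A × E => F p.1 p.2) (a, x'))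
    (b : A) (v : Fin k → E) :
    fderiv ℝ (fun a' => iterDeriv (F a') k x v) a b =
      iterDeriv (fun x' => fderiv ℝ (fun a' => F a' x') a b) k x v := by
  induction k generalizing x with
  | zero => rfl
  | succ k ih =>
    have h0 := contDiffAt_iterDeriv_param k (Fin.tail v) h.self_of_nhds
    have h1 : ContDiffAt ℝ ∞ (fun p : A × E => iterDeriv (F p.1) k p.2 (Fin.tail v)) (a, x) :=
      ContDiffAt.comp (a, x)
        (g := fun p : A × E × (Fin k → E) => iterDeriv (F p.1) k p.2.1 p.2.2)
        (f := fun p : A × E => (p.1, p.2, Fin.tail v)) h0 (by fun_prop)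
    have h2 := fderiv_fderiv_comm (F := fun a' y => iterDeriv (F a') k y (Fin.tail v)) h1 b (v 0)
    simp only [iterDeriv_succ]
    rw [h2]
    have h3 : (fun x' => fderiv ℝ (fun a' => iterDeriv (F a') k x' (Fin.tail v)) a b) =ᶠ[𝓝 x]
        fun x' => iterDeriv (fun x' => fderiv ℝ (fun a' => F a' x') a b) k x' (Fin.tail v) := by
      filter_upwards [h.eventually_nhds] with x' hx' using ih hx' _
    rw [h3.fderiv_eq]

theorem hasDirDerivAt_of_hasFDerivAt {F : Type*} [NormedAddCommGroup F] [NormedSpace ℝ F]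
    {f : E → F} {f' : E →L[ℝ] F} {x : E} (h : HasFDerivAt f f' x) (v : E) :
    HasDirDerivAt f (f' v) x v := by
  have h1 := (h.hasLineDerivAt v)
  have h2 := hasDerivAt_iff_tendsto_slope_zero.1 h1
  simpa [HasDirDerivAt] using h2

end IterDeriv

/-! ### Scalarwise smooth functions -/

section Scalarwise

variable {E : Type*} [NormedAddCommGroup E] [NormedSpace ℝ E]
  {V : Type*} [AddCommGroup V] [Module ℝ V] [UniformSpace V]

/-- All functions `l ∘ f`, for `l` in the dual space, are smooth on `U`. -/
def ScalarSmoothOn (U : Set E) (f : E → V) : Prop :=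
  ∀ l : StrongDual ℝ V, ContDiffOn ℝ ∞ (fun x => l (f x)) U

variable [IsUniformAddGroup V] [ContinuousSMul ℝ V] [LocallyConvexSpace ℝ V] {U : Set E}

/-- By the mean value inequality for `l ∘ f` on a compact ball, the quotients `(f y - f x) / ‖y -
x‖` are weakly bounded, hence bounded for every continuous seminorm. Thus `p (f y - f x) ≤ c ‖y -
x‖` near `x`. -/
theorem ScalarSmoothOn.continuousOn [FiniteDimensional ℝ E] (hU : IsOpen U) {f : E → V}
    (hf : ScalarSmoothOn U f) : ContinuousOn f U := by
  intro x hx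
  refine ContinuousAt.continuousWithinAt ?_
  obtain ⟨r, hr, hrU⟩ := Metric.nhds_basis_closedBall.mem_iff.1 (hU.mem_nhds hx)
  rw [ContinuousAt, tendsto_iff_seminorm]
  intro p hp ε hε
  obtain ⟨c, hc⟩ := seminorm_bounded_of_weakly_bounded
    (b := fun y : Metric.closedBall x r => ‖(y : E) - x‖⁻¹ • (f y - f x)) (fun l => by
      have h1 : ContinuousOn (fun y => ‖fderiv ℝ (fun z => l (f z)) y‖) (Metric.closedBall x r) :=
        (((hf l).continuousOn_fderiv_of_isOpen hU (by simp)).mono hrU).norm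
      obtain ⟨M, hM⟩ := (isCompact_closedBall x r).bddAbove_image h1
      refine ⟨M, fun y => ?_⟩
      have h2 := (convex_closedBall x r).norm_image_sub_le_of_norm_fderiv_le (𝕜 := ℝ)
        (f := fun z => l (f z)) (C := M)
        (fun z hz => ((hf l).contDiffAt (hU.mem_nhds (hrU hz))).differentiableAt (by simp))
        (fun z hz => hM ⟨z, hz, rfl⟩) (Metric.mem_closedBall_self hr.le) y.2
      rw [map_smul, map_sub, smul_eq_mul, abs_mul, abs_inv, abs_norm]
      -- At `y = x` the inverse is `0` by convention, so the quotient is `0`.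
      by_cases hy : ‖(y : E) - x‖ = 0
      · rw [hy]
        simpa using (norm_nonneg _).trans (hM ⟨x, Metric.mem_closedBall_self hr.le, rfl⟩)
      · rw [inv_mul_le_iff₀ (lt_of_le_of_ne (norm_nonneg _) (Ne.symm hy)), mul_comm]
        exact h2) hp
  have h0 : Tendsto (fun y => c * ‖y - x‖) (𝓝 x) (𝓝 0) := by
    have : Continuous fun y => c * ‖y - x‖ := by fun_prop
    simpa using this.tendsto x
  filter_upwards [Metric.closedBall_mem_nhds x hr, h0.eventually_lt_const hε] with y hy hy2
  by_cases hyx : y = x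
  · simpa [hyx] using hε
  have hpos : 0 < ‖y - x‖ := norm_pos_iff.2 (sub_ne_zero.2 hyx)
  have h3 := hc ⟨y, hy⟩
  simp only [map_smul_eq_mul, norm_inv, norm_norm] at h3
  rw [inv_mul_le_iff₀ hpos] at h3
  linarith [mul_comm c ‖y - x‖]

/-- A second-order Taylor estimate from two uses of the mean value inequality. The sharp factor
`1/2` is immaterial: only a bound uniform in `t` is needed, and it may depend on `g`. -/
theorem exists_quadratic_bound {g : ℝ → ℝ} {r : ℝ} (hr : 0 < r) {S : Set ℝ} (hS : IsOpen S)
    (hrS : Icc (-r) r ⊆ S) (hg : ContDiffOn ℝ ∞ g S) :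
    ∃ M, 0 ≤ M ∧ ∀ t ∈ Icc (-r) r, |g t - g 0 - t * deriv g 0| ≤ M * |t| * |t| := by
  have hg' : ContDiffOn ℝ ∞ (deriv g) S := hg.deriv_of_isOpen hS (by simp)
  have h1 : ContinuousOn (fun t => ‖deriv (deriv g) t‖) (Icc (-r) r) :=
    ((hg'.continuousOn_deriv_of_isOpen hS (by simp)).mono hrS).norm
  obtain ⟨M, hM⟩ := isCompact_Icc.bddAbove_image h1
  have h00 : (0 : ℝ) ∈ Icc (-r) r := ⟨by linarith, hr.le⟩
  have hM0 : 0 ≤ M := (norm_nonneg _).trans (hM ⟨0, h00, rfl⟩)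
  refine ⟨M, hM0, fun t ht => ?_⟩
  have hsub : uIcc 0 t ⊆ Icc (-r) r := uIcc_subset_Icc h00 ht
  have h2 : ∀ s ∈ uIcc 0 t, |deriv g s - deriv g 0| ≤ M * |t| := by
    intro s hs
    have := (convex_Icc (-r) r).norm_image_sub_le_of_norm_deriv_le (f := deriv g) (C := M)
      (fun z hz => (hg'.contDiffAt (hS.mem_nhds (hrS hz))).differentiableAt (by simp))
      (fun z hz => hM ⟨z, hz, rfl⟩) h00 (hsub hs)
    refine this.trans (mul_le_mul_of_nonneg_left ?_ hM0)
    have := abs_sub_left_of_mem_uIcc hs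
    simpa using this
  have h3 := Convex.norm_image_sub_le_of_norm_hasDerivWithin_le (C := M * |t|)
    (f := fun s => g s - s * deriv g 0) (f' := fun s => deriv g s - deriv g 0) (s := uIcc 0 t)
    (fun s hs => by
      have h4 := ((hg.contDiffAt (hS.mem_nhds (hrS (hsub hs)))).differentiableAt
        (by simp)).hasDerivAt
      have h5 : HasDerivAt (fun s : ℝ => s * deriv g 0) (deriv g 0) s := by
        simpa using (hasDerivAt_id s).mul_const (deriv g 0)
      exact (h4.sub h5).hasDerivWithinAt)
    h2 (convex_uIcc 0 t) left_mem_uIcc right_mem_uIcc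
  simp only [zero_mul, sub_zero, Real.norm_eq_abs] at h3
  convert h3 using 2
  ring

/-- For each `l`, the difference quotients `q t` satisfy `|l (q t) - a| ≤ M |t|`, so `(q s - q t) /
(|s| + |t|)` is weakly bounded and therefore bounded. Hence `q` is Cauchy as `t → 0`, and
quasi-completeness provides the limit. -/
theorem ScalarSmoothOn.exists_dirDeriv [T2Space V] [QuasiCompleteSpace ℝ V] (hU : IsOpen U)
    {f : E → V} (hf : ScalarSmoothOn U f) {x : E} (hx : x ∈ U) (h : E) :
    ∃ d : V, HasDirDerivAt f d x h ∧ ∀ l : StrongDual ℝ V, l d = fderiv ℝ (fun y => l (f y)) x h := by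
  suffices h1 : ∃ d : V, HasDirDerivAt f d x h by
    obtain ⟨d, hd⟩ := h1
    refine ⟨d, hd, fun l => ?_⟩
    exact tendsto_nhds_unique (hd.clm_comp l) (hasDirDerivAt_of_hasFDerivAt
      (((hf l).contDiffAt (hU.mem_nhds hx)).differentiableAt (by simp)).hasFDerivAt h)
  have hcont : Continuous fun t : ℝ => x + t • h := by fun_prop
  set S : Set ℝ := (fun t : ℝ => x + t • h) ⁻¹' U with hSdef
  have hS : IsOpen S := hU.preimage hcont
  have h0S : (0 : ℝ) ∈ S := by simpa [hSdef] using hx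
  obtain ⟨r, hr, hrS⟩ := Metric.nhds_basis_closedBall.mem_iff.1 (hS.mem_nhds h0S)
  rw [Real.closedBall_eq_Icc, zero_sub, zero_add] at hrS
  set q : ℝ → V := fun t => t⁻¹ • (f (x + t • h) - f x) with hq
  have hg : ∀ l : StrongDual ℝ V, ContDiffOn ℝ ∞ (fun t : ℝ => l (f (x + t • h))) S := fun l =>
    (hf l).comp (by fun_prop) (fun t ht => ht)
  let I := {z : ℝ × ℝ // z.1 ∈ Icc (-r) r ∧ z.2 ∈ Icc (-r) r ∧ z.1 ≠ 0 ∧ z.2 ≠ 0}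
  have hbd : ∀ p : Seminorm ℝ V, Continuous p →
      ∃ c, ∀ i : I, p (q i.1.1 - q i.1.2) ≤ c * (|i.1.1| + |i.1.2|) := by
    intro p hp
    obtain ⟨c, hc⟩ := seminorm_bounded_of_weakly_bounded
      (b := fun i : I => (|i.1.1| + |i.1.2|)⁻¹ • (q i.1.1 - q i.1.2)) (fun l => by
        obtain ⟨M, hM0, hM⟩ := exists_quadratic_bound hr hS hrS (hg l)
        set a := deriv (fun t : ℝ => l (f (x + t • h))) 0 with ha
        have h1 : ∀ t ∈ Icc (-r) r, t ≠ 0 → |l (q t) - a| ≤ M * |t| := by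
          intro t ht ht0
          have h2 := hM t ht
          have h3 : l (q t) - a =
              t⁻¹ * (l (f (x + t • h)) - l (f (x + (0 : ℝ) • h)) - t * a) := by
            simp only [hq, map_smul, map_sub, smul_eq_mul, zero_smul, add_zero]
            field_simp
          rw [h3, abs_mul, abs_inv, inv_mul_le_iff₀ (abs_pos.2 ht0)]
          linarith
        refine ⟨M, fun i => ?_⟩
        obtain ⟨⟨s, t⟩, hs, ht, hs0, ht0⟩ := i
        have hpos : 0 < |s| + |t| := add_pos (abs_pos.2 hs0) (abs_pos.2 ht0)
        simp only [map_smul, map_sub, smul_eq_mul]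
        rw [abs_mul, abs_inv, abs_of_pos hpos, inv_mul_le_iff₀ hpos]
        have h4 := abs_sub (l (q s) - a) (l (q t) - a)
        rw [sub_sub_sub_cancel_right] at h4
        linarith [h1 s hs hs0, h1 t ht ht0]) hp
    refine ⟨c, fun i => ?_⟩
    have hpos : 0 < |i.1.1| + |i.1.2| := add_pos (abs_pos.2 i.2.2.2.1) (abs_pos.2 i.2.2.2.2)
    have h1 := hc i
    rw [map_smul_eq_mul, norm_inv, Real.norm_eq_abs, abs_of_pos hpos,
      inv_mul_le_iff₀ hpos] at h1
    linarith [mul_comm c (|i.1.1| + |i.1.2|)]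
  set T : Set ℝ := Icc (-r) r \ {0} with hT
  have hTm : T ∈ 𝓝[≠] (0 : ℝ) := by
    rw [hT, sdiff_eq]
    exact inter_mem (mem_nhdsWithin_of_mem_nhds (Icc_mem_nhds (by linarith) hr)) self_mem_nhdsWithin
  have hcauchy : Cauchy (map q (𝓝[≠] 0)) := by
    rw [IsUniformAddGroup.cauchy_map_iff_tendsto]
    refine ⟨inferInstance, ?_⟩
    rw [tendsto_iff_seminorm]
    intro p hp ε hε
    obtain ⟨c, hc⟩ := hbd p hp
    have h1 : Tendsto (fun z : ℝ × ℝ => c * (|z.1| + |z.2|)) (𝓝[≠] 0 ×ˢ 𝓝[≠] 0) (𝓝 0) := by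
      have h2 : Continuous fun z : ℝ × ℝ => c * (|z.1| + |z.2|) := by fun_prop
      have h3 := h2.tendsto (0, 0)
      simp only [abs_zero, add_zero, mul_zero, nhds_prod_eq] at h3
      exact h3.mono_left (Filter.prod_mono nhdsWithin_le_nhds nhdsWithin_le_nhds)
    filter_upwards [h1.eventually_lt_const hε, prod_mem_prod hTm hTm] with z hz hzT
    rw [sub_zero]
    exact (hc ⟨z, hzT.1.1, hzT.2.1, hzT.1.2, hzT.2.2⟩).trans_lt hz
  -- Quasi-completeness gives limits only inside bounded closed sets; boundedness follows by
  -- comparing every `q t` with the fixed vector `q r`.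
  have hbdd : Bornology.IsVonNBounded ℝ (q '' T) := by
    rw [isVonNBounded_iff_seminorm]
    intro p hp
    obtain ⟨c, hc⟩ := hbd p hp
    refine ⟨|c| * (r + r) + p (q r), ?_⟩
    rintro _ ⟨t, ht, rfl⟩
    have h1 := hc ⟨(t, r), ht.1, ⟨by linarith, le_rfl⟩, ht.2, hr.ne'⟩
    have h2 : |t| + |r| ≤ r + r := add_le_add (abs_le.2 ht.1) (abs_of_pos hr).le
    have h3 : c * (|t| + |r|) ≤ |c| * (r + r) :=
      mul_le_mul (le_abs_self c) h2 (by positivity) (abs_nonneg c)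
    have h4 := map_add_le_add p (q t - q r) (q r)
    rw [sub_add_cancel] at h4
    simp only at h1
    linarith
  have hcomp := QuasiCompleteSpace.quasiComplete hbdd.closure isClosed_closure
  obtain ⟨d, -, hd⟩ := hcomp _ hcauchy (by
    rw [le_principal_iff, mem_map]
    filter_upwards [hTm] with t ht using subset_closure ⟨t, ht, rfl⟩)
  exact ⟨d, hd⟩

end Scalarwise

/-! ### Smooth real functions from jointly continuous directional derivatives -/

section RealDirDeriv

variable {E : Type*} [NormedAddCommGroup E] [NormedSpace ℝ E]

theorem HasDirDerivAt.smul_dir {E F : Type*} [AddCommGroup E] [Module ℝ E] [AddCommGroup F]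
    [Module ℝ F] [TopologicalSpace F] [ContinuousConstSMul ℝ F] {f : E → F} {f' : F} {x h : E}
    (hf : HasDirDerivAt f f' x h) (c : ℝ) : HasDirDerivAt f (c • f') x (c • h) := by
  rcases eq_or_ne c 0 with rfl | hc
  · simpa [HasDirDerivAt] using tendsto_const_nhds
  · have h1 : Tendsto (fun t : ℝ => t * c) (𝓝[≠] 0) (𝓝[≠] 0) := by
      refine tendsto_nhdsWithin_iff.2 ⟨?_, ?_⟩
      · have h2 : Continuous fun t : ℝ => t * c := by fun_prop
        have h3 := h2.tendsto 0
        rw [zero_mul] at h3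
        exact h3.mono_left nhdsWithin_le_nhds
      · filter_upwards [self_mem_nhdsWithin] with t ht using mul_ne_zero ht hc
    refine Tendsto.congr (fun t => ?_) ((hf.comp h1).const_smul c)
    simp only [Function.comp_apply]
    rw [smul_smul, mul_inv, mul_comm, mul_assoc, inv_mul_cancel₀ hc, mul_one, smul_smul]

/-- A real function with jointly continuous directional derivatives is Fréchet differentiable. -/
theorem exists_hasFDerivAt_of_hasDirDerivAt [FiniteDimensional ℝ E] {U : Set E} (hU : IsOpen U)
    {f : E → ℝ} {D : E → E → ℝ} (hD : ∀ x ∈ U, ∀ h, HasDirDerivAt f (D x h) x h)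
    (hc : ContinuousOn (fun p : E × E => D p.1 p.2) (U ×ˢ univ)) {x : E} (hx : x ∈ U) :
    ∃ f' : E →L[ℝ] ℝ, (∀ h, f' h = D x h) ∧ HasFDerivAt f f' x := by
  have hsmul : ∀ y ∈ U, ∀ (c : ℝ) h, D y (c • h) = c * D y h := fun y hy c h =>
    tendsto_nhds_unique (hD y hy (c • h)) ((hD y hy h).smul_dir c)
  -- A strict differentiability estimate, obtained before `D x` is known to be linear. Homogeneity
  -- reduces directions to the unit sphere, whose compactness makes continuity of `D` uniform in the
  -- direction.
  have hmv : ∀ ε > 0, ∃ δ > 0, ∀ y ∈ Metric.ball x δ, ∀ z ∈ Metric.ball x δ,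
      |f y - f z - D x (y - z)| ≤ ε * ‖y - z‖ := by
    intro ε hε
    have h1 : ∀ᶠ ξ in 𝓝 x, ∀ u ∈ Metric.sphere (0 : E) 1, |D ξ u - D x u| < ε := by
      refine (isCompact_sphere (0 : E) 1).eventually_forall_of_forall_eventually fun u _ => ?_
      have hcx : Continuous fun u => D x u :=
        hc.comp_continuous (f := fun u => (x, u)) (by fun_prop) (fun u => ⟨hx, mem_univ _⟩)
      have h2 : ContinuousAt (fun p : E × E => D p.1 p.2) (x, u) :=
        hc.continuousAt ((hU.prod isOpen_univ).mem_nhds ⟨hx, mem_univ _⟩)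
      have h3 : ContinuousAt (fun p : E × E => |D p.1 p.2 - D x p.2|) (x, u) :=
        (h2.sub (hcx.comp continuous_snd).continuousAt).abs
      exact h3.eventually_lt continuousAt_const (by simpa using hε)
    obtain ⟨δ, hδ, hball⟩ := Metric.mem_nhds_iff.1 (inter_mem h1 (hU.mem_nhds hx))
    refine ⟨δ, hδ, fun y hy z hz => ?_⟩
    have hseg : ∀ s ∈ uIcc (0 : ℝ) 1, z + s • (y - z) ∈ Metric.ball x δ := by
      intro s hs
      rw [uIcc_of_le zero_le_one] at hs
      have := (convex_ball x δ).add_smul_sub_mem hz hy hs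
      exact this
    have h2 := seminorm_slope_sub_le (p := normSeminorm ℝ ℝ) continuous_norm
      (f := fun s : ℝ => f (z + s • (y - z))) (f' := fun s => D (z + s • (y - z)) (y - z))
      (d := D x (y - z)) (c := ε * ‖y - z‖) (t := 1) one_ne_zero
      (fun s hs => HasDirDerivAt.comp_line (hD _ (hball (hseg s hs)).2 _)) (fun s hs => by
        have h3 := (hball (hseg s hs))
        by_cases hyz : y - z = 0
        · have h0D : ∀ q ∈ U, D q 0 = 0 := fun q hq => by simpa using hsmul q hq 0 0
          obtain ⟨-, h4⟩ := h3
          generalize z + s • (y - z) = q at h4 ⊢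
          rw [hyz, h0D q h4, h0D x hx]
          simp
        · have hn : ‖y - z‖ ≠ 0 := norm_ne_zero_iff.2 hyz
          have hu : ‖y - z‖⁻¹ • (y - z) ∈ Metric.sphere (0 : E) 1 := by
            rw [mem_sphere_zero_iff_norm, norm_smul, norm_inv, norm_norm, inv_mul_cancel₀ hn]
          have h5 := h3.1 _ hu
          rw [hsmul _ h3.2, hsmul _ hx, ← mul_sub, abs_mul, abs_inv, abs_norm,
            inv_mul_lt_iff₀ (lt_of_le_of_ne (norm_nonneg _) hn.symm)] at h5
          rw [coe_normSeminorm, Real.norm_eq_abs]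
          linarith)
    simpa using h2
  -- The increments over `x → x + t h → x + t (h + k)` add up to the direct increment, so the defect
  -- `t a` is bounded by three error terms. With `ε = a / (2C)` these total at most half of it.
  have hadd : ∀ h k, D x (h + k) = D x h + D x k := by
    intro h k
    by_contra hne
    set a := |D x (h + k) - D x h - D x k| with ha
    have hapos : 0 < a := abs_pos.2 (by intro h0; exact hne (by linarith))
    set C := ‖h + k‖ + ‖h‖ + ‖k‖ + 1 with hC
    have hCpos : 0 < C := by positivity
    obtain ⟨δ, hδ, hb⟩ := hmv (a / (2 * C)) (by positivity)
    have hlim : ∀ w : E, ∀ᶠ t : ℝ in 𝓝[>] 0, x + t • w ∈ Metric.ball x δ := by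
      intro w
      have h1 : Continuous fun t : ℝ => x + t • w := by fun_prop
      have h2 := h1.tendsto 0
      simp only [zero_smul, add_zero] at h2
      exact (h2.mono_left nhdsWithin_le_nhds) (Metric.ball_mem_nhds x hδ)
    obtain ⟨t, ⟨⟨h1, h2⟩, ht⟩⟩ := (((hlim (h + k)).and (hlim h)).and self_mem_nhdsWithin).exists
    replace ht : 0 < t := ht
    have h0 : x ∈ Metric.ball x δ := Metric.mem_ball_self hδ
    have e1 := hb _ h1 _ h0
    have e2 := hb _ h1 _ h2
    have e3 := hb _ h2 _ h0
    have s1 : x + t • (h + k) - x = t • (h + k) := by abel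
    have s2 : x + t • (h + k) - (x + t • h) = t • k := by rw [smul_add]; abel
    have s3 : x + t • h - x = t • h := by abel
    rw [s1, hsmul x hx, norm_smul, Real.norm_eq_abs, abs_of_pos ht] at e1
    rw [s2, hsmul x hx, norm_smul, Real.norm_eq_abs, abs_of_pos ht] at e2
    rw [s3, hsmul x hx, norm_smul, Real.norm_eq_abs, abs_of_pos ht] at e3
    have e4 : t * a ≤ a / (2 * C) * (t * (‖h + k‖ + ‖h‖ + ‖k‖)) := by
      have : t * a = |t * (D x (h + k) - D x h - D x k)| := by rw [abs_mul, abs_of_pos ht]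
      rw [this]
      rw [abs_le] at e1 e2 e3 ⊢
      constructor <;> nlinarith [e1.1, e1.2, e2.1, e2.2, e3.1, e3.2]
    have e5 : a / (2 * C) * (t * (‖h + k‖ + ‖h‖ + ‖k‖)) ≤ a / (2 * C) * (t * C) := by
      gcongr
      rw [hC]; linarith
    have e6 : a / (2 * C) * (t * C) = t * a / 2 := by field_simp
    nlinarith [mul_pos ht hapos]
  let L : E →ₗ[ℝ] ℝ := ⟨⟨D x, hadd⟩, fun c h => hsmul x hx c h⟩
  refine ⟨L.toContinuousLinearMap, fun h => rfl, ?_⟩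
  rw [hasFDerivAt_iff_isLittleO, Asymptotics.isLittleO_iff]
  intro ε hε
  obtain ⟨δ, hδ, hb⟩ := hmv ε hε
  filter_upwards [Metric.ball_mem_nhds x hδ] with y hy
  exact hb y hy x (Metric.mem_ball_self hδ)

/-- A real function on a product with jointly continuous iterated partial directional derivatives
is smooth. -/
theorem contDiffOn_of_partial_dirDerivs {A : Type*} [NormedAddCommGroup A] [NormedSpace ℝ A]
    [FiniteDimensional ℝ A] [FiniteDimensional ℝ E] {S : Set A} (hS : IsOpen S) {U : Set E}
    (hU : IsOpen U) {g : ∀ j k : ℕ, A → (Fin j → A) → E → (Fin k → E) → ℝ}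
    (hc : ∀ j k, ContinuousOn (fun p : (A × (Fin j → A)) × (E × (Fin k → E)) =>
      g j k p.1.1 p.1.2 p.2.1 p.2.2) ((S ×ˢ univ) ×ˢ (U ×ˢ univ)))
    (h1 : ∀ j k, ∀ a ∈ S, ∀ x ∈ U, ∀ w v h,
      HasDirDerivAt (fun a => g j k a w x v) (g (j + 1) k a (Fin.cons h w) x v) a h)
    (h2 : ∀ j k, ∀ a ∈ S, ∀ x ∈ U, ∀ w v h,
      HasDirDerivAt (fun x => g j k a w x v) (g j (k + 1) a w x (Fin.cons h v)) x h)
    (n : ℕ) : ∀ (j k : ℕ) (w : Fin j → A) (v : Fin k → E),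
      ContDiffOn ℝ n (fun p : A × E => g j k p.1 w p.2 v) (S ×ˢ U) := by
  have hSU : IsOpen (S ×ˢ U) := hS.prod hU
  have hcont : ∀ (j k : ℕ) (w : Fin j → A) (v : Fin k → E),
      ContinuousOn (fun p : A × E => g j k p.1 w p.2 v) (S ×ˢ U) := fun j k w v =>
    (hc j k).comp (f := fun p : A × E => ((p.1, w), (p.2, v))) (by fun_prop)
      (fun p hp => ⟨⟨hp.1, mem_univ _⟩, ⟨hp.2, mem_univ _⟩⟩)
  -- The induction runs over the whole family at once, since the partial derivatives of a member are
  -- again members.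
  induction n with
  | zero => exact fun j k w v => contDiffOn_zero.2 (hcont j k w v)
  | succ n ih =>
    intro j k w v
    have hA : ∀ p ∈ S ×ˢ U, ∃ f' : A →L[ℝ] ℝ,
        (∀ h, f' h = g (j + 1) k p.1 (Fin.cons h w) p.2 v) ∧
        HasFDerivAt (fun a => g j k a w p.2 v) f' p.1 := fun p hp =>
      exists_hasFDerivAt_of_hasDirDerivAt hS
        (D := fun a h => g (j + 1) k a (Fin.cons h w) p.2 v)
        (fun a ha h => h1 j k a ha p.2 hp.2 w v h)
        ((hc (j + 1) k).comp (f := fun q : A × A => ((q.1, (Fin.cons q.2 w : Fin (j + 1) → A)), (p.2, v)))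
          (Continuous.continuousOn (by fun_prop))
          (fun q hq => ⟨⟨hq.1, mem_univ _⟩, ⟨hp.2, mem_univ _⟩⟩)) hp.1
    have hE : ∀ p ∈ S ×ˢ U, ∃ f' : E →L[ℝ] ℝ,
        (∀ h, f' h = g j (k + 1) p.1 w p.2 (Fin.cons h v)) ∧
        HasFDerivAt (fun x => g j k p.1 w x v) f' p.2 := fun p hp =>
      exists_hasFDerivAt_of_hasDirDerivAt hU
        (D := fun x h => g j (k + 1) p.1 w x (Fin.cons h v))
        (fun x hx h => h2 j k p.1 hp.1 x hx w v h)
        ((hc j (k + 1)).comp (f := fun q : E × E => ((p.1, w), (q.1, (Fin.cons q.2 v : Fin (k + 1) → E))))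
          (Continuous.continuousOn (by fun_prop))
          (fun q hq => ⟨⟨hp.1, mem_univ _⟩, ⟨hq.1, mem_univ _⟩⟩)) hp.2
    choose! φ hφ hφ' using hA
    choose! ψ hψ hψ' using hE
    have hφc : ContinuousOn φ (S ×ˢ U) := continuousOn_clm_apply.2 fun h =>
      (hcont (j + 1) k (Fin.cons h w) v).congr fun p hp => hφ p hp h
    have hψc : ContinuousOn ψ (S ×ˢ U) := continuousOn_clm_apply.2 fun h =>
      (hcont j (k + 1) w (Fin.cons h v)).congr fun p hp => hψ p hp h
    have hfd : ∀ p ∈ S ×ˢ U, HasFDerivAt (fun p : A × E => g j k p.1 w p.2 v)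
        ((φ p).coprod (ψ p)) p := by
      intro p hp
      refine (hasStrictFDerivAt_uncurry_coprod (f := fun a x => g j k a w x v)
        (f₁ := fun a x => φ (a, x)) (f₂ := fun a x => ψ (a, x)) (u := p) ?_ ?_
        (hφc.continuousAt (hSU.mem_nhds hp)) (hψc.continuousAt (hSU.mem_nhds hp))).hasFDerivAt
      · filter_upwards [hSU.mem_nhds hp] with q hq using hφ' q hq
      · filter_upwards [hSU.mem_nhds hp] with q hq using hψ' q hq
    rw [show ((n + 1 : ℕ) : WithTop ℕ∞) = (n : WithTop ℕ∞) + 1 by push_cast; rfl,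
      contDiffOn_succ_iff_fderiv_apply hSU.uniqueDiffOn]
    refine ⟨fun p hp => (hfd p hp).differentiableAt.differentiableWithinAt, by simp, fun y => ?_⟩
    refine ((ih (j + 1) k (Fin.cons y.1 w) v).add (ih j (k + 1) w (Fin.cons y.2 v))).congr
      fun p hp => ?_
    rw [fderivWithin_of_isOpen hSU hp, (hfd p hp).fderiv]
    simp [hφ p hp, hψ p hp]

theorem HasDirDerivsOn.contDiffOn [FiniteDimensional ℝ E] {U : Set E} (hU : IsOpen U) {f : E → ℝ}
    {D : ∀ k : ℕ, E → (Fin k → E) → ℝ} (hD : HasDirDerivsOn U f D) : ContDiffOn ℝ ∞ f U := by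
  rw [contDiffOn_infty]
  intro n
  -- A dummy real variable, on which nothing depends, turns the one-variable case into the product
  -- case.
  let g : ∀ j k : ℕ, ℝ → (Fin j → ℝ) → E → (Fin k → E) → ℝ := fun j k _ _ x v =>
    match j with
    | 0 => D k x v
    | _ + 1 => 0
  have h := contDiffOn_of_partial_dirDerivs isOpen_univ hU (g := g)
    (fun j k => by
      match j with
      | 0 => exact (hD.cont k).comp (f := Prod.snd) continuous_snd.continuousOn fun p hp => hp.2
      | j + 1 => exact continuousOn_const)
    (fun j k a _ x _ w v h => by
      match j with
      | 0 => simp [g, HasDirDerivAt]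
      | j + 1 => simp [g, HasDirDerivAt])
    (fun j k a _ x hx w v h => by
      match j with
      | 0 => exact hD.succ k x hx v h
      | j + 1 => simp [g, HasDirDerivAt]) n 0 0 Fin.elim0 Fin.elim0
  refine (h.comp (g := fun p : ℝ × E => g 0 0 p.1 Fin.elim0 p.2 Fin.elim0)
    (f := fun x : E => ((0 : ℝ), x)) (by fun_prop) (fun x hx => ⟨mem_univ _, hx⟩)).congr
    fun x hx => ?_
  exact (hD.zero x hx _).symm

end RealDirDeriv

/-! ### Weak derivatives -/

section WeakDeriv

variable {E : Type*} [NormedAddCommGroup E] [NormedSpace ℝ E]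
  {V : Type*} [AddCommGroup V] [Module ℝ V] [UniformSpace V]

open Classical in
/-- The vector `d` with `l d = iterDeriv (l ∘ f) k x v` for all continuous linear functionals `l`
(and `0` if there is none). -/
def weakDeriv (f : E → V) (k : ℕ) (x : E) (v : Fin k → E) : V :=
  if h : ∃ d : V, ∀ l : StrongDual ℝ V, l d = iterDeriv (fun y => l (f y)) k x v
  then h.choose else 0

variable [IsUniformAddGroup V] [ContinuousSMul ℝ V] [LocallyConvexSpace ℝ V] [T2Space V]
  [QuasiCompleteSpace ℝ V] {U : Set E} {f : E → V}

/-- The `k`-th weak derivative with fixed directions is again scalarwise smooth, so the existence of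
one directional derivative can be iterated. -/
theorem ScalarSmoothOn.dual_weakDeriv (hU : IsOpen U) (hf : ScalarSmoothOn U f) (k : ℕ) :
    ∀ x ∈ U, ∀ (v : Fin k → E) (l : StrongDual ℝ V),
      l (weakDeriv f k x v) = iterDeriv (fun y => l (f y)) k x v := by
  suffices h : ∀ x ∈ U, ∀ v : Fin k → E, ∃ d : V, ∀ l : StrongDual ℝ V,
      l d = iterDeriv (fun y => l (f y)) k x v by
    intro x hx v l
    rw [weakDeriv, dif_pos (h x hx v)]
    exact (h x hx v).choose_spec l
  induction k with
  | zero => exact fun x hx v => ⟨f x, fun l => rfl⟩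
  | succ k ih =>
    intro x hx v
    choose! d hd using ih
    have hs : ScalarSmoothOn U (fun y => d y (Fin.tail v)) := fun l y hy => by
      refine ContDiffAt.contDiffWithinAt ?_
      have h1 : ContDiffAt ℝ ∞ (fun y => iterDeriv (fun z => l (f z)) k y (Fin.tail v)) y :=
        ContDiffAt.comp y
          (g := fun p : E × (Fin k → E) => iterDeriv (fun z => l (f z)) k p.1 p.2)
          (f := fun y => (y, Fin.tail v))
          (contDiffAt_iterDeriv k (Fin.tail v) ((hf l).contDiffAt (hU.mem_nhds hy)))
          (by fun_prop)
      refine h1.congr_of_eventuallyEq ?_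
      filter_upwards [hU.mem_nhds hy] with z hz using hd z hz _ l
    obtain ⟨e, -, he⟩ := hs.exists_dirDeriv hU hx (v 0)
    refine ⟨e, fun l => ?_⟩
    rw [he, iterDeriv_succ]
    have h2 : (fun y => l (d y (Fin.tail v))) =ᶠ[𝓝 x]
        fun y => iterDeriv (fun z => l (f z)) k y (Fin.tail v) := by
      filter_upwards [hU.mem_nhds hx] with z hz using hd z hz _ l
    rw [h2.fderiv_eq]

theorem ScalarSmoothOn.weakDeriv (hU : IsOpen U) (hf : ScalarSmoothOn U f) (k : ℕ) :
    ScalarSmoothOn (U ×ˢ univ) (fun p : E × (Fin k → E) => weakDeriv f k p.1 p.2) := by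
  intro l p hp
  refine ContDiffAt.contDiffWithinAt ?_
  refine (contDiffAt_iterDeriv k p.2 ((hf l).contDiffAt (hU.mem_nhds hp.1))).congr_of_eventuallyEq ?_
  filter_upwards [(hU.prod isOpen_univ).mem_nhds hp] with q hq
  exact hf.dual_weakDeriv hU k q.1 hq.1 q.2 l

/-- Scalarwise smooth implies smooth. Each weak derivative is scalarwise smooth jointly in point and
directions, so it is continuous and has directional derivatives; functionals identify these with the
next weak derivative. -/
theorem ScalarSmoothOn.hasDirDerivsOn [FiniteDimensional ℝ E] (hU : IsOpen U)
    (hf : ScalarSmoothOn U f) : HasDirDerivsOn U f (EquivCoh.weakDeriv f) where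
  zero x hx v := eq_of_forall_dual_eq fun l => hf.dual_weakDeriv hU 0 x hx v l
  succ k x hx v h := by
    have hs : ScalarSmoothOn U (fun y => EquivCoh.weakDeriv f k y v) := fun l =>
      (hf.weakDeriv hU k l).comp (f := fun y => (y, v)) (by fun_prop)
        (fun y hy => ⟨hy, mem_univ _⟩)
    obtain ⟨d, hd, hd'⟩ := hs.exists_dirDeriv hU hx h
    have : d = EquivCoh.weakDeriv f (k + 1) x (Fin.cons h v) := eq_of_forall_dual_eq fun l => by
      rw [hd', hf.dual_weakDeriv hU (k + 1) x hx, iterDeriv_succ, Fin.cons_zero, Fin.tail_cons]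
      have h2 : (fun y => l (EquivCoh.weakDeriv f k y v)) =ᶠ[𝓝 x]
          fun y => iterDeriv (fun z => l (f z)) k y v := by
        filter_upwards [hU.mem_nhds hx] with z hz using hf.dual_weakDeriv hU k z hz v l
      rw [h2.fderiv_eq]
    rwa [← this]
  cont k := (hf.weakDeriv hU k).continuousOn (hU.prod isOpen_univ)

theorem HasDirDerivsOn.scalarSmoothOn [FiniteDimensional ℝ E] (hU : IsOpen U)
    {D : ∀ k : ℕ, E → (Fin k → E) → V} (hD : HasDirDerivsOn U f D) : ScalarSmoothOn U f :=
  fun l => (hD.clm_comp l).contDiffOn hU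

end WeakDeriv

/-! ### Smooth and scalarwise smooth maps on manifolds -/

section Manifold

variable {E H : Type*} [NormedAddCommGroup E] [NormedSpace ℝ E] [TopologicalSpace H]
  {I : ModelWithCorners ℝ E H} {M : Type*} [TopologicalSpace M] [ChartedSpace H M]

theorem contMDiffOn_extend_symm_target {e : OpenPartialHomeomorph M H}
    (he : e ∈ IsManifold.maximalAtlas I ∞ M) :
    ContMDiffOn 𝓘(ℝ, E) I ∞ (e.extend I).symm (e.extend I).target := by
  rw [e.extend_target']
  exact contMDiffOn_extend_symm he

theorem contMDiffOn_extend_source {e : OpenPartialHomeomorph M H}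
    (he : e ∈ IsManifold.maximalAtlas I ∞ M) :
    ContMDiffOn I 𝓘(ℝ, E) ∞ (e.extend I) (e.extend I).source := by
  rw [e.extend_source]
  exact e.contMDiffOn_extend he

theorem contDiffOn_extend_symm [I.Boundaryless] {f : M → ℝ} (hf : ContMDiff I 𝓘(ℝ) ∞ f)
    {e : OpenPartialHomeomorph M H} (he : e ∈ IsManifold.maximalAtlas I ∞ M) :
    ContDiffOn ℝ ∞ (fun x => f ((e.extend I).symm x)) (e.extend I).target :=
  contMDiffOn_iff_contDiffOn.1 (hf.comp_contMDiffOn (contMDiffOn_extend_symm_target he))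

theorem contMDiff_of_contDiffOn_extend_symm [I.Boundaryless] [IsManifold I ∞ M] {f : M → ℝ}
    (h : ∀ e ∈ IsManifold.maximalAtlas I ∞ M,
      ContDiffOn ℝ ∞ (fun x => f ((e.extend I).symm x)) (e.extend I).target) :
    ContMDiff I 𝓘(ℝ) ∞ f := by
  intro x
  have he := IsManifold.chart_mem_maximalAtlas (I := I) (n := ∞) x
  have h1 := (contMDiffOn_iff_contDiffOn.2 (h _ he)).comp (contMDiffOn_extend_source he)
    (fun y hy => PartialEquiv.map_source _ hy)
  have hx : x ∈ ((chartAt H x).extend I).source := by simp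
  refine ((h1.congr fun y hy => ?_).contMDiffAt
    ((OpenPartialHomeomorph.isOpen_extend_source _).mem_nhds hx))
  simp only [Function.comp_apply]
  rw [PartialEquiv.left_inv _ hy]

variable {V : Type*} [AddCommGroup V] [Module ℝ V] [UniformSpace V]

variable (I) in
/-- All functions `l ∘ f`, for `l` in the dual space, are smooth. -/
def ScalarSmooth (f : M → V) : Prop :=
  ∀ l : StrongDual ℝ V, ContMDiff I 𝓘(ℝ) ∞ (fun x => l (f x))

variable [IsUniformAddGroup V] [ContinuousSMul ℝ V] [LocallyConvexSpace ℝ V] [T2Space V]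
  [QuasiCompleteSpace ℝ V] [FiniteDimensional ℝ E] [I.Boundaryless]

theorem ScalarSmooth.scalarSmoothOn {f : M → V} (hf : ScalarSmooth I f)
    {e : OpenPartialHomeomorph M H} (he : e ∈ IsManifold.maximalAtlas I ∞ M) :
    ScalarSmoothOn (e.extend I).target (fun x => f ((e.extend I).symm x)) :=
  fun l => contDiffOn_extend_symm (hf l) he

theorem ScalarSmooth.isSmooth {f : M → V} (hf : ScalarSmooth I f) : IsSmooth I f := fun e he =>
  ⟨_, (hf.scalarSmoothOn he).hasDirDerivsOn e.isOpen_extend_target⟩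

theorem IsSmooth.scalarSmooth [IsManifold I ∞ M] {f : M → V} (hf : IsSmooth I f) :
    ScalarSmooth I f := fun l => contMDiff_of_contDiffOn_extend_symm fun e he => by
  obtain ⟨D, hD⟩ := hf e he
  exact hD.scalarSmoothOn e.isOpen_extend_target l

/-- The chart derivatives come from an arbitrary choice; uniqueness of limits identifies them with
the weak derivatives, which functionals compute. -/
theorem SmoothMap.dual_chartDeriv [IsManifold I ∞ M] (e : IsManifold.maximalAtlas I ∞ M)
    (f : SmoothMap I M V) (k : ℕ) {x : E} (hx : x ∈ (e.1.extend I).target) (v : Fin k → E)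
    (l : StrongDual ℝ V) :
    l (f.chartDeriv e k x v) = iterDeriv (fun y => l (f ((e.1.extend I).symm y))) k x v := by
  have hs : ScalarSmooth I f := IsSmooth.scalarSmooth f.2
  rw [← (hs.scalarSmoothOn e.2).dual_weakDeriv e.1.isOpen_extend_target k x hx v l]
  rw [HasDirDerivsOn.unique e.1.isOpen_extend_target (f.hasDirDerivsOn_chartDeriv e)
    ((hs.scalarSmoothOn e.2).hasDirDerivsOn e.1.isOpen_extend_target) k x hx v]

/-! ### Continuous maps into `C^∞(M, V)` -/

/-- The domains of the jets are locally compact, `E` being finite-dimensional, so continuity into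
the compact-open topology is joint continuity after uncurrying. -/
theorem continuous_smoothMap_iff {P : Type*} [TopologicalSpace P] {f : P → SmoothMap I M V} :
    Continuous f ↔ ∀ (e : IsManifold.maximalAtlas I ∞ M) (k : ℕ),
      Continuous fun q : P × (e.1.extend I).target × (Fin k → E) =>
        (f q.1).chartDeriv e k q.2.1 q.2.2 := by
  have h1 : Continuous f ↔ ∀ (e : IsManifold.maximalAtlas I ∞ M) (k : ℕ),
      Continuous fun p => SmoothMap.jet e k (f p) := by
    rw [continuous_iInf_rng]
    refine forall_congr' fun e => ?_
    rw [continuous_iInf_rng]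
    exact forall_congr' fun k => continuous_induced_rng
  rw [h1]
  refine forall_congr' fun e => forall_congr' fun k => ⟨fun h => ?_, fun h => ?_⟩
  · have : LocallyCompactSpace (e.1.extend I).target :=
      e.1.isOpen_extend_target.locallyCompactSpace
    exact ContinuousMap.continuous_uncurry_of_continuous ⟨_, h⟩
  · exact ContinuousMap.continuous_of_continuous_uncurry _ h

theorem tendsto_compactOpen_of_locally {α Y Z : Type*} [TopologicalSpace Y] [TopologicalSpace Z]
    {l : Filter α} {f : α → C(Y, Z)} {g : C(Y, Z)}
    (h : ∀ y, Tendsto (fun p : α × Y => f p.1 p.2) (l ×ˢ 𝓝 y) (𝓝 (g y))) :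
    Tendsto f l (𝓝 g) := by
  rw [ContinuousMap.tendsto_nhds_compactOpen]
  intro K hK U hU hKU
  refine hK.induction_on (p := fun S => ∀ᶠ a in l, MapsTo (f a) S U) ?_ ?_ ?_ ?_
  · exact Eventually.of_forall fun a => mapsTo_empty _ _
  · intro s t hst ht
    filter_upwards [ht] with a ha using ha.mono_left hst
  · intro s t hs ht
    filter_upwards [hs, ht] with a ha hb using ha.union hb
  · intro y hy
    have h1 := (h y).eventually (hU.mem_nhds (hKU hy))
    obtain ⟨A, hA, B, hB, hAB⟩ := Filter.eventually_prod_iff.1 h1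
    refine ⟨{y | B y}, mem_nhdsWithin_of_mem_nhds hB, ?_⟩
    filter_upwards [hA] with a ha z hz using hAB ha hz

theorem tendsto_smoothMap_iff {α : Type*} {l : Filter α} {f : α → SmoothMap I M V}
    {g : SmoothMap I M V} :
    Tendsto f l (𝓝 g) ↔ ∀ (e : IsManifold.maximalAtlas I ∞ M) (k : ℕ),
      Tendsto (fun a => SmoothMap.jet e k (f a)) l (𝓝 (SmoothMap.jet e k g)) := by
  have h1 : 𝓝 g = ⨅ (e : IsManifold.maximalAtlas I ∞ M) (k : ℕ),
      comap (SmoothMap.jet e k) (𝓝 (SmoothMap.jet e k g)) := by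
    change @nhds _ (⨅ (e : IsManifold.maximalAtlas I ∞ M) (k : ℕ),
      TopologicalSpace.induced (SmoothMap.jet e k) ContinuousMap.compactOpen) g = _
    simp_rw [nhds_iInf, nhds_induced]
  rw [h1]
  simp only [tendsto_iInf, tendsto_comap_iff]
  rfl

/-- Evaluation of the `k`-th derivative in a chart, as a continuous linear map. -/
def SmoothMap.jetEval (e : IsManifold.maximalAtlas I ∞ M) (k : ℕ)
    (p : (e.1.extend I).target × (Fin k → E)) : SmoothMap I M V →L[ℝ] V where
  toFun f := SmoothMap.jet e k f p
  map_add' f g := congrArg (fun c : C(_, V) => c p) (map_add (SmoothMap.jetₗ e k) f g)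
  map_smul' c f := congrArg (fun c : C(_, V) => c p) (map_smul (SmoothMap.jetₗ e k) c f)
  cont := (continuous_eval_const p).comp (continuous_iff_continuousAt.2 fun _ =>
    tendsto_smoothMap_iff.1 (tendsto_id (α := SmoothMap I M V)) e k)

theorem SmoothMap.jetEval_apply (e : IsManifold.maximalAtlas I ∞ M) (k : ℕ)
    (p : (e.1.extend I).target × (Fin k → E)) (f : SmoothMap I M V) :
    SmoothMap.jetEval e k p f = f.chartDeriv e k p.1 p.2 := rfl

theorem SmoothMap.chartDeriv_zero (e : IsManifold.maximalAtlas I ∞ M) (f : SmoothMap I M V)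
    {x : E} (hx : x ∈ (e.1.extend I).target) (v : Fin 0 → E) :
    f.chartDeriv e 0 x v = f ((e.1.extend I).symm x) :=
  (f.hasDirDerivsOn_chartDeriv e).zero x hx v

end Manifold

/-! ### The exponential law for smooth maps -/

section ExponentialLaw

variable {E H : Type*} [NormedAddCommGroup E] [NormedSpace ℝ E] [TopologicalSpace H]
  {I : ModelWithCorners ℝ E H} {M : Type*} [TopologicalSpace M] [ChartedSpace H M]
  {E' H' : Type*} [NormedAddCommGroup E'] [NormedSpace ℝ E'] [TopologicalSpace H']
  {J : ModelWithCorners ℝ E' H'} {N : Type*} [TopologicalSpace N] [ChartedSpace H' N]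
  {V : Type*} [AddCommGroup V] [Module ℝ V] [UniformSpace V]
  [IsUniformAddGroup V] [ContinuousSMul ℝ V] [LocallyConvexSpace ℝ V] [T2Space V]
  [QuasiCompleteSpace ℝ V] [FiniteDimensional ℝ E] [I.Boundaryless]
  [FiniteDimensional ℝ E'] [J.Boundaryless]

theorem ScalarSmooth.curry_right {u : N → M → V}
    (hu : ScalarSmooth (J.prod I) (fun p : N × M => u p.1 p.2)) (n : N) :
    ScalarSmooth I (u n) := fun l =>
  (hu l).comp (f := fun x : M => (n, x)) (contMDiff_const.prodMk contMDiff_id)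

theorem ScalarSmooth.contDiffOn_charts {u : N → M → V}
    (hu : ScalarSmooth (J.prod I) (fun p : N × M => u p.1 p.2))
    {c : OpenPartialHomeomorph N H'} (hc : c ∈ IsManifold.maximalAtlas J ∞ N)
    {e : OpenPartialHomeomorph M H} (he : e ∈ IsManifold.maximalAtlas I ∞ M)
    (l : StrongDual ℝ V) :
    ContDiffOn ℝ ∞ (fun p : E' × E => l (u ((c.extend J).symm p.1) ((e.extend I).symm p.2)))
      ((c.extend J).target ×ˢ (e.extend I).target) := by
  have h1 : ContMDiffOn 𝓘(ℝ, E' × E) (J.prod I) ∞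
      (fun p : E' × E => ((c.extend J).symm p.1, (e.extend I).symm p.2))
      ((c.extend J).target ×ˢ (e.extend I).target) := by
    refine ContMDiffOn.prodMk ?_ ?_
    · exact (contMDiffOn_extend_symm_target hc).comp contDiff_fst.contMDiff.contMDiffOn fun p hp => hp.1
    · exact (contMDiffOn_extend_symm_target he).comp contDiff_snd.contMDiff.contMDiffOn fun p hp => hp.2
  exact contMDiffOn_iff_contDiffOn.1 ((hu l).comp_contMDiffOn h1)

theorem ScalarSmooth.of_contDiffOn_charts [IsManifold I ∞ M] [IsManifold J ∞ N] {u : N → M → V}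
    (h : ∀ c ∈ IsManifold.maximalAtlas J ∞ N, ∀ e ∈ IsManifold.maximalAtlas I ∞ M,
      ∀ l : StrongDual ℝ V,
      ContDiffOn ℝ ∞ (fun p : E' × E => l (u ((c.extend J).symm p.1) ((e.extend I).symm p.2)))
        ((c.extend J).target ×ˢ (e.extend I).target)) :
    ScalarSmooth (J.prod I) (fun p : N × M => u p.1 p.2) := by
  rintro l ⟨n, x⟩
  have hc := IsManifold.chart_mem_maximalAtlas (I := J) (n := ∞) n
  have he := IsManifold.chart_mem_maximalAtlas (I := I) (n := ∞) x
  set c := chartAt H' n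
  set e := chartAt H x
  have hm : ContMDiffOn (J.prod I) 𝓘(ℝ, E' × E) ∞ (fun p : N × M => (c.extend J p.1, e.extend I p.2))
      ((c.extend J).source ×ˢ (e.extend I).source) := by
    rw [modelWithCornersSelf_prod, ← chartedSpaceSelf_prod]
    refine ContMDiffOn.prodMk ?_ ?_
    · exact (contMDiffOn_extend_source hc).comp contMDiff_fst.contMDiffOn fun p hp => hp.1
    · exact (contMDiffOn_extend_source he).comp contMDiff_snd.contMDiffOn fun p hp => hp.2
  have h1 := (contMDiffOn_iff_contDiffOn.2 (h c hc e he l)).comp hm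
    (fun p hp => ⟨PartialEquiv.map_source _ hp.1, PartialEquiv.map_source _ hp.2⟩)
  have hx : (n, x) ∈ (c.extend J).source ×ˢ (e.extend I).source := by
    simp [c, e]
  refine ((h1.congr fun p hp => ?_).contMDiffAt
    ((c.isOpen_extend_source.prod e.isOpen_extend_source).mem_nhds hx))
  simp only [Function.comp_apply]
  rw [PartialEquiv.left_inv _ hp.1, PartialEquiv.left_inv _ hp.2]

/-- A smooth map into `C^∞(M, V)` is (scalarwise) smooth as a map of two variables. -/
theorem IsSmooth.scalarSmooth_uncurry [IsManifold I ∞ M] [IsManifold J ∞ N]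
    {f : N → SmoothMap I M V} (hf : IsSmooth J f) :
    ScalarSmooth (J.prod I) (fun p : N × M => f p.1 p.2) := by
  refine ScalarSmooth.of_contDiffOn_charts (u := fun n x => f n x) fun c hc e he l => ?_
  obtain ⟨D, hD⟩ := hf c hc
  have hS := c.isOpen_extend_target (I := J)
  have hU := e.isOpen_extend_target (I := I)
  set S := (c.extend J).target
  set U := (e.extend I).target
  let e' : IsManifold.maximalAtlas I ∞ M := ⟨e, he⟩
  rw [contDiffOn_infty]
  intro n
  -- The mixed family takes `j` derivatives along `N` and then `k` along `M`. Derivatives along `N`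
  -- pass through the jets because evaluation of a jet is continuous and linear on `C^∞(M, V)`.
  have h := contDiffOn_of_partial_dirDerivs hS hU
    (g := fun j k a w x v => l ((D j a w).chartDeriv e' k x v))
    (fun j k => by
      have h1 : Continuous fun q : (S ×ˢ univ : Set (E' × (Fin j → E'))) => D j q.1.1 q.1.2 :=
        continuousOn_iff_continuous_domRestrict.1 (hD.cont j)
      have h2 := continuous_smoothMap_iff.1 h1 e' k
      rw [continuousOn_iff_continuous_domRestrict]
      let Φ : ((S ×ˢ univ) ×ˢ (U ×ˢ univ) : Set ((E' × (Fin j → E')) × (E × (Fin k → E)))) →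
          (S ×ˢ univ : Set (E' × (Fin j → E'))) × U × (Fin k → E) := fun q =>
        (⟨q.1.1, q.2.1⟩, ⟨q.1.2.1, q.2.2.1⟩, q.1.2.2)
      have hΦ : Continuous Φ := by
        refine Continuous.prodMk (Continuous.subtype_mk (by fun_prop) _)
          (Continuous.prodMk (Continuous.subtype_mk (by fun_prop) _) (by fun_prop))
      exact l.continuous.comp (h2.comp hΦ))
    (fun j k a ha x hx w v h => ((hD.succ j a ha w h).clm_comp
      (SmoothMap.jetEval e' k (⟨x, hx⟩, v))).clm_comp l)
    (fun j k a ha x hx w v h =>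
      (((D j a w).hasDirDerivsOn_chartDeriv e').succ k x hx v h).clm_comp l) n 0 0 Fin.elim0 Fin.elim0
  refine h.congr fun p hp => ?_
  rw [SmoothMap.chartDeriv_zero e' _ hp.2, hD.zero _ hp.1]

variable [IsManifold I ∞ M]

/-- The converse half of the exponential law. The candidate derivatives are taken in `n` for each
fixed `x`; the point is that the difference quotients converge in the `C^∞`-topology, that is,
locally uniformly with all their derivatives in `x`. -/
theorem isSmooth_smoothMap {u : N → M → V}
    (hu : ScalarSmooth (J.prod I) (fun p : N × M => u p.1 p.2)) :
    IsSmooth J (fun n => SmoothMap.mk (u n) (hu.curry_right n).isSmooth : N → SmoothMap I M V) := by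
  classical
  intro c hc
  have hS := c.isOpen_extend_target (I := J)
  have hT : ∀ e : IsManifold.maximalAtlas I ∞ M, IsOpen (e.1.extend I).target :=
    fun e => e.1.isOpen_extend_target
  set S := (c.extend J).target with hSdef
  -- the function `u` in charts
  let F : IsManifold.maximalAtlas I ∞ M → StrongDual ℝ V → E' → E → ℝ := fun e l a y =>
    l (u ((c.extend J).symm a) ((e.1.extend I).symm y))
  have hF : ∀ e l, ContDiffOn ℝ ∞ (fun p : E' × E => F e l p.1 p.2)
      (S ×ˢ (e.1.extend I).target) := fun e l => hu.contDiffOn_charts hc e.2 l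
  have hFat : ∀ e l, ∀ a ∈ S, ∀ y ∈ (e.1.extend I).target,
      ContDiffAt ℝ ∞ (fun p : E' × E => F e l p.1 p.2) (a, y) := fun e l a ha y hy =>
    (hF e l).contDiffAt ((hS.prod (hT e)).mem_nhds ⟨ha, hy⟩)
  -- the partial derivatives in the first variable
  have hux : ∀ x, ScalarSmoothOn S (fun a => u ((c.extend J).symm a) x) := fun x l => by
    have h1 : ContMDiff J 𝓘(ℝ) ∞ (fun n => l (u n x)) :=
      (hu l).comp (f := fun n : N => (n, x)) (contMDiff_id.prodMk contMDiff_const)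
    exact contDiffOn_extend_symm h1 hc
  let d : ∀ k : ℕ, E' → (Fin k → E') → M → V := fun k a w x =>
    weakDeriv (fun a => u ((c.extend J).symm a) x) k a w
  have hdF : ∀ e l k, ∀ a ∈ S, ∀ w y, l (d k a w ((e.1.extend I).symm y)) =
      iterDeriv (fun a => F e l a y) k a w := fun e l k a ha w y =>
    (hux _).dual_weakDeriv hS k a ha w l
  have hG : ∀ e l k, ∀ a ∈ S, ∀ w, ∀ y ∈ (e.1.extend I).target,
      ContDiffAt ℝ ∞ (fun q : (E' × (Fin k → E')) × E =>
        iterDeriv (fun a => F e l a q.2) k q.1.1 q.1.2) ((a, w), y) := by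
    intro e l k a ha w y hy
    have h1 := contDiffAt_iterDeriv_param (A := E) (F := fun y a => F e l a y) k w
      (ContDiffAt.comp (y, a) (g := fun p : E' × E => F e l p.1 p.2) (f := Prod.swap)
        (hFat e l a ha y hy) (by unfold Prod.swap; fun_prop))
    exact ContDiffAt.comp ((a, w), y)
      (g := fun p : E × E' × (Fin k → E') => iterDeriv (fun a => F e l a p.1) k p.2.1 p.2.2)
      (f := fun q : (E' × (Fin k → E')) × E => (q.2, q.1.1, q.1.2)) h1 (by fun_prop)
  have hds : ∀ k, ∀ a ∈ S, ∀ w, IsSmooth I (d k a w) := by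
    intro k a ha w e he
    refine ⟨_, ScalarSmoothOn.hasDirDerivsOn e.isOpen_extend_target fun l y hy => ?_⟩
    have h1 := ContDiffAt.comp y (f := fun y : E => ((a, w), y)) (hG ⟨e, he⟩ l k a ha w y hy)
      (by fun_prop)
    refine ContDiffAt.contDiffWithinAt (h1.congr_of_eventuallyEq (Eventually.of_forall fun z => ?_))
    exact hdF ⟨e, he⟩ l k a ha w z
  -- Outside the open set `S` the value is irrelevant and set to `0`.
  let D : ∀ k : ℕ, E' → (Fin k → E') → SmoothMap I M V := fun k a w =>
    if ha : a ∈ S then SmoothMap.mk (d k a w) (hds k a ha w) else 0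
  have hDd : ∀ k, ∀ a ∈ S, ∀ w, (D k a w : M → V) = d k a w := by
    intro k a ha w
    simp only [D, dif_pos ha]
    rfl
  -- all derivatives of the partial derivatives
  let z : ∀ (e : IsManifold.maximalAtlas I ∞ M) (k i : ℕ), E' → (Fin k → E') → E → (Fin i → E) → V :=
    fun e k i a w y v => (D k a w).chartDeriv e i y v
  have hz : ∀ e l k i, ∀ a ∈ S, ∀ w, ∀ y ∈ (e.1.extend I).target, ∀ v,
      l (z e k i a w y v) =
        iterDeriv (fun y => iterDeriv (fun a => F e l a y) k a w) i y v := by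
    intro e l k i a ha w y hy v
    refine ((D k a w).dual_chartDeriv e i hy v l).trans ?_
    refine iterDeriv_congr i (Eventually.of_forall fun y' => ?_) v
    rw [hDd k a ha w]
    exact hdF e l k a ha w y'
  have hzs : ∀ e k i, ScalarSmoothOn ((S ×ˢ univ) ×ˢ ((e.1.extend I).target ×ˢ univ))
      (fun q : (E' × (Fin k → E')) × (E × (Fin i → E)) => z e k i q.1.1 q.1.2 q.2.1 q.2.2) := by
    rintro e k i l ⟨⟨a, w⟩, ⟨y, v⟩⟩ ⟨⟨ha, -⟩, ⟨hy, -⟩⟩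
    have h1 := contDiffAt_iterDeriv_param (A := E' × (Fin k → E'))
      (F := fun q y => iterDeriv (fun a => F e l a y) k q.1 q.2) i v (hG e l k a ha w y hy)
    refine ContDiffAt.contDiffWithinAt (h1.congr_of_eventuallyEq ?_)
    filter_upwards [((hS.prod isOpen_univ).prod ((hT e).prod isOpen_univ)).mem_nhds
      (show ((a, w), (y, v)) ∈ (S ×ˢ univ) ×ˢ ((e.1.extend I).target ×ˢ univ) from
        ⟨⟨ha, mem_univ _⟩, ⟨hy, mem_univ _⟩⟩)] with q hq
    exact hz e l k i q.1.1 hq.1.1 q.1.2 q.2.1 hq.2.1 q.2.2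
  have hzc : ∀ e k i, ContinuousOn
      (fun q : (E' × (Fin k → E')) × (E × (Fin i → E)) => z e k i q.1.1 q.1.2 q.2.1 q.2.2)
      ((S ×ˢ univ) ×ˢ ((e.1.extend I).target ×ˢ univ)) := fun e k i =>
    (hzs e k i).continuousOn ((hS.prod isOpen_univ).prod ((hT e).prod isOpen_univ))
  -- Under a functional this is the interchange of one derivative in `a` with `i` derivatives in
  -- `y`.
  have hzd : ∀ e k i, ∀ a ∈ S, ∀ w, ∀ y ∈ (e.1.extend I).target, ∀ v h,
      HasDirDerivAt (fun a => z e k i a w y v) (z e (k + 1) i a (Fin.cons h w) y v) a h := by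
    intro e k i a ha w y hy v h
    have hs : ScalarSmoothOn S (fun a => z e k i a w y v) := fun l =>
      (hzs e k i l).comp (f := fun a => ((a, w), (y, v))) (by fun_prop)
        (fun a ha => ⟨⟨ha, mem_univ _⟩, ⟨hy, mem_univ _⟩⟩)
    obtain ⟨b, hb, hb'⟩ := hs.exists_dirDeriv hS ha h
    have hbz : b = z e (k + 1) i a (Fin.cons h w) y v := eq_of_forall_dual_eq fun l => by
      rw [hb', hz e l (k + 1) i a ha _ y hy v]
      have h1 : (fun a => l (z e k i a w y v)) =ᶠ[𝓝 a]
          fun a => iterDeriv (fun y => iterDeriv (fun a => F e l a y) k a w) i y v := by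
        filter_upwards [hS.mem_nhds ha] with a' ha' using hz e l k i a' ha' w y hy v
      rw [h1.fderiv_eq, fderiv_iterDeriv_comm
        (F := fun a y => iterDeriv (fun a => F e l a y) k a w) i _ h v]
      · rfl
      · filter_upwards [(hT e).mem_nhds hy] with y' hy'
        exact ContDiffAt.comp (a, y')
          (g := fun q : (E' × (Fin k → E')) × E => iterDeriv (fun a => F e l a q.2) k q.1.1 q.1.2)
          (f := fun p : E' × E => ((p.1, w), p.2)) (hG e l k a ha w y' hy') (by fun_prop)
    rwa [← hbz]
  refine ⟨D, ⟨fun a ha w => ?_, fun k a ha w h => ?_, fun k => ?_⟩⟩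
  · refine Subtype.ext ((hDd 0 a ha w).trans (funext fun x => ?_))
    exact eq_of_forall_dual_eq fun l => (hux x).dual_weakDeriv hS 0 a ha w l
  · refine tendsto_smoothMap_iff.2 fun e i => tendsto_compactOpen_of_locally fun ⟨⟨y, hy⟩, v⟩ => ?_
    have hquot : ∀ (t : ℝ) (q : (e.1.extend I).target × (Fin i → E)),
        SmoothMap.jet e i (t⁻¹ • (D k (a + t • h) w - D k a w)) q =
          t⁻¹ • (z e k i (a + t • h) w q.1 q.2 - z e k i a w q.1 q.2) := by
      intro t q
      change SmoothMap.jetEval e i q _ = _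
      rw [map_smul, map_sub]
      rfl
    simp only [hquot]
    change Tendsto _ _ (𝓝 (z e (k + 1) i a (Fin.cons h w) y v))
    rw [tendsto_iff_seminorm]
    intro p hp ε hε
    -- Joint continuity of the next derivative controls it for all small `t` and all points near
    -- `(y, v)`. The mean value inequality transfers this control to the difference quotient,
    -- uniformly in those points.
    have hcz : ContinuousAt (fun r : ℝ × ((e.1.extend I).target × (Fin i → E)) =>
        p (z e (k + 1) i (a + r.1 • h) (Fin.cons h w) r.2.1 r.2.2 -
          z e (k + 1) i a (Fin.cons h w) y v)) (0, (⟨y, hy⟩, v)) := by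
      refine hp.continuousAt.comp (ContinuousAt.sub ?_ continuousAt_const)
      have h1 := (hzc e (k + 1) i).continuousAt
        (((hS.prod isOpen_univ).prod ((hT e).prod isOpen_univ)).mem_nhds
        (show ((a, Fin.cons h w), (y, v)) ∈ (S ×ˢ univ) ×ˢ ((e.1.extend I).target ×ˢ univ) from
        ⟨⟨ha, mem_univ _⟩, ⟨hy, mem_univ _⟩⟩))
      refine ContinuousAt.comp_of_eq (f := fun r : ℝ × ((e.1.extend I).target × (Fin i → E)) =>
        ((a + r.1 • h, (Fin.cons h w : Fin (k + 1) → E')), ((r.2.1 : E), r.2.2))) h1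
        (Continuous.continuousAt (by fun_prop)) (by simp)
    have hev := hcz.eventually_lt (continuousAt_const (y := ε / 2)) (by simpa using half_pos hε)
    have hevS : ∀ᶠ t : ℝ in 𝓝 0, a + t • h ∈ S := by
      have h1 : Continuous fun t : ℝ => a + t • h := by fun_prop
      exact h1.continuousAt.eventually (hS.mem_nhds (by simpa using ha))
    rw [nhds_prod_eq, Filter.eventually_prod_iff] at hev
    obtain ⟨A, hA, B, hB, hAB⟩ := hev
    obtain ⟨δ, hδ, hball⟩ := Metric.mem_nhds_iff.1 (hA.and hevS)
    have hA' : ∀ᶠ t : ℝ in 𝓝[≠] 0, t ∈ Metric.ball (0 : ℝ) δ ∧ t ≠ 0 :=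
      (eventually_mem_set.2 (nhdsWithin_le_nhds (Metric.ball_mem_nhds 0 hδ))).and self_mem_nhdsWithin
    refine Filter.eventually_prod_iff.2 ⟨_, hA', B, hB, fun {t} ht {q} hq => ?_⟩
    have hsub : ∀ s ∈ uIcc 0 t, s ∈ Metric.ball (0 : ℝ) δ := fun s hs => by
      have h1 := abs_sub_left_of_mem_uIcc hs
      have h2 := ht.1
      simp only [sub_zero] at h1
      rw [mem_ball_zero_iff, Real.norm_eq_abs] at h2 ⊢
      linarith
    have h1 := seminorm_slope_sub_le hp (f := fun s => z e k i (a + s • h) w q.1 q.2)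
      (f' := fun s => z e (k + 1) i (a + s • h) (Fin.cons h w) q.1 q.2)
      (d := z e (k + 1) i a (Fin.cons h w) y v) (c := ε / 2) ht.2
      (fun s hs => (hzd e k i _ (hball (hsub s hs)).2 w q.1 q.1.2 q.2 h).comp_line)
      (fun s hs => (hAB (hball (hsub s hs)).1 hq).le)
    simp only [zero_smul, add_zero] at h1
    exact h1.trans_lt (half_lt_self hε)
  · rw [continuousOn_iff_continuous_domRestrict]
    refine continuous_smoothMap_iff.2 fun e i => ?_
    exact (hzc e k i).comp_continuous
      (f := fun q : (S ×ˢ univ : Set (E' × (Fin k → E'))) × (e.1.extend I).target × (Fin i → E) =>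
        ((q.1.1.1, q.1.1.2), ((q.2.1 : E), q.2.2))) (by fun_prop)
      (fun q => ⟨q.1.2, ⟨q.2.1.2, mem_univ _⟩⟩)

theorem IsSmooth.continuous [IsManifold J ∞ N] {W : Type*} [AddCommGroup W] [Module ℝ W]
    [TopologicalSpace W] {f : N → W} (hf : IsSmooth J f) : Continuous f := by
  rw [continuous_iff_continuousAt]
  intro n
  have hc := IsManifold.chart_mem_maximalAtlas (I := J) (n := ∞) n
  obtain ⟨D, hD⟩ := hf _ hc
  set c := chartAt H' n
  have h1 : ContinuousOn (fun a => f ((c.extend J).symm a)) (c.extend J).target :=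
    ((hD.cont 0).comp (f := fun a => (a, Fin.elim0)) (by fun_prop)
      (fun a ha => ⟨ha, mem_univ _⟩)).congr fun a ha => (hD.zero a ha _).symm
  have h2 := h1.comp c.continuousOn_extend (fun y hy => PartialEquiv.map_source _ hy)
  have hx : n ∈ (c.extend J).source := by simp [c]
  refine (h2.congr fun y hy => ?_).continuousAt (c.isOpen_extend_source.mem_nhds hx)
  simp only [Function.comp_apply]
  rw [PartialEquiv.left_inv _ hy]

end ExponentialLaw

/-! ### Functions that are smooth in one variable and depend continuously on a parameter -/

section ParamDiff

variable {P : Type*} [TopologicalSpace P]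
  {E : Type*} [NormedAddCommGroup E] [NormedSpace ℝ E]
  {V : Type*} [AddCommGroup V] [Module ℝ V] [TopologicalSpace V]

/-- `f p x v` is `n` times directionally differentiable in `x ∈ U`, and all these derivatives are
continuous functions of all the variables. The family `f` is regarded as a `k`-th derivative in the
directions `v`. -/
def ParamDiff (U : Set E) : ∀ _ k : ℕ, (P → E → (Fin k → E) → V) → Prop
  | 0, k, f => Continuous fun q : P × U × (Fin k → E) => f q.1 q.2.1 q.2.2
  | n + 1, k, f => (Continuous fun q : P × U × (Fin k → E) => f q.1 q.2.1 q.2.2) ∧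
      ∃ f' : P → E → (Fin (k + 1) → E) → V,
        (∀ p, ∀ x ∈ U, ∀ v h,
          HasDirDerivAt (fun y => f p y v) (f' p x (Fin.cons h v)) x h) ∧
        ParamDiff U n (k + 1) f'

variable {U : Set E} {n k : ℕ} {f g : P → E → (Fin k → E) → V}

theorem ParamDiff.continuous (hf : ParamDiff U n k f) :
    Continuous fun q : P × U × (Fin k → E) => f q.1 q.2.1 q.2.2 := by
  cases n with
  | zero => exact hf
  | succ n => exact hf.1

theorem ParamDiff.of_succ (hf : ParamDiff U (n + 1) k f) : ParamDiff U n k f := by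
  induction n generalizing k with
  | zero => exact hf.1
  | succ n ih =>
    obtain ⟨hc, f', hf', h⟩ := hf
    exact ⟨hc, f', hf', ih h⟩

theorem tendsto_add_smul_nhdsNE (x h : E) :
    Tendsto (fun t : ℝ => x + t • h) (𝓝[≠] 0) (𝓝 x) := by
  have h1 : Continuous fun t : ℝ => x + t • h := by fun_prop
  have h2 := h1.tendsto 0
  simp only [zero_smul, add_zero] at h2
  exact h2.mono_left nhdsWithin_le_nhds

theorem HasDirDerivAt.congr_of_eqOn (hU : IsOpen U) {φ ψ : E → V} {d : V} {x h : E} (hx : x ∈ U)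
    (hφ : HasDirDerivAt φ d x h) (he : EqOn φ ψ U) : HasDirDerivAt ψ d x h := by
  refine Tendsto.congr' ?_ hφ
  filter_upwards [tendsto_add_smul_nhdsNE x h (hU.mem_nhds hx)] with t ht
  rw [he ht, he hx]

theorem ParamDiff.congr (hU : IsOpen U) (hf : ParamDiff U n k f)
    (he : ∀ p, ∀ x ∈ U, ∀ v, f p x v = g p x v) : ParamDiff U n k g := by
  have hc : Continuous fun q : P × U × (Fin k → E) => g q.1 q.2.1 q.2.2 :=
    hf.continuous.congr fun q => he _ _ q.2.1.2 _
  cases n with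
  | zero => exact hc
  | succ n =>
    obtain ⟨-, f', hf', h⟩ := hf
    exact ⟨hc, f', fun p x hx v h => (hf' p x hx v h).congr_of_eqOn hU hx fun y hy => he p y hy v, h⟩

theorem ParamDiff.of_derivs {D : ∀ k : ℕ, P → E → (Fin k → E) → V}
    (hc : ∀ k, Continuous fun q : P × U × (Fin k → E) => D k q.1 q.2.1 q.2.2)
    (hd : ∀ k p, ∀ x ∈ U, ∀ v h,
      HasDirDerivAt (fun y => D k p y v) (D (k + 1) p x (Fin.cons h v)) x h) (n k : ℕ) :
    ParamDiff U n k (D k) := by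
  induction n generalizing k with
  | zero => exact hc k
  | succ n ih => exact ⟨hc k, D (k + 1), hd k, ih (k + 1)⟩

/-- In the product rule one factor does not see the newest direction; stability under a change of
directions lets such factors stay in the induction. -/
theorem ParamDiff.comp_directions {m : ℕ} {σ : (Fin m → E) → (Fin k → E)} (hσ : Continuous σ)
    (hf : ParamDiff U n k f) : ParamDiff U n m (fun p x v => f p x (σ v)) := by
  induction n generalizing k m with
  | zero =>
    exact Continuous.comp (g := fun q : P × U × (Fin k → E) => f q.1 q.2.1 q.2.2)
      (f := fun q : P × U × (Fin m → E) => (q.1, q.2.1, σ q.2.2)) hf (by fun_prop)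
  | succ n ih =>
    obtain ⟨hc, f', hf', h⟩ := hf
    have hτ : Continuous fun w : Fin (m + 1) → E =>
        (Fin.cons (w 0) (σ (Fin.tail w)) : Fin (k + 1) → E) := by
      have h1 : Continuous fun w : Fin (m + 1) → E => σ (Fin.tail w) :=
        hσ.comp (by unfold Fin.tail; fun_prop)
      fun_prop
    refine ⟨Continuous.comp (g := fun q : P × U × (Fin k → E) => f q.1 q.2.1 q.2.2)
      (f := fun q : P × U × (Fin m → E) => (q.1, q.2.1, σ q.2.2)) hc (by fun_prop),
      fun p x w => f' p x (Fin.cons (w 0) (σ (Fin.tail w))), fun p x hx v h => ?_, ih hτ h⟩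
    simpa using hf' p x hx (σ v) h

variable [IsTopologicalAddGroup V] [ContinuousSMul ℝ V]

theorem ParamDiff.add (hf : ParamDiff U n k f) (hg : ParamDiff U n k g) :
    ParamDiff U n k (fun p x v => f p x v + g p x v) := by
  induction n generalizing k with
  | zero => exact Continuous.add hf hg
  | succ n ih =>
    obtain ⟨hc, f', hf', h⟩ := hf
    obtain ⟨hc', g', hg', h'⟩ := hg
    refine ⟨hc.add hc', fun p x v => f' p x v + g' p x v, fun p x hx v w => ?_, ih h h'⟩
    refine Tendsto.congr (fun t => ?_) ((hf' p x hx v w).add (hg' p x hx v w))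
    rw [← smul_add, add_sub_add_comm]

theorem ParamDiff.smul (hU : IsOpen U) {φ : P → E → (Fin k → E) → ℝ} (hφ : ParamDiff U n k φ)
    (hf : ParamDiff U n k f) : ParamDiff U n k (fun p x v => φ p x v • f p x v) := by
  induction n generalizing k with
  | zero => exact Continuous.smul hφ hf
  | succ n ih =>
    have htail : Continuous fun w : Fin (k + 1) → E => (Fin.tail w : Fin k → E) := by
      unfold Fin.tail; fun_prop
    have hφ0 := hφ.of_succ.comp_directions htail
    have hf0 := hf.of_succ.comp_directions htail
    obtain ⟨hc, φ', hφ', h⟩ := hφ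
    obtain ⟨hc', f', hf', h'⟩ := hf
    refine ⟨hc.smul hc', fun p x v => φ' p x v • f p x (Fin.tail v) + φ p x (Fin.tail v) • f' p x v,
      fun p x hx v w => ?_, (ih h hf0).add (ih hφ0 h')⟩
    have hfc : Tendsto (fun t : ℝ => f p (x + t • w) v) (𝓝[≠] 0) (𝓝 (f p x v)) := by
      have h1 : ContinuousOn (fun y => f p y v) U := by
        rw [continuousOn_iff_continuous_domRestrict]
        exact hc'.comp (f := fun y : U => (p, y, v)) (by fun_prop)
      exact (h1.continuousAt (hU.mem_nhds hx)).tendsto.comp (tendsto_add_smul_nhdsNE x w)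
    have h1 := ((hφ' p x hx v w).smul hfc).add ((hf' p x hx v w).const_smul (φ p x v))
    simp only [HasDirDerivAt, Fin.tail_cons]
    refine Tendsto.congr (fun t => ?_) h1
    simp only [smul_eq_mul]
    module

variable [T2Space V]

/-- Each order `n` comes with its own chain of derivatives. Limits in `V` are unique, so these
chains agree on `U` and a single infinite sequence can be chosen step by step. -/
theorem exists_derivs_of_paramDiff (hU : IsOpen U) {f : P → E → V}
    (hf : ∀ n, ParamDiff U n 0 (fun p x _ => f p x)) :
    ∃ D : ∀ k : ℕ, P → E → (Fin k → E) → V, (∀ p x v, D 0 p x v = f p x) ∧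
      (∀ k, Continuous fun q : P × U × (Fin k → E) => D k q.1 q.2.1 q.2.2) ∧
      ∀ k p, ∀ x ∈ U, ∀ v h,
        HasDirDerivAt (fun y => D k p y v) (D (k + 1) p x (Fin.cons h v)) x h := by
  have step : ∀ k (φ : {φ : P → E → (Fin k → E) → V // ∀ n, ParamDiff U n k φ}),
      ∃ ψ : {ψ : P → E → (Fin (k + 1) → E) → V // ∀ n, ParamDiff U n (k + 1) ψ},
        ∀ p, ∀ x ∈ U, ∀ v h,
          HasDirDerivAt (fun y => φ.1 p y v) (ψ.1 p x (Fin.cons h v)) x h := by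
    rintro k ⟨φ, hφ⟩
    obtain ⟨-, ψ, hψ, -⟩ := hφ 1
    refine ⟨⟨ψ, fun n => ?_⟩, hψ⟩
    obtain ⟨-, ψ', hψ', h⟩ := hφ (n + 1)
    refine h.congr hU fun p x hx v => ?_
    have h1 := hψ p x hx (Fin.tail v) (v 0)
    have h2 := hψ' p x hx (Fin.tail v) (v 0)
    rw [Fin.cons_self_tail] at h1 h2
    exact tendsto_nhds_unique h2 h1
  choose next hnext using step
  let D : ∀ k, {φ : P → E → (Fin k → E) → V // ∀ n, ParamDiff U n k φ} := fun k =>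
    Nat.rec ⟨fun p x _ => f p x, hf⟩ (fun k φ => next k φ) k
  exact ⟨fun k => (D k).1, fun p x v => rfl, fun k => ((D k).2 0), fun k => hnext k (D k)⟩

end ParamDiff

/-! ### Differentiation under the integral sign with a continuous parameter -/

section ParamIntegral

open MeasureTheory

variable {P : Type*} [TopologicalSpace P]
  {E : Type*} [NormedAddCommGroup E] [NormedSpace ℝ E]
  {V : Type*} [AddCommGroup V] [Module ℝ V] [UniformSpace V] [IsUniformAddGroup V]
  [ContinuousSMul ℝ V] [LocallyConvexSpace ℝ V] [T2Space V] [QuasiCompleteSpace ℝ V]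
  {G : Type*} [TopologicalSpace G] [MeasurableSpace G] [OpensMeasurableSpace G] [T2Space G]
  {μ : Measure G} [IsFiniteMeasureOnCompacts μ] {U : Set E}

/-- The mean value inequality bounds the difference quotient minus `f' x` by the oscillation of `f'`
near `x`, which is small uniformly on the compact set `K` carrying all the integrands. -/
theorem hasDirDerivAt_weakIntegral (hU : IsOpen U) {f f' : E → G → V} {x h : E} (hx : x ∈ U)
    (hf : Continuous fun q : U × G => f q.1 q.2) (hf' : Continuous fun q : U × G => f' q.1 q.2)
    (hd : ∀ x ∈ U, ∀ g, HasDirDerivAt (fun y => f y g) (f' x g) x h)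
    {N : Set E} (hN : N ∈ 𝓝 x) {K : Set G} (hK : IsCompact K) (h0 : ∀ y ∈ N, ∀ g ∉ K, f y g = 0)
    (h0' : ∀ g ∉ K, f' x g = 0) :
    HasDirDerivAt (fun y => weakIntegral μ (f y)) (weakIntegral μ (f' x)) x h := by
  refine tendsto_iff_seminorm.2 fun p hp ε hε => ?_
  have hfc : ∀ y ∈ U, Continuous (f y) := fun y hy =>
    hf.comp (f := fun g => ((⟨y, hy⟩ : U), g)) (by fun_prop)
  have hfc' : Continuous (f' x) := hf'.comp (f := fun g => ((⟨x, hx⟩ : U), g)) (by fun_prop)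
  let δ : ℝ := ε / ((μ K).toReal + 1)
  have hm : 0 ≤ (μ K).toReal := ENNReal.toReal_nonneg
  have hδ : 0 < δ := div_pos hε (by linarith)
  have h1 : ∀ᶠ y : U in 𝓝 (⟨x, hx⟩ : U), ∀ g ∈ K, p (f' y g - f' x g) < δ := by
    refine hK.eventually_forall_of_forall_eventually fun g _ => ?_
    have h2 : Continuous fun z : U × G => p (f' z.1 z.2 - f' x z.2) :=
      hp.comp (hf'.sub (hfc'.comp continuous_snd))
    exact h2.continuousAt.eventually_lt (x₀ := ((⟨x, hx⟩ : U), g)) continuousAt_const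
      (by simpa using hδ)
  have h2 : ∀ᶠ y in 𝓝 x, y ∈ U ∧ ∀ g ∈ K, p (f' y g - f' x g) < δ := by
    rw [← map_nhds_subtype_coe_eq_nhds hx (hU.mem_nhds hx), eventually_map]
    filter_upwards [h1] with y hy using ⟨y.2, hy⟩
  have hline : ∀ᶠ t in 𝓝 (0 : ℝ), x + t • h ∈ N ∧ x + t • h ∈ U ∧
      ∀ g ∈ K, p (f' (x + t • h) g - f' x g) < δ := by
    have h3 : Continuous fun t : ℝ => x + t • h := by fun_prop
    have h4 : Tendsto (fun t : ℝ => x + t • h) (𝓝 0) (𝓝 x) := by simpa using h3.tendsto 0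
    exact h4.eventually ((eventually_mem_set.2 hN).and h2)
  obtain ⟨r, hr, hball⟩ := Metric.mem_nhds_iff.1 hline
  filter_upwards [nhdsWithin_le_nhds (Metric.ball_mem_nhds 0 hr), self_mem_nhdsWithin] with t ht ht0
  have hsub : ∀ s ∈ uIcc 0 t, s ∈ Metric.ball (0 : ℝ) r := fun s hs => by
    have h1 := abs_sub_left_of_mem_uIcc hs
    simp only [sub_zero] at h1
    rw [mem_ball_zero_iff, Real.norm_eq_abs] at ht ⊢
    linarith
  have hxN := mem_of_mem_nhds hN
  obtain ⟨htN, htU, -⟩ := hball ht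
  have hq0 : ∀ g ∉ K, t⁻¹ • (f (x + t • h) g - f x g) = 0 := fun g hg => by
    rw [h0 _ htN g hg, h0 x hxN g hg, sub_zero, smul_zero]
  have hquot : t⁻¹ • (weakIntegral μ (f (x + t • h)) - weakIntegral μ (f x)) =
      weakIntegral μ (fun g => t⁻¹ • (f (x + t • h) g - f x g)) := by
    refine (weakIntegral_eq fun l => ?_).symm
    simp only [map_smul, map_sub, smul_eq_mul]
    rw [integral_const_mul, integral_sub (integrable_dual (hfc _ htU) hK (h0 _ htN) l)
      (integrable_dual (hfc x hx) hK (h0 x hxN) l),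
      dual_weakIntegral (hfc _ htU) hK (h0 _ htN), dual_weakIntegral (hfc x hx) hK (h0 x hxN)]
  rw [hquot]
  refine (seminorm_weakIntegral_sub_le (μ := μ) (((hfc _ htU).sub (hfc x hx)).const_smul t⁻¹) hfc'
    hK hq0 h0' hp (c := δ) fun g hg => ?_).trans_lt ?_
  · have h5 := seminorm_slope_sub_le hp (f := fun s => f (x + s • h) g)
      (f' := fun s => f' (x + s • h) g) (d := f' x g) (c := δ) ht0
      (fun s hs => (hd _ (hball (hsub s hs)).2.1 g).comp_line)
      (fun s hs => ((hball (hsub s hs)).2.2 g hg).le)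
    simpa using h5
  · rw [div_mul_eq_mul_div, div_lt_iff₀ (by linarith)]
    nlinarith

theorem ParamDiff.weakIntegral (hU : IsOpen U) {n k : ℕ} {f : P × G → E → (Fin k → E) → V}
    (hf : ParamDiff U n k f)
    (h0 : ∀ p₀, ∀ x₀ ∈ U, ∃ N ∈ 𝓝 (p₀, x₀), ∃ K : Set G, IsCompact K ∧
      ∀ q ∈ N, ∀ g ∉ K, ∀ v, f (q.1, g) q.2 v = 0) :
    ParamDiff U n k (fun p x v => weakIntegral μ (fun g => f (p, g) x v)) := by
  have hc : ∀ {k : ℕ} {f : P × G → E → (Fin k → E) → V}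
      (_ : Continuous fun q : (P × G) × U × (Fin k → E) => f q.1 q.2.1 q.2.2)
      (_ : ∀ p₀, ∀ x₀ ∈ U, ∃ N ∈ 𝓝 (p₀, x₀), ∃ K : Set G, IsCompact K ∧
        ∀ q ∈ N, ∀ g ∉ K, ∀ v, f (q.1, g) q.2 v = 0),
      Continuous fun q : P × U × (Fin k → E) =>
        EquivCoh.weakIntegral μ (fun g => f (q.1, g) q.2.1 q.2.2) := by
    intro k f hf h0
    rw [continuous_iff_continuousAt]
    rintro ⟨p, x, v⟩
    obtain ⟨N, hN, K, hK, hNK⟩ := h0 p x x.2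
    have hm : Continuous fun q : P × U × (Fin k → E) => (q.1, (q.2.1 : E)) := by fun_prop
    exact continuousAt_weakIntegral (μ := μ) (P := P × U × (Fin k → E))
      (f := fun q g => f (q.1, g) q.2.1 q.2.2)
      (hf.comp (f := fun q : (P × U × (Fin k → E)) × G => ((q.1.1, q.2), q.1.2)) (by fun_prop))
      (hm.continuousAt hN) hK (fun q hq g hg => hNK _ hq g hg _)
  induction n generalizing k with
  | zero => exact hc hf h0
  | succ n ih =>
    obtain ⟨hfc, f', hd, hf'⟩ := hf
    -- The support condition passes to the derivative: at an interior point of `N` the difference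
    -- quotients vanish for small `t`, and so does their limit.
    have h0' : ∀ p₀, ∀ x₀ ∈ U, ∃ N ∈ 𝓝 (p₀, x₀), ∃ K : Set G, IsCompact K ∧
        ∀ q ∈ N, ∀ g ∉ K, ∀ v, f' (q.1, g) q.2 v = 0 := by
      intro p x hx
      obtain ⟨N, hN, K, hK, hNK⟩ := h0 p x hx
      refine ⟨interior N ∩ (univ ×ˢ U), inter_mem (interior_mem_nhds.2 hN)
        ((isOpen_univ.prod hU).mem_nhds ⟨mem_univ _, hx⟩), K, hK, fun q hq g hg v => ?_⟩
      have h1 := hd (q.1, g) q.2 hq.2.2 (Fin.tail v) (v 0)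
      rw [Fin.cons_self_tail] at h1
      refine tendsto_nhds_unique h1 (tendsto_const_nhds.congr' ?_)
      have hm : Tendsto (fun t : ℝ => (q.1, q.2 + t • v 0)) (𝓝[≠] 0) (𝓝 q) :=
        tendsto_const_nhds.prodMk_nhds (tendsto_add_smul_nhdsNE q.2 (v 0))
      filter_upwards [hm (isOpen_interior.mem_nhds hq.1)] with t ht
      have h2 := hNK _ (interior_subset ht) g hg (Fin.tail v)
      have h3 := hNK _ (interior_subset hq.1) g hg (Fin.tail v)
      simp only at h2
      rw [h2, h3, sub_zero, smul_zero]
    refine ⟨hc hfc h0, fun p x v => EquivCoh.weakIntegral μ (fun g => f' (p, g) x v),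
      fun p x hx v h => ?_, ih hf' h0'⟩
    obtain ⟨N, hN, K, hK, hNK⟩ := h0 p x hx
    obtain ⟨N', hN', K', hK', hNK'⟩ := h0' p x hx
    have hm : Continuous fun y : E => (p, y) := by fun_prop
    exact hasDirDerivAt_weakIntegral hU (f := fun y g => f (p, g) y v)
      (f' := fun y g => f' (p, g) y (Fin.cons h v)) hx
      (hfc.comp (f := fun q : U × G => ((p, q.2), q.1, v)) (by fun_prop))
      (hf'.continuous.comp (f := fun q : U × G => ((p, q.2), q.1, (Fin.cons h v : Fin (k + 1) → E)))
        (by fun_prop))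
      (fun y hy g => hd (p, g) y hy v h) (hm.continuousAt hN) (hK.union hK')
      (fun y hy g hg => hNK _ hy g (fun h => hg (Or.inl h)) v)
      (fun g hg => hNK' _ (mem_of_mem_nhds hN') g (fun h => hg (Or.inr h)) _)

end ParamIntegral

/-! ### Products and integrals of continuous families in `C^∞(M, V)` -/

section SmoothMapParam

variable {E H : Type*} [NormedAddCommGroup E] [NormedSpace ℝ E] [TopologicalSpace H]
  {I : ModelWithCorners ℝ E H} {M : Type*} [TopologicalSpace M] [ChartedSpace H M]
  {V : Type*} [AddCommGroup V] [Module ℝ V] [UniformSpace V]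
  [IsUniformAddGroup V] [ContinuousSMul ℝ V] [LocallyConvexSpace ℝ V] [T2Space V]
  [QuasiCompleteSpace ℝ V] [FiniteDimensional ℝ E] [I.Boundaryless]
  {P : Type*} [TopologicalSpace P]

theorem paramDiff_of_continuous {f : P → SmoothMap I M V} (hf : Continuous f)
    (e : IsManifold.maximalAtlas I ∞ M) (n : ℕ) :
    ParamDiff (e.1.extend I).target n 0
      (fun p x (_ : Fin 0 → E) => f p ((e.1.extend I).symm x)) :=
  (ParamDiff.of_derivs (D := fun k p x v => (f p).chartDeriv e k x v)
    (continuous_smoothMap_iff.1 hf e)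
    (fun k p x hx v h => ((f p).hasDirDerivsOn_chartDeriv e).succ k x hx v h) n 0).congr
    e.1.isOpen_extend_target fun p _ hx v => (f p).chartDeriv_zero e hx v

/-- Converse of `paramDiff_of_continuous`. Together they replace continuity into the `C^∞`-topology
by a condition in charts that survives products and integration. -/
theorem continuous_of_paramDiff {f : P → M → V}
    (hf : ∀ (e : IsManifold.maximalAtlas I ∞ M) (n : ℕ), ParamDiff (e.1.extend I).target n 0
      (fun p x (_ : Fin 0 → E) => f p ((e.1.extend I).symm x))) :
    ∃ hs : ∀ p, IsSmooth I (f p), Continuous fun p => (SmoothMap.mk (f p) (hs p) : SmoothMap I M V) := by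
  have h1 := fun e : IsManifold.maximalAtlas I ∞ M =>
    exists_derivs_of_paramDiff e.1.isOpen_extend_target (hf e)
  choose D hD0 hDc hDd using h1
  have hD : ∀ e p, HasDirDerivsOn (e.1.extend I).target (fun x => f p ((e.1.extend I).symm x))
      (fun k x v => D e k p x v) := fun e p =>
    { zero := fun x _ v => hD0 e p x v
      succ := fun k x hx v h => hDd e k p x hx v h
      cont := fun k => by
        have h2 : Continuous fun q : ((e.1.extend I).target ×ˢ univ : Set (E × (Fin k → E))) =>
            D e k p q.1.1 q.1.2 :=
          (hDc e k).comp (f := fun q : ((e.1.extend I).target ×ˢ univ : Set (E × (Fin k → E))) =>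
            (p, (⟨q.1.1, q.2.1⟩ : (e.1.extend I).target), q.1.2)) (by fun_prop)
        exact continuousOn_iff_continuous_domRestrict.2 h2 }
  have hs : ∀ p, IsSmooth I (f p) := fun p e he => ⟨_, hD ⟨e, he⟩ p⟩
  refine ⟨hs, continuous_smoothMap_iff.2 fun e k => (hDc e k).congr fun q => ?_⟩
  exact HasDirDerivsOn.unique e.1.isOpen_extend_target (hD e q.1)
    (SmoothMap.hasDirDerivsOn_chartDeriv e (SmoothMap.mk (f q.1) (hs q.1))) k _ q.2.1.2 _

theorem continuous_smoothMap_smul {φ : P → SmoothMap I M ℝ} (hφ : Continuous φ)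
    {f : P → SmoothMap I M V} (hf : Continuous f) :
    ∃ hs : ∀ p, IsSmooth I (fun x => φ p x • f p x),
      Continuous fun p => (SmoothMap.mk (fun x => φ p x • f p x) (hs p) : SmoothMap I M V) :=
  continuous_of_paramDiff fun e n =>
    (paramDiff_of_continuous hφ e n).smul e.1.isOpen_extend_target (paramDiff_of_continuous hf e n)

open MeasureTheory in
theorem continuous_smoothMap_weakIntegral {G : Type*} [TopologicalSpace G] [MeasurableSpace G]
    [OpensMeasurableSpace G] [T2Space G] {μ : Measure G} [IsFiniteMeasureOnCompacts μ]
    {f : P × G → SmoothMap I M V} (hf : Continuous f)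
    (h0 : ∀ p₀ x₀, ∃ N ∈ 𝓝 (p₀, x₀), ∃ K : Set G, IsCompact K ∧
      ∀ q ∈ N, ∀ g ∉ K, f (q.1, g) q.2 = 0) :
    ∃ hs : ∀ p, IsSmooth I (fun x => weakIntegral μ (fun g => f (p, g) x)),
      Continuous fun p =>
        (SmoothMap.mk (fun x => weakIntegral μ (fun g => f (p, g) x)) (hs p) : SmoothMap I M V) := by
  refine continuous_of_paramDiff fun e n =>
    (paramDiff_of_continuous hf e n).weakIntegral e.1.isOpen_extend_target fun p x hx => ?_
  obtain ⟨N, hN, K, hK, hNK⟩ := h0 p ((e.1.extend I).symm x)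
  have h1 : ContinuousAt (e.1.extend I).symm x :=
    (contMDiffOn_extend_symm_target e.2).continuousOn.continuousAt
      (e.1.isOpen_extend_target.mem_nhds hx)
  refine ⟨(fun q : P × E => (q.1, (e.1.extend I).symm q.2)) ⁻¹' N, ?_, K, hK,
    fun q hq g hg v => hNK _ hq g hg⟩
  have h2 : ContinuousAt (fun q : P × E => (q.1, (e.1.extend I).symm q.2)) (p, x) :=
    continuousAt_fst.prodMk (ContinuousAt.comp (f := Prod.snd) h1 continuousAt_snd)
  exact h2 hN

end SmoothMapParam

/-! ### Finite powers of a manifold -/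

section Pi

variable {ι : Type*} [Fintype ι] {E H : Type*} [NormedAddCommGroup E] [NormedSpace ℝ E]
  [TopologicalSpace H] {I : ModelWithCorners ℝ E H} {M : Type*} [TopologicalSpace M]
  [ChartedSpace H M] {n : WithTop ℕ∞}

instance boundaryless_pi [I.Boundaryless] :
    (ModelWithCorners.pi fun _ : ι => I).Boundaryless := by
  constructor
  refine eq_univ_of_forall fun x => ?_
  choose y hy using fun i => (I.range_eq_univ ▸ mem_univ (x i) : x i ∈ range I)
  exact ⟨y, funext hy⟩

instance isManifold_pi [IsManifold I n M] :
    IsManifold (ModelWithCorners.pi fun _ : ι => I) n (ι → M) := by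
  refine isManifold_of_contDiffOn _ _ _ ?_
  rintro _ _ ⟨f, hf, rfl⟩ ⟨g, hg, rfl⟩
  refine contDiffOn_pi.2 fun i => ?_
  have h1 := (contDiffGroupoid n I).compatible (hf i (mem_univ i)) (hg i (mem_univ i))
  rw [contDiffGroupoid, mem_groupoid_of_pregroupoid] at h1
  have h2 : ContDiffOn ℝ n (I ∘ ((f i).symm.trans (g i)) ∘ I.symm)
      (I.symm ⁻¹' ((f i).symm.trans (g i)).source ∩ range I) := h1.1
  refine h2.comp (f := fun x : ι → E => x i) (by fun_prop) ?_
  rintro x ⟨⟨hx1, hx2⟩, y, rfl⟩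
  exact ⟨⟨hx1 i (mem_univ i), hx2 i (mem_univ i)⟩, mem_range_self (y i)⟩

theorem contMDiff_pi_apply (i : ι) :
    ContMDiff (ModelWithCorners.pi fun _ : ι => I) I n (fun α : ι → M => α i) := by
  intro α
  rw [contMDiffAt_iff]
  refine ⟨(continuous_apply i).continuousAt, ?_⟩
  have hc : ContDiffWithinAt ℝ n (fun y : ι → E => y i)
      (range (ModelWithCorners.pi fun _ : ι => I))
      (extChartAt (ModelWithCorners.pi fun _ : ι => I) α α) :=
    (contDiff_apply ℝ E i).contDiffWithinAt
  refine hc.congr_of_eventuallyEq_of_mem ?_ (mem_range_self _)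
  filter_upwards [extChartAt_target_mem_nhdsWithin (I := ModelWithCorners.pi fun _ : ι => I) α]
    with y hy
  have hy' : y i ∈ (extChartAt I (α i)).target := by
    obtain ⟨hy1, hy2⟩ := hy
    exact ⟨hy1 i (mem_univ i), hy2 i (mem_univ i)⟩
  exact (extChartAt I (α i)).right_inv hy'

theorem contMDiff_pi_of_apply {E' H' N : Type*} [NormedAddCommGroup E'] [NormedSpace ℝ E']
    [TopologicalSpace H'] {J : ModelWithCorners ℝ E' H'} [TopologicalSpace N] [ChartedSpace H' N]
    {f : N → ι → M} (hf : ∀ i, ContMDiff J I n (fun x => f x i)) :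
    ContMDiff J (ModelWithCorners.pi fun _ : ι => I) n f := by
  intro x
  rw [contMDiffAt_iff_target]
  refine ⟨(continuous_pi fun i => (hf i).continuous).continuousAt, ?_⟩
  refine contMDiffAt_pi_space.2 fun i => ?_
  exact (contMDiffAt_iff_target.1 (hf i x)).2

theorem contMDiff_snoc (k : ℕ) :
    ContMDiff ((ModelWithCorners.pi fun _ : Fin k => I).prod I)
      (ModelWithCorners.pi fun _ : Fin (k + 1) => I) n
      (fun p : (Fin k → M) × M => (Fin.snoc p.1 p.2 : Fin (k + 1) → M)) := by
  refine contMDiff_pi_of_apply fun i => ?_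
  induction i using Fin.lastCases with
  | last => simp only [Fin.snoc_last]; exact contMDiff_snd
  | cast i => simp only [Fin.snoc_castSucc]; exact (contMDiff_pi_apply i).comp contMDiff_fst

theorem continuous_snoc (k : ℕ) :
    Continuous (fun p : (Fin k → M) × M => (Fin.snoc p.1 p.2 : Fin (k + 1) → M)) := by
  refine continuous_pi fun i => ?_
  induction i using Fin.lastCases with
  | last => simp only [Fin.snoc_last]; exact continuous_snd
  | cast i => simp only [Fin.snoc_castSucc]; exact (continuous_apply i).comp continuous_fst

theorem continuous_partialProd [Monoid M] [ContinuousMul M] {k : ℕ} (j : Fin (k + 1)) :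
    Continuous (fun α : Fin k → M => Fin.partialProd α j) := by
  induction j using Fin.induction with
  | zero => simp only [Fin.partialProd_zero]; exact continuous_const
  | succ j ih => simp only [Fin.partialProd_succ]; exact ih.mul (continuous_apply j)

theorem contMDiff_partialProd [Monoid M] [ContMDiffMul I n M] {k : ℕ} (j : Fin (k + 1)) :
    ContMDiff (ModelWithCorners.pi fun _ : Fin k => I) I n
      (fun α : Fin k → M => Fin.partialProd α j) := by
  induction j using Fin.induction with
  | zero => simp only [Fin.partialProd_zero]; exact contMDiff_const
  | succ j ih => simp only [Fin.partialProd_succ]; exact ih.mul (contMDiff_pi_apply j)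

end Pi

/-! ### Paracompact locally compact spaces -/

section Topology

/-- Starting from `{x₀}`, repeatedly take the closures of all members of a locally finite,
relatively compact open cover that meet the previous compact set. Only finitely many occur at each
stage, and the union of the stages is clopen. -/
theorem isSigmaCompact_connectedComponent {X : Type*} [TopologicalSpace X] [T2Space X]
    [ParacompactSpace X] [WeaklyLocallyCompactSpace X] (x₀ : X) :
    IsSigmaCompact (connectedComponent x₀) := by
  choose K hK hxK using fun x : X => exists_compact_mem_nhds x
  obtain ⟨v, hvo, hvc, hvf, hvK⟩ := precise_refinement (fun x => interior (K x))
    (fun x => isOpen_interior) (eq_univ_of_forall fun x =>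
      mem_iUnion.2 ⟨x, mem_interior_iff_mem_nhds.2 (hxK x)⟩)
  have hcl : ∀ i, IsCompact (closure (v i)) := fun i =>
    (hK i).of_isClosed_subset isClosed_closure
      (closure_minimal ((hvK i).trans interior_subset) (hK i).isClosed)
  let C : ℕ → Set X := fun n => Nat.rec {x₀}
    (fun _ A => ⋃ i ∈ {i | (v i ∩ A).Nonempty}, closure (v i)) n
  have hC : ∀ n, IsCompact (C n) := by
    intro n
    induction n with
    | zero => exact isCompact_singleton
    | succ n ih => exact (hvf.finite_nonempty_inter_compact ih).isCompact_biUnion fun i _ => hcl i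
  have hstep : ∀ n i, (v i ∩ C n).Nonempty → closure (v i) ⊆ C (n + 1) := fun n i h =>
    subset_biUnion_of_mem (u := fun i => closure (v i)) (show i ∈ {i | (v i ∩ C n).Nonempty} from h)
  have hcover : ∀ x, ∃ i, x ∈ v i := fun x => mem_iUnion.1 (hvc ▸ mem_univ x)
  have hclopen : IsClopen (⋃ n, C n) := by
    constructor
    · refine isClosed_of_closure_subset fun x hx => ?_
      obtain ⟨i, hi⟩ := hcover x
      obtain ⟨y, hy, hyC⟩ := mem_closure_iff.1 hx _ (hvo i) hi
      obtain ⟨n, hn⟩ := mem_iUnion.1 hyC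
      exact mem_iUnion.2 ⟨n + 1, hstep n i ⟨y, hy, hn⟩ (subset_closure hi)⟩
    · refine isOpen_iff_mem_nhds.2 fun x hx => ?_
      obtain ⟨i, hi⟩ := hcover x
      obtain ⟨n, hn⟩ := mem_iUnion.1 hx
      refine mem_of_superset ((hvo i).mem_nhds hi) ?_
      exact subset_closure.trans ((hstep n i ⟨x, hi, hn⟩).trans (subset_iUnion C (n + 1)))
  exact (isSigmaCompact_iUnion_of_isCompact C hC).of_isClosed_subset isClosed_connectedComponent
    (hclopen.connectedComponent_subset (mem_iUnion.2 ⟨0, rfl⟩))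

/-- A locally finite refinement by members of given neighbourhood bases, in a locally compact space
that is partitioned into `σ`-compact open sets. -/
theorem exists_locallyFinite_basis_refinement.{v} {Q κ : Type v} [TopologicalSpace Q] [T2Space Q]
    [WeaklyLocallyCompactSpace Q] {S : κ → Set Q} (hSo : ∀ k, IsOpen (S k))
    (hSσ : ∀ k, IsSigmaCompact (S k)) (hSd : Pairwise fun j k => Disjoint (S j) (S k))
    (hSc : ⋃ k, S k = univ) {ι : Q → Type*} {p : ∀ q, ι q → Prop} {B : ∀ q, ι q → Set Q}
    (hB : ∀ q, (𝓝 q).HasBasis (p q) (B q)) :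
    ∃ (α : Type v) (c : α → Q) (r : ∀ a, ι (c a)), ⋃ a, B (c a) (r a) = univ ∧
      LocallyFinite fun a => B (c a) (r a) := by
  have hclosed : ∀ k, IsClosed (S k) := fun k => by
    have : S k = (⋃ j ∈ {j | j ≠ k}, S j)ᶜ := by
      ext x
      simp only [mem_compl_iff, mem_iUnion, mem_ofPred_eq, not_exists]
      constructor
      · intro hx j hj hxj
        exact disjoint_left.1 (hSd hj) hxj hx
      · intro h
        obtain ⟨j, hj⟩ := mem_iUnion.1 (hSc ▸ mem_univ x : x ∈ ⋃ k, S k)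
        by_contra hx
        exact h j (fun hjk => hx (hjk ▸ hj)) hj
    rw [this]
    exact (isOpen_biUnion fun j _ => hSo j).isClosed_compl
  have key : ∀ k, ∃ (α : Type v) (c : α → Q) (r : ∀ a, ι (c a)), (∀ a, B (c a) (r a) ⊆ S k) ∧
      S k ⊆ ⋃ a, B (c a) (r a) ∧ LocallyFinite fun a => B (c a) (r a) := by
    intro k
    have : SigmaCompactSpace (S k) := isSigmaCompact_iff_sigmaCompactSpace.1 (hSσ k)
    have : WeaklyLocallyCompactSpace (S k) := (hclosed k).isClosedEmbedding_subtypeVal.weaklyLocallyCompactSpace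
    have hB' : ∀ q : S k, (𝓝 q).HasBasis (fun i : ι q => p q i ∧ B q i ⊆ S k)
        (fun i => (Subtype.val ⁻¹' B q i : Set (S k))) := fun q => by
      rw [nhds_subtype_eq_comap]
      exact ((hB q).restrict_subset ((hSo k).mem_nhds q.2)).comap _
    obtain ⟨α, c, r, hp, hc, hf⟩ := refinement_of_locallyCompact_sigmaCompact_of_nhds_basis hB'
    refine ⟨α, fun a => c a, r, fun a => (hp a).2, fun x hx => ?_, fun x => ?_⟩
    · obtain ⟨a, ha⟩ := mem_iUnion.1 (hc ▸ mem_univ (⟨x, hx⟩ : S k) : _ ∈ ⋃ a, _)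
      exact mem_iUnion.2 ⟨a, ha⟩
    · by_cases hx : x ∈ S k
      · obtain ⟨t, ht, hfin⟩ := hf ⟨x, hx⟩
        rw [nhds_subtype_eq_comap, mem_comap] at ht
        obtain ⟨u, hu, hut⟩ := ht
        refine ⟨u ∩ S k, inter_mem hu ((hSo k).mem_nhds hx), hfin.subset ?_⟩
        rintro a ⟨y, hya, hyu, hyS⟩
        exact ⟨⟨y, hyS⟩, hya, hut hyu⟩
      -- The pieces are closed as well as open, so the `k`-th family stays away from points outside
      -- `S k`.
      · refine ⟨(S k)ᶜ, (hclosed k).isOpen_compl.mem_nhds hx, ?_⟩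
        convert finite_empty
        refine eq_empty_of_forall_notMem ?_
        rintro a ⟨y, hya, hyS⟩
        exact hyS ((hp a).2 hya)
  choose α c r hsub hcov hfin using key
  refine ⟨Σ k, α k, fun a => c a.1 a.2, fun a => r a.1 a.2, eq_univ_of_forall fun x => ?_,
    fun x => ?_⟩
  · obtain ⟨k, hk⟩ := mem_iUnion.1 (hSc ▸ mem_univ x : x ∈ ⋃ k, S k)
    obtain ⟨a, ha⟩ := mem_iUnion.1 (hcov k hk)
    exact mem_iUnion.2 ⟨⟨k, a⟩, ha⟩
  · obtain ⟨k, hk⟩ := mem_iUnion.1 (hSc ▸ mem_univ x : x ∈ ⋃ k, S k)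
    obtain ⟨t, ht, htf⟩ := hfin k x
    refine ⟨t ∩ S k, inter_mem ht ((hSo k).mem_nhds hk), (htf.image (Sigma.mk k)).subset ?_⟩
    rintro ⟨j, a⟩ ⟨y, hya, hyt, hyS⟩
    obtain rfl : j = k := by
      by_contra hjk
      exact disjoint_left.1 (hSd hjk) (hsub j a hya) hyS
    exact ⟨a, ⟨y, hya, hyt⟩, rfl⟩

end Topology

/-! ### Images of connected components in the orbit space -/

section Orbits

open MulAction

variable {G X : Type*} [Group G] [TopologicalSpace X] [MulAction G X] [ContinuousConstSMul G X]

/-- Translation by a group element carries components into components, so the image of a component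
depends only on the orbit of its base point. -/
theorem image_mk_connectedComponent_subset {x y : X} (h : (⟦x⟧ : orbitRel.Quotient G X) = ⟦y⟧) :
    (Quotient.mk (orbitRel G X)) '' connectedComponent x ⊆
      (Quotient.mk (orbitRel G X)) '' connectedComponent y := by
  obtain ⟨g, hg⟩ := orbitRel_apply.1 (Quotient.exact h.symm)
  rintro _ ⟨z, hz, rfl⟩
  have hgx : g • x = y := hg
  refine ⟨g • z, ?_, Quotient.sound (orbitRel_apply.2 ⟨g, rfl⟩)⟩
  have := (continuous_const_smul g).image_connectedComponent_subset x ⟨z, hz, rfl⟩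
  rwa [hgx] at this

theorem image_mk_connectedComponent_eq {x y : X}
    (h : ((Quotient.mk (orbitRel G X)) '' connectedComponent x ∩
      (Quotient.mk (orbitRel G X)) '' connectedComponent y).Nonempty) :
    (Quotient.mk (orbitRel G X)) '' connectedComponent x =
      (Quotient.mk (orbitRel G X)) '' connectedComponent y := by
  obtain ⟨_, ⟨a, ha, rfl⟩, b, hb, hab⟩ := h
  rw [connectedComponent_eq ha, connectedComponent_eq hb]
  exact (image_mk_connectedComponent_subset hab.symm).antisymm
    (image_mk_connectedComponent_subset hab)

end Orbits

open MeasureTheory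

/-! ### Integrals depending smoothly on a parameter -/

section ParametricIntegral

variable {E H : Type*} [NormedAddCommGroup E] [NormedSpace ℝ E] [TopologicalSpace H]
  {I : ModelWithCorners ℝ E H} {M : Type*} [TopologicalSpace M] [ChartedSpace H M]
  [FiniteDimensional ℝ E] [I.Boundaryless] [IsManifold I ∞ M]
  {E' H' : Type*} [NormedAddCommGroup E'] [NormedSpace ℝ E'] [TopologicalSpace H']
  {J : ModelWithCorners ℝ E' H'} {N : Type*} [TopologicalSpace N] [ChartedSpace H' N]
  [FiniteDimensional ℝ E'] [J.Boundaryless] [IsManifold J ∞ N]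
  {V : Type*} [AddCommGroup V] [Module ℝ V] [UniformSpace V]
  [IsUniformAddGroup V] [ContinuousSMul ℝ V] [LocallyConvexSpace ℝ V] [T2Space V]
  [QuasiCompleteSpace ℝ V]

/-- By the exponential law, `g ↦ u(·, g)` is a continuous family in `C^∞(M, V)`. Its integral is
smooth in `x`, with a one-point space as the remaining parameter. -/
theorem ScalarSmooth.weakIntegral [MeasurableSpace N] [OpensMeasurableSpace N] [T2Space N]
    {μ : Measure N} [IsFiniteMeasureOnCompacts μ] {u : M → N → V}
    (hu : ScalarSmooth (I.prod J) (fun p : M × N => u p.1 p.2))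
    (h0 : ∀ x₀, ∃ U ∈ 𝓝 x₀, ∃ K : Set N, IsCompact K ∧ ∀ x ∈ U, ∀ g ∉ K, u x g = 0) :
    ScalarSmooth I (fun x => weakIntegral μ (u x)) := by
  have hu' : ScalarSmooth (J.prod I) (fun p : N × M => u p.2 p.1) := fun l =>
    (hu l).comp (contMDiff_snd.prodMk contMDiff_fst)
  have hs := isSmooth_smoothMap (u := fun g x => u x g) hu'
  have hc := hs.continuous
  obtain ⟨hs, -⟩ := continuous_smoothMap_weakIntegral (μ := μ) (P := Unit)
    (hc.comp continuous_snd) (by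
      rintro ⟨⟩ x₀
      obtain ⟨U, hU, K, hK, h⟩ := h0 x₀
      exact ⟨Prod.snd ⁻¹' U, continuous_snd.continuousAt.preimage_mem_nhds hU, K, hK,
        fun q hq g hg => h q.2 hq g hg⟩)
  exact (hs ()).scalarSmooth

end ParametricIntegral

/-! ### Cutoff functions of proper actions -/

section Bumps

universe v

variable {G : Type*} [TopologicalSpace G] [Group G] [IsTopologicalGroup G]
  {E H : Type*} [NormedAddCommGroup E] [NormedSpace ℝ E] [FiniteDimensional ℝ E]
  [TopologicalSpace H] (I : ModelWithCorners ℝ E H) [I.Boundaryless] {X : Type v}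
  [TopologicalSpace X] [T2Space X] [ParacompactSpace X] [ChartedSpace H X] [IsManifold I ∞ X]
  [MulAction G X] [ProperSMul G X]

variable (G X) in
-- The refinement takes place in the orbit space, which is Hausdorff by properness; since the
-- projection is open, images of supports of bump functions form neighbourhood bases there. As `X`
-- may have uncountably many components, the orbit space is partitioned into images of components,
-- each `σ`-compact.
theorem exists_bump_family : ∃ (α : Type v) (ψ : α → X → ℝ),
    (∀ a, ContMDiff I 𝓘(ℝ) ∞ (ψ a)) ∧ (∀ a, HasCompactSupport (ψ a)) ∧ (∀ a x, 0 ≤ ψ a x) ∧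
    (∀ x, ∃ (a : α) (g : G), ψ a (g • x) ≠ 0) ∧
    LocallyFinite fun a => Quotient.mk (MulAction.orbitRel G X) '' Function.support (ψ a) := by
  have : LocallyCompactSpace X := Manifold.locallyCompact_of_finiteDimensional I
  have : LocallyConnectedSpace H := I.toHomeomorph.isOpenEmbedding.locallyConnectedSpace
  have : LocallyConnectedSpace X := ChartedSpace.locallyConnectedSpace H X
  let π : X → MulAction.orbitRel.Quotient G X := Quotient.mk (MulAction.orbitRel G X)
  have hπ : IsOpenQuotientMap π := MulAction.isOpenQuotientMap_quotientMk
  have : WeaklyLocallyCompactSpace (MulAction.orbitRel.Quotient G X) := by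
    refine ⟨fun q => ?_⟩
    obtain ⟨x, rfl⟩ := hπ.surjective q
    obtain ⟨K, hK, hxK⟩ := exists_compact_mem_nhds x
    exact ⟨π '' K, hK.image hπ.continuous, hπ.isOpenMap.image_mem_nhds hxK⟩
  have : T2Space (MulAction.orbitRel.Quotient G X) := t2Space_quotient_mulAction_of_properSMul
  let κ := range fun x : X => π '' connectedComponent x
  have hB : ∀ q : MulAction.orbitRel.Quotient G X, (𝓝 q).HasBasis
      (fun f : SmoothBumpFunction I q.out => tsupport f ⊆ univ)
      (fun f => π '' Function.support f) := fun q => by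
    have h1 := (SmoothBumpFunction.nhds_basis_support (I := I) (c := q.out) univ_mem).map π
    rwa [hπ.isOpenMap.map_nhds_eq hπ.continuous.continuousAt,
      show π q.out = q from Quotient.out_eq q] at h1
  have hSo : ∀ k : κ, IsOpen k.1 := by
    rintro ⟨_, x, rfl⟩
    exact hπ.isOpenMap _ isOpen_connectedComponent
  have hSσ : ∀ k : κ, IsSigmaCompact k.1 := by
    rintro ⟨_, x, rfl⟩
    exact (isSigmaCompact_connectedComponent x).image hπ.continuous
  have hSd : Pairwise fun j k : κ => Disjoint j.1 k.1 := by
    rintro ⟨_, x, rfl⟩ ⟨_, y, rfl⟩ hne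
    by_contra h
    exact hne (Subtype.ext (image_mk_connectedComponent_eq (not_disjoint_iff_nonempty_inter.1 h)))
  have hSc : ⋃ k : κ, k.1 = univ := by
    refine eq_univ_of_forall fun q => ?_
    obtain ⟨x, rfl⟩ := hπ.surjective q
    exact mem_iUnion.2 ⟨⟨_, x, rfl⟩, x, mem_connectedComponent, rfl⟩
  obtain ⟨α, c, r, hcov, hfin⟩ := exists_locallyFinite_basis_refinement hSo hSσ hSd hSc hB
  refine ⟨α, fun a => r a, fun a => (r a).contMDiff, fun a => (r a).hasCompactSupport,
    fun a x => (r a).nonneg, fun x => ?_, hfin⟩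
  obtain ⟨a, y, hy, hyx⟩ := mem_iUnion.1 (hcov ▸ mem_univ (π x) : π x ∈ ⋃ a, _)
  obtain ⟨g, hg⟩ := MulAction.orbitRel_apply.1 (Quotient.exact hyx)
  have hgx : g • x = y := hg
  exact ⟨a, g, hgx ▸ hy⟩

variable (G X) in
/-- A nonnegative smooth function that is positive somewhere on every orbit and whose support meets
every compact set under compactly many translations only. -/
theorem exists_precutoff : ∃ φ : X → ℝ, ContMDiff I 𝓘(ℝ) ∞ φ ∧ (∀ x, 0 ≤ φ x) ∧
    (∀ x, ∃ g : G, φ (g • x) ≠ 0) ∧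
    ∀ K : Set X, IsCompact K → ∃ L : Set G, IsCompact L ∧
      ∀ g ∉ L, ∀ x ∈ K, φ (g⁻¹ • x) = 0 := by
  obtain ⟨α, ψ, hψs, hψc, hψ0, hψx, hψf⟩ := exists_bump_family (G := G) (X := X) (I := I)
  have hπ : IsOpenQuotientMap (Quotient.mk (MulAction.orbitRel G X)) :=
    MulAction.isOpenQuotientMap_quotientMk
  have hfin : LocallyFinite fun a => Function.support (ψ a) :=
    (hψf.preimage_continuous hπ.continuous).subset fun a => subset_preimage_image _ _
  refine ⟨fun x => ∑ᶠ a, ψ a x, contMDiff_finsum hψs hfin, fun x => finsum_nonneg fun a => hψ0 a x,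
    fun x => ?_, fun K hK => ?_⟩
  · obtain ⟨a, g, hg⟩ := hψx x
    refine ⟨g, (finsum_pos (fun a => hψ0 a _) ⟨a, (hψ0 a _).lt_of_ne' hg⟩ ?_).ne'⟩
    exact hfin.point_finite (g • x)
  -- The image of `K` meets only finitely many of the sets in the orbit space. For each of these,
  -- properness confines the translations bringing the support of the bump to `K` to a compact set.
  · have hF := hψf.finite_nonempty_inter_compact (hK.image hπ.continuous)
    refine ⟨_, hF.isCompact_biUnion fun a _ =>
      ProperSMul.isCompact_setOfPred_inter_nonempty (G := G) (hψc a).isCompact hK, fun g hg x hx => ?_⟩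
    refine finsum_eq_zero_of_forall_eq_zero fun a => ?_
    by_contra ha
    refine hg (mem_biUnion (x := a) ?_ ?_)
    · exact ⟨_, ⟨_, ha, rfl⟩, x, hx, Quotient.sound (MulAction.orbitRel_apply.2 ⟨g, by simp⟩)⟩
    · exact ⟨x, ⟨_, subset_tsupport _ ha, by simp⟩, hx⟩

end Bumps

section Cutoff

variable {EG HG G : Type*} [NormedAddCommGroup EG] [NormedSpace ℝ EG] [FiniteDimensional ℝ EG]
  [TopologicalSpace HG]
  [TopologicalSpace G] [T2Space G] [ChartedSpace HG G] [Group G]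
  {EX HX X : Type*} [NormedAddCommGroup EX] [NormedSpace ℝ EX] [FiniteDimensional ℝ EX]
  [TopologicalSpace HX] (IX : ModelWithCorners ℝ EX HX) [IX.Boundaryless]
  [TopologicalSpace X] [T2Space X] [ParacompactSpace X] [ChartedSpace HX X] [IsManifold IX ∞ X]
  [MulAction G X] [ProperSMul G X]

variable (G X) in
/-- A proper action admits a smooth cutoff function: its integral along every orbit is `1`, and its
support meets every compact set under compactly many translations only. -/
theorem exists_cutoff (IG : ModelWithCorners ℝ EG HG) [IG.Boundaryless] [LieGroup IG ∞ G]
    [ContMDiffSMul IG IX ∞ G X] [MeasurableSpace G] [BorelSpace G] (μ : Measure G) [μ.IsHaarMeasure] :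
    ∃ φ : X → ℝ, ContMDiff IX 𝓘(ℝ) ∞ φ ∧ (∀ x, ∫ g : G, φ (g⁻¹ • x) ∂μ = 1) ∧
    ∀ K : Set X, IsCompact K → ∃ L : Set G, IsCompact L ∧
      ∀ g ∉ L, ∀ x ∈ K, φ (g⁻¹ • x) = 0 := by
  have : IsTopologicalGroup G := topologicalGroup_of_lieGroup IG ∞
  have : LocallyCompactSpace X := Manifold.locallyCompact_of_finiteDimensional IX
  obtain ⟨φ, hφ, hφ0, hφx, hφc⟩ := exists_precutoff (G := G) (X := X) (I := IX)
  have hc : ∀ x, Continuous fun g : G => φ (g⁻¹ • x) := fun x =>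
    hφ.continuous.comp (continuous_inv.smul continuous_const)
  -- The normalising factor. It is `G`-invariant by left invariance of Haar measure, so the quotient
  -- `φ / Φ` integrates to `1` along orbits.
  let Φ : X → ℝ := fun x => ∫ g : G, φ (g⁻¹ • x) ∂μ
  have hcpt : ∀ x, ∃ L : Set G, IsCompact L ∧ ∀ g ∉ L, φ (g⁻¹ • x) = 0 := fun x => by
    obtain ⟨L, hL, h⟩ := hφc {x} isCompact_singleton
    exact ⟨L, hL, fun g hg => h g hg x rfl⟩
  have hΦpos : ∀ x, 0 < Φ x := fun x => by
    obtain ⟨L, hL, h⟩ := hcpt x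
    obtain ⟨g, hg⟩ := hφx x
    exact (hc x).integral_pos_of_hasCompactSupport_nonneg_nonzero (HasCompactSupport.intro hL h)
      (fun g => hφ0 _) (x := g⁻¹) (by simpa using hg)
  have hΦinv : ∀ (γ : G) x, Φ (γ • x) = Φ x := fun γ x => by
    have h := integral_mul_left_eq_self (μ := μ) (fun g : G => φ (g⁻¹ • x)) γ⁻¹
    simpa only [mul_inv_rev, inv_inv, mul_smul] using h
  have hΦ : ContMDiff IX 𝓘(ℝ) ∞ Φ := by
    have hΦw : ∀ x, weakIntegral μ (fun g : G => φ (g⁻¹ • x)) = Φ x := fun x => by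
      obtain ⟨L, hL, h⟩ := hcpt x
      exact dual_weakIntegral (hc x) hL h (ContinuousLinearMap.id ℝ ℝ)
    have h1 : ScalarSmooth (IX.prod IG) (fun p : X × G => φ (p.2⁻¹ • p.1)) := fun l => by
      refine l.contDiff.contMDiff.comp (hφ.comp ?_)
      exact contMDiff_snd.inv.smul contMDiff_fst
    have h2 := ScalarSmooth.weakIntegral (μ := μ) (u := fun x (g : G) => φ (g⁻¹ • x)) h1
      (fun x₀ => by
        obtain ⟨K, hK, hx⟩ := exists_compact_mem_nhds x₀
        obtain ⟨L, hL, h⟩ := hφc K hK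
        exact ⟨K, hx, L, hL, fun x hx g hg => h g hg x hx⟩)
    simp only [hΦw] at h2
    exact h2 (ContinuousLinearMap.id ℝ ℝ)
  refine ⟨fun x => φ x / Φ x, hφ.div₀ hΦ fun x => (hΦpos x).ne', fun x => ?_, fun K hK => ?_⟩
  · simp only [hΦinv, integral_div]
    exact div_self (hΦpos x).ne'
  · obtain ⟨L, hL, h⟩ := hφc K hK
    exact ⟨L, hL, fun g hg x hx => by simp [h g hg x hx]⟩

end Cutoff

open MeasureTheory

/-! ### The contracting homotopy -/

section Tuples

variable {G : Type*} {n : ℕ}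

/-- This and the next three lemmas describe the terms of the cocycle identity at `(α, h)`: inner
contractions leave `h` alone, and only the last one multiplies into it. -/
theorem contractNth_castSucc_snoc (op : G → G → G) (i : Fin n) (α : Fin (n + 1) → G) (h : G) :
    Fin.contractNth i.castSucc.castSucc op (Fin.snoc α h : Fin (n + 2) → G) =
      Fin.snoc (Fin.contractNth i.castSucc op α) h := by
  ext k
  induction k using Fin.lastCases with
  | last =>
    rw [Fin.snoc_last, Fin.contractNth_apply_of_gt _ _ _ _ (by simp), Fin.succ_last, Fin.snoc_last]
  | cast k =>
    rw [Fin.snoc_castSucc]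
    simp only [Fin.contractNth, Fin.snoc_castSucc, ← Fin.castSucc_succ, Fin.val_castSucc]

theorem contractNth_last_snoc (op : G → G → G) (α : Fin (n + 1) → G) (h : G) :
    Fin.contractNth (Fin.last n).castSucc op (Fin.snoc α h : Fin (n + 2) → G) =
      Fin.snoc (fun i : Fin n => α i.castSucc) (op (α (Fin.last n)) h) := by
  ext k
  induction k using Fin.lastCases with
  | last =>
    rw [Fin.snoc_last, Fin.contractNth_apply_of_eq _ _ _ _ (by simp), Fin.succ_last, Fin.snoc_last,
      Fin.snoc_castSucc]
  | cast k =>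
    rw [Fin.snoc_castSucc, Fin.contractNth_apply_of_lt _ _ _ _ (by simp), Fin.snoc_castSucc]

theorem tail_snoc (α : Fin (n + 1) → G) (h : G) :
    (fun i : Fin (n + 1) => (Fin.snoc α h : Fin (n + 2) → G) i.succ) =
      Fin.snoc (fun i : Fin n => α i.succ) h := by
  ext k
  induction k using Fin.lastCases with
  | last => rw [Fin.succ_last, Fin.snoc_last, Fin.snoc_last]
  | cast k => rw [Fin.succ_castSucc, Fin.snoc_castSucc, Fin.snoc_castSucc]

theorem snoc_zero (α : Fin (n + 1) → G) (h : G) : (Fin.snoc α h : Fin (n + 2) → G) 0 = α 0 := by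
  rw [← Fin.castSucc_zero, Fin.snoc_castSucc]

/-- The total product fixes the base point of the cutoff in the averaging operator; this and the
next two lemmas make that base point the same in all terms of the coboundary. -/
theorem partialProd_contractNth_last [Monoid G] (i : Fin n) (α : Fin (n + 1) → G) :
    Fin.partialProd (Fin.contractNth i.castSucc (· * ·) α) (Fin.last n) =
      Fin.partialProd α (Fin.last (n + 1)) := by
  rw [Fin.partialProd_contractNth, Function.comp_apply,
    Fin.succAbove_of_le_castSucc _ _ (by simp [Fin.le_def]), Fin.succ_last]

theorem partialProd_tail_last [Monoid G] (α : Fin (n + 1) → G) :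
    α 0 * Fin.partialProd (fun i => α i.succ) (Fin.last n) =
      Fin.partialProd α (Fin.last (n + 1)) := by
  rw [← Fin.succ_last, Fin.partialProd_succ']
  rfl

theorem partialProd_castSucc_last [Monoid G] (α : Fin (n + 1) → G) :
    Fin.partialProd (fun i => α i.castSucc) (Fin.last n) * α (Fin.last n) =
      Fin.partialProd α (Fin.last (n + 1)) := by
  rw [← Fin.succ_last, Fin.partialProd_succ, ← Fin.partialProd_init]
  rfl

end Tuples

section Homotopy

variable {G : Type*} [TopologicalSpace G] [T2Space G] [Group G] [IsTopologicalGroup G]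
  [MeasurableSpace G] [BorelSpace G] {μ : Measure G} [IsFiniteMeasureOnCompacts μ]
  {X : Type*} [TopologicalSpace X] [MulAction G X] [ContinuousSMul G X]
  {V : Type*} [AddCommGroup V] [Module ℝ V] [UniformSpace V] [IsUniformAddGroup V]
  [ContinuousSMul ℝ V] [LocallyConvexSpace ℝ V] [T2Space V] [QuasiCompleteSpace ℝ V]
  {φ : X → ℝ} {n : ℕ} {c : (Fin (n + 1) → G) → X → V}

variable (μ φ) in
/-- The averaging operator that lowers the degree of a cochain by one. -/
def cochainHomotopy (c : (Fin (n + 1) → G) → X → V) (α : Fin n → G) (x : X) : V :=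
  weakIntegral μ fun h => φ (h⁻¹ • (Fin.partialProd α (Fin.last n))⁻¹ • x) • c (Fin.snoc α h) x

variable (hφ : Continuous φ)
  (hφc : ∀ x, ∃ L : Set G, IsCompact L ∧ ∀ g ∉ L, φ (g⁻¹ • x) = 0)

include hφ hφc

theorem integrable_cutoff_mul {u : G → V} (hu : Continuous u) (x : X) (l : StrongDual ℝ V) :
    Integrable (fun h => φ (h⁻¹ • x) * l (u h)) μ := by
  obtain ⟨L, hL, h⟩ := hφc x
  have := integrable_dual (μ := μ) (f := fun g => φ (g⁻¹ • x) • u g)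
    ((hφ.comp (continuous_inv.smul continuous_const)).smul hu) hL
    (fun g hg => by rw [h g hg, zero_smul]) l
  simpa using this

theorem dual_cochainHomotopy (hc : ∀ x, Continuous fun α => c α x) (α : Fin n → G) (x : X)
    (l : StrongDual ℝ V) :
    l (cochainHomotopy μ φ c α x) =
      ∫ h, φ (h⁻¹ • (Fin.partialProd α (Fin.last n))⁻¹ • x) * l (c (Fin.snoc α h) x) ∂μ := by
  obtain ⟨L, hL, h⟩ := hφc ((Fin.partialProd α (Fin.last n))⁻¹ • x)
  have hu : Continuous fun h => c (Fin.snoc α h) x :=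
    (hc x).comp ((continuous_snoc n).comp (Continuous.prodMk_right α))
  have := dual_weakIntegral (μ := μ)
    (f := fun g => φ (g⁻¹ • (Fin.partialProd α (Fin.last n))⁻¹ • x) • c (Fin.snoc α g) x)
    ((hφ.comp (continuous_inv.smul continuous_const)).smul hu) hL
    (fun g hg => by rw [h g hg, zero_smul]) l
  simpa [cochainHomotopy] using this

/-- On cocycles, `cochainHomotopy` is inverted, up to sign, by the coboundary operator. -/
theorem coboundary_cochainHomotopy [μ.IsMulLeftInvariant]
    (hφ1 : ∀ x, ∫ g : G, φ (g⁻¹ • x) ∂μ = 1) {ρ : Representation ℝ G V}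
    (hρ : IsContinuousModule ρ) (hc : ∀ x, Continuous fun α => c α x)
    (hcoc : ∀ (α : Fin (n + 2) → G) x, ρ (α 0) (c (fun i => α i.succ) ((α 0)⁻¹ • x))
      + ∑ i : Fin (n + 1), (-1 : ℝ) ^ ((i : ℕ) + 1) • c (Fin.contractNth i.castSucc (· * ·) α) x
      + (-1 : ℝ) ^ (n + 1 + 1) • c (fun i => α i.castSucc) x = 0)
    (α : Fin (n + 1) → G) (x : X) :
    ρ (α 0) (cochainHomotopy μ φ c (fun i => α i.succ) ((α 0)⁻¹ • x))
      + ∑ i : Fin n, (-1 : ℝ) ^ ((i : ℕ) + 1) •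
        cochainHomotopy μ φ c (Fin.contractNth i.castSucc (· * ·) α) x
      + (-1 : ℝ) ^ (n + 1) • cochainHomotopy μ φ c (fun i => α i.castSucc) x =
    (-1 : ℝ) ^ (n + 1) • c α x := by
  refine eq_of_forall_dual_eq fun l => ?_
  have hcs : ∀ (β : Fin n → G) {s : G → G} (_ : Continuous s) y,
      Continuous fun h => c (Fin.snoc β (s h)) y := fun β s hs y =>
    (hc y).comp ((continuous_snoc n).comp (continuous_const.prodMk hs))
  have hρc : ∀ g, Continuous (ρ g) := fun g =>
    (show Continuous fun p : G × V => ρ p.1 p.2 from hρ).comp (Continuous.prodMk_right g)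
  set y := (Fin.partialProd α (Fin.last (n + 1)))⁻¹ • x with hy
  have e0 : l (ρ (α 0) (cochainHomotopy μ φ c (fun i => α i.succ) ((α 0)⁻¹ • x))) =
      ∫ h, φ (h⁻¹ • y) * l (ρ (α 0) (c (Fin.snoc (fun i => α i.succ) h) ((α 0)⁻¹ • x))) ∂μ := by
    have := dual_cochainHomotopy (μ := μ) hφ hφc hc (fun i => α i.succ) ((α 0)⁻¹ • x)
      (l.comp ⟨ρ (α 0), hρc _⟩)
    rw [← mul_smul, ← mul_inv_rev, partialProd_tail_last] at this
    exact this
  have e1 : ∀ i : Fin n, l (cochainHomotopy μ φ c (Fin.contractNth i.castSucc (· * ·) α) x) =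
      ∫ h, φ (h⁻¹ • y) * l (c (Fin.snoc (Fin.contractNth i.castSucc (· * ·) α) h) x) ∂μ := by
    intro i
    rw [dual_cochainHomotopy hφ hφc hc, partialProd_contractNth_last]
  -- Substituting `αₙ₊₁h` for `h` restores the missing last factor in the total product and produces
  -- the contracted entry of the cocycle identity.
  have e2 : l (cochainHomotopy μ φ c (fun i => α i.castSucc) x) =
      ∫ h, φ (h⁻¹ • y) * l (c (Fin.snoc (fun i => α i.castSucc) (α (Fin.last n) * h)) x) ∂μ := by
    rw [dual_cochainHomotopy hφ hφc hc, ← integral_mul_left_eq_self _ (α (Fin.last n))]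
    simp only [hy, ← partialProd_castSucc_last α, mul_inv_rev, mul_smul]
  have i0 := integrable_cutoff_mul (μ := μ) hφ hφc
    ((hρc (α 0)).comp (hcs (fun i => α i.succ) continuous_id ((α 0)⁻¹ • x))) y l
  have i1 := fun i : Fin n => (integrable_cutoff_mul (μ := μ) hφ hφc
    (hcs (Fin.contractNth i.castSucc (· * ·) α) continuous_id x) y l).const_mul
      ((-1 : ℝ) ^ ((i : ℕ) + 1))
  have i2 := (integrable_cutoff_mul (μ := μ) hφ hφc
    (hcs (fun i => α i.castSucc) (continuous_const_mul (α (Fin.last n))) x) y l).const_mul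
      ((-1 : ℝ) ^ (n + 1))
  simp only [Function.comp_apply, id] at i0 i1
  simp only [map_add, map_sum, map_smul, smul_eq_mul, e0, e1, e2]
  simp only [← integral_const_mul]
  rw [← integral_finsetSum _ fun i _ => i1 i,
    ← integral_add i0 (integrable_finsetSum _ fun i _ => i1 i)]
  -- Total weight `1` writes the right-hand side as an integral too, so it suffices to compare
  -- integrands.
  have e3 : l (c α x) = ∫ h, φ (h⁻¹ • y) * l (c α x) ∂μ := by
    rw [integral_mul_const, hφ1 y, one_mul]
  rw [e3, ← integral_const_mul]
  refine (integral_add (i0.add (integrable_finsetSum _ fun i _ => i1 i)) i2).symm.trans ?_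
  refine integral_congr_ae (ae_of_all _ fun h => ?_)
  -- The comparison is the cocycle identity at `(α, h)`; its final term does not involve `h` and has
  -- sign `(-1)^(n+2)`, which accounts for `(-1)^(n+1)` on the other side.
  have h1 := congrArg l (hcoc (Fin.snoc α h) x)
  rw [Fin.sum_univ_castSucc] at h1
  simp only [contractNth_castSucc_snoc, contractNth_last_snoc, tail_snoc, snoc_zero, map_add,
    map_sum, map_smul, map_zero, smul_eq_mul, Fin.snoc_castSucc, Fin.val_castSucc,
    Fin.val_last] at h1
  simp only [Pi.add_apply, mul_left_comm _ (φ _), ← Finset.mul_sum, ← mul_add]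
  congr 1
  rw [pow_succ _ (n + 1)] at h1
  linear_combination h1

end Homotopy

open MeasureTheory

/-! ### Assembling the vanishing theorem -/

section Evaluation

variable {E H : Type*} [NormedAddCommGroup E] [NormedSpace ℝ E] [TopologicalSpace H]
  {I : ModelWithCorners ℝ E H} {M : Type*} [TopologicalSpace M] [ChartedSpace H M]
  {V : Type*} [AddCommGroup V] [Module ℝ V] [UniformSpace V]
  [IsUniformAddGroup V] [ContinuousSMul ℝ V] [LocallyConvexSpace ℝ V] [T2Space V]
  [QuasiCompleteSpace ℝ V] [FiniteDimensional ℝ E] [I.Boundaryless] [IsManifold I ∞ M]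

theorem continuous_smoothMap_apply (x : M) : Continuous fun f : SmoothMap I M V => f x := by
  let e : IsManifold.maximalAtlas I ∞ M := ⟨_, IsManifold.chart_mem_maximalAtlas x⟩
  have hx : e.1.extend I x ∈ (e.1.extend I).target :=
    (e.1.extend I).map_source (by rw [e.1.extend_source]; exact mem_chart_source H x)
  refine (SmoothMap.jetEval (V := V) e 0 (⟨_, hx⟩, Fin.elim0)).continuous.congr fun f => ?_
  rw [SmoothMap.jetEval_apply, SmoothMap.chartDeriv_zero e f hx, (e.1.extend I).left_inv]
  rw [e.1.extend_source]
  exact mem_chart_source H x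

end Evaluation

section Algebra

variable {G W : Type*} [Group G] [AddCommGroup W] [Module ℝ W]

theorem coboundary_apply (σ : Representation ℝ G W) (r : ℕ) (c : (Fin r → G) → W)
    (α : Fin (r + 1) → G) :
    coboundary σ r c α = σ (α 0) (c fun i => α i.succ)
      + ∑ i : Fin r, (-1 : ℝ) ^ ((i : ℕ) + 1) • c (Fin.contractNth i.castSucc (· * ·) α)
      + (-1 : ℝ) ^ (r + 1) • c fun i => α i.castSucc := rfl

theorem subsingleton_cohomology {σ : Representation ℝ G W}
    {C : ∀ r : ℕ, Submodule ℝ ((Fin r → G) → W)}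
    (h : ∀ n, ∀ c ∈ C (n + 1), coboundary σ (n + 1) c = 0 → ∃ F ∈ C n, coboundary σ n F = c)
    (r : ℕ) (hr : 1 ≤ r) : Subsingleton (Cohomology σ C r) := by
  obtain ⟨n, rfl⟩ := Nat.exists_eq_add_of_le' hr
  rw [Submodule.Quotient.subsingleton_iff, Submodule.submoduleOf_eq_top]
  rintro c ⟨hc, hc0⟩
  exact h n c hc hc0

end Algebra

section Vanishing

variable {EG HG G : Type*} [NormedAddCommGroup EG] [NormedSpace ℝ EG] [FiniteDimensional ℝ EG]
  [TopologicalSpace HG] {IG : ModelWithCorners ℝ EG HG} [IG.Boundaryless]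
  [TopologicalSpace G] [T2Space G] [ChartedSpace HG G] [Group G] [LieGroup IG ∞ G]
  {EX HX X : Type*} [NormedAddCommGroup EX] [NormedSpace ℝ EX] [FiniteDimensional ℝ EX]
  [TopologicalSpace HX] {IX : ModelWithCorners ℝ EX HX} [IX.Boundaryless]
  [TopologicalSpace X] [T2Space X] [ChartedSpace HX X] [IsManifold IX ∞ X]
  [MulAction G X] [ContMDiffSMul IG IX ∞ G X] [ProperSMul G X]
  {V : Type*} [AddCommGroup V] [Module ℝ V] [UniformSpace V] [IsUniformAddGroup V]
  [ContinuousSMul ℝ V] [LocallyConvexSpace ℝ V] [T2Space V] [QuasiCompleteSpace ℝ V]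
  {ρ : Representation ℝ G V} {φ : X → ℝ} {n : ℕ} {c : (Fin (n + 1) → G) → SmoothMap IX X V}

/-- Pulling back a compact neighbourhood of the translated point gives one compact set of `g` valid
for all nearby `(α, x)`, as parameter integrals require. -/
theorem exists_nhds_cutoff_eq_zero [IsTopologicalGroup G] [LocallyCompactSpace X]
    (hφc : ∀ K : Set X, IsCompact K → ∃ L : Set G, IsCompact L ∧
      ∀ g ∉ L, ∀ x ∈ K, φ (g⁻¹ • x) = 0) (p₀ : (Fin n → G) × X) :
    ∃ N ∈ 𝓝 p₀, ∃ L : Set G, IsCompact L ∧ ∀ p ∈ N, ∀ g ∉ L,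
      φ (g⁻¹ • (Fin.partialProd p.1 (Fin.last n))⁻¹ • p.2) = 0 := by
  obtain ⟨K, hK, hx⟩ := exists_compact_mem_nhds ((Fin.partialProd p₀.1 (Fin.last n))⁻¹ • p₀.2)
  obtain ⟨L, hL, h⟩ := hφc K hK
  have hc : Continuous fun p : (Fin n → G) × X =>
      (Fin.partialProd p.1 (Fin.last n))⁻¹ • p.2 :=
    (((continuous_partialProd (Fin.last n)).comp continuous_fst).inv).smul continuous_snd
  exact ⟨_, hc.continuousAt.preimage_mem_nhds hx, L, hL, fun p hp g hg => h g hg _ hp⟩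

theorem coboundary_smoothRep_apply (hρ : IsContinuousModule ρ) (r : ℕ)
    (c : (Fin r → G) → SmoothMap IX X V) (α : Fin (r + 1) → G) (x : X) :
    (coboundary (smoothRep IG IX X ρ hρ) r c α : SmoothMap IX X V) x =
      ρ (α 0) (c (fun i => α i.succ) ((α 0)⁻¹ • x))
      + ∑ i : Fin r, (-1 : ℝ) ^ ((i : ℕ) + 1) • c (Fin.contractNth i.castSucc (· * ·) α) x
      + (-1 : ℝ) ^ (r + 1) • c (fun i => α i.castSucc) x := by
  let ev : SmoothMap IX X V →ₗ[ℝ] V := {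
    toFun := fun f => f x
    map_add' := fun _ _ => rfl
    map_smul' := fun _ _ => rfl }
  change ev (coboundary (smoothRep IG IX X ρ hρ) r c α) = _
  rw [coboundary_apply]
  simp only [map_add, map_sum, map_smul]
  rfl

section Haar

variable [MeasurableSpace G] [BorelSpace G] {μ : Measure G} [IsFiniteMeasureOnCompacts μ]

variable (IG) in
include IG in
-- Here `c` is only continuous in the group variables, so the exponential law is applied to the
-- cutoff alone; the product with `c` and the integral are then formed as continuous families in
-- `C^∞(X, V)`.
theorem continuous_cochainHomotopy (hφ : ContMDiff IX 𝓘(ℝ) ∞ φ)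
    (hφc : ∀ K : Set X, IsCompact K → ∃ L : Set G, IsCompact L ∧
      ∀ g ∉ L, ∀ x ∈ K, φ (g⁻¹ • x) = 0) (hc : Continuous c) :
    ∃ hs : ∀ α, IsSmooth IX (cochainHomotopy μ φ (fun β x => c β x) α),
      Continuous fun α => (SmoothMap.mk _ (hs α) : SmoothMap IX X V) := by
  have : IsTopologicalGroup G := topologicalGroup_of_lieGroup IG ∞
  have : LocallyCompactSpace X := Manifold.locallyCompact_of_finiteDimensional IX
  have h1 : ScalarSmooth (IG.prod IX) (fun p : G × X => φ (p.1⁻¹ • p.2)) := fun l =>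
    l.contDiff.contMDiff.comp (hφ.comp (contMDiff_fst.inv.smul contMDiff_snd))
  have h2 := (isSmooth_smoothMap (u := fun (g : G) x => φ (g⁻¹ • x)) h1).continuous
  have hm : Continuous fun p : (Fin n → G) × G => Fin.partialProd p.1 (Fin.last n) * p.2 :=
    ((continuous_partialProd (Fin.last n)).comp continuous_fst).mul continuous_snd
  obtain ⟨hs, h3⟩ := continuous_smoothMap_smul (h2.comp hm) (hc.comp (continuous_snoc n))
  -- The weight depends on `α` and `h` only through one group element, so it factors through the
  -- continuous family `g ↦ φ(g⁻¹ ·)`.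
  have heq : ∀ (p : (Fin n → G) × G) (x : X), φ ((Fin.partialProd p.1 (Fin.last n) * p.2)⁻¹ • x) =
      φ (p.2⁻¹ • (Fin.partialProd p.1 (Fin.last n))⁻¹ • x) := fun p x => by
    rw [mul_inv_rev, mul_smul]
  obtain ⟨hs', h4⟩ := continuous_smoothMap_weakIntegral (μ := μ) h3 (fun α₀ x₀ => by
    obtain ⟨N, hN, L, hL, h⟩ := exists_nhds_cutoff_eq_zero hφc (α₀, x₀)
    refine ⟨N, hN, L, hL, fun q hq g hg => ?_⟩
    change φ ((Fin.partialProd q.1 (Fin.last n) * g)⁻¹ • q.2) • c _ q.2 = 0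
    rw [heq (q.1, g), h q hq g hg, zero_smul])
  have hF : ∀ α, (fun x => weakIntegral μ fun g =>
      φ ((Fin.partialProd α (Fin.last n) * g)⁻¹ • x) • c (Fin.snoc α g) x) =
      cochainHomotopy μ φ (fun β x => c β x) α := fun α => by
    ext x
    simp only [cochainHomotopy, heq (α, _)]
  refine ⟨fun α => hF α ▸ hs' α, ?_⟩
  convert h4 using 2 with α
  exact Subtype.ext (hF α).symm

/-- The exponential law is used twice: `c` becomes a function on `Gⁿ⁺¹ × X`, the integral is smooth
on `Gⁿ × X`, and currying back gives a smooth cochain. -/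
theorem isSmooth_cochainHomotopy (hφ : ContMDiff IX 𝓘(ℝ) ∞ φ)
    (hφc : ∀ K : Set X, IsCompact K → ∃ L : Set G, IsCompact L ∧
      ∀ g ∉ L, ∀ x ∈ K, φ (g⁻¹ • x) = 0)
    (hc : IsSmooth (ModelWithCorners.pi fun _ : Fin (n + 1) => IG) c) :
    ∃ hs : ∀ α, IsSmooth IX (cochainHomotopy μ φ (fun β x => c β x) α),
      IsSmooth (ModelWithCorners.pi fun _ : Fin n => IG)
        fun α => (SmoothMap.mk _ (hs α) : SmoothMap IX X V) := by
  have : IsTopologicalGroup G := topologicalGroup_of_lieGroup IG ∞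
  have : LocallyCompactSpace X := Manifold.locallyCompact_of_finiteDimensional IX
  have h1 := hc.scalarSmooth_uncurry
  let In := ModelWithCorners.pi fun _ : Fin n => IG
  have hu : ScalarSmooth ((In.prod IX).prod IG) (fun p : ((Fin n → G) × X) × G =>
      φ (p.2⁻¹ • (Fin.partialProd p.1.1 (Fin.last n))⁻¹ • p.1.2) •
        c (Fin.snoc p.1.1 p.2) p.1.2) := fun l => by
    simp only [map_smul, smul_eq_mul]
    refine ContMDiff.mul (hφ.comp ?_) ((h1 l).comp (ContMDiff.prodMk ?_ ?_))
    · exact contMDiff_snd.inv.smul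
        (((contMDiff_partialProd (Fin.last n)).comp (contMDiff_fst.comp contMDiff_fst)).inv.smul
          (contMDiff_snd.comp contMDiff_fst))
    · exact (contMDiff_snoc n).comp ((contMDiff_fst.comp contMDiff_fst).prodMk contMDiff_snd)
    · exact contMDiff_snd.comp contMDiff_fst
  have h2 := ScalarSmooth.weakIntegral (μ := μ) (I := In.prod IX) (J := IG)
    (u := fun (p : (Fin n → G) × X) (g : G) =>
      φ (g⁻¹ • (Fin.partialProd p.1 (Fin.last n))⁻¹ • p.2) • c (Fin.snoc p.1 g) p.2) hu
    (fun p₀ => by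
      obtain ⟨N, hN, L, hL, h⟩ := exists_nhds_cutoff_eq_zero hφc p₀
      exact ⟨N, hN, L, hL, fun p hp g hg => by rw [h p hp g hg, zero_smul]⟩)
  exact ⟨_, isSmooth_smoothMap (u := cochainHomotopy μ φ (fun β x => c β x)) h2⟩

theorem coboundary_smoothRep_cochainHomotopy [μ.IsMulLeftInvariant]
    (hρ : IsContinuousModule ρ) (hφ : ContMDiff IX 𝓘(ℝ) ∞ φ)
    (hφ1 : ∀ x, ∫ g : G, φ (g⁻¹ • x) ∂μ = 1)
    (hφc : ∀ K : Set X, IsCompact K → ∃ L : Set G, IsCompact L ∧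
      ∀ g ∉ L, ∀ x ∈ K, φ (g⁻¹ • x) = 0) (hc : Continuous c)
    (hc0 : coboundary (smoothRep IG IX X ρ hρ) (n + 1) c = 0)
    (hs : ∀ α, IsSmooth IX (cochainHomotopy μ φ (fun β x => c β x) α)) :
    coboundary (smoothRep IG IX X ρ hρ) n
      ((-1 : ℝ) ^ (n + 1) • fun α => (SmoothMap.mk _ (hs α) : SmoothMap IX X V)) = c := by
  have : IsTopologicalGroup G := topologicalGroup_of_lieGroup IG ∞
  rw [map_smul]
  have key : coboundary (smoothRep IG IX X ρ hρ) n
      (fun α => (SmoothMap.mk _ (hs α) : SmoothMap IX X V)) = (-1 : ℝ) ^ (n + 1) • c := by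
    ext α
    refine Subtype.ext (funext fun x => ?_)
    rw [coboundary_smoothRep_apply]
    refine coboundary_cochainHomotopy (c := fun β x => c β x) hφ.continuous (fun x => ?_) hφ1 hρ
      (fun x => (continuous_smoothMap_apply x).comp hc) (fun β y => ?_) α x
    · obtain ⟨L, hL, h⟩ := hφc {x} isCompact_singleton
      exact ⟨L, hL, fun g hg => h g hg x rfl⟩
    · rw [← coboundary_smoothRep_apply (IG := IG) hρ, hc0]
      rfl
  rw [key, smul_smul, ← mul_pow, neg_one_mul, neg_neg, one_pow, one_smul]

end Haar

variable [ParacompactSpace X]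

/-- The cohomology of `G` with coefficients in `C^∞(X, V)` vanishes in positive degrees
if the action on `X` is proper; continuity of the module `V` suffices. -/
theorem subsingleton_cohomology_smoothRep (hρ : IsContinuousModule ρ) (r : ℕ) (hr : 1 ≤ r) :
    Subsingleton (DifferentiableCohomology IG (smoothRep IG IX X ρ hρ) r) ∧
      Subsingleton (ContinuousCohomology (smoothRep IG IX X ρ hρ) r) := by
  have : IsTopologicalGroup G := topologicalGroup_of_lieGroup IG ∞
  have : LocallyCompactSpace G := Manifold.locallyCompact_of_finiteDimensional IG
  let : MeasurableSpace G := borel G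
  have : BorelSpace G := ⟨rfl⟩
  obtain ⟨φ, hφ, hφ1, hφc⟩ := exists_cutoff G X IX IG (Measure.haar : Measure G)
  refine ⟨subsingleton_cohomology (fun n c hc hc0 => ?_) r hr,
    subsingleton_cohomology (fun n c hc hc0 => ?_) r hr⟩
  · obtain ⟨hs, h⟩ := isSmooth_cochainHomotopy (μ := Measure.haar) hφ hφc hc
    exact ⟨_, Submodule.smul_mem _ _ h, coboundary_smoothRep_cochainHomotopy hρ hφ hφ1 hφc
      (IsSmooth.continuous hc) hc0 hs⟩
  · obtain ⟨hs, h⟩ := continuous_cochainHomotopy IG (μ := Measure.haar) hφ hφc hc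
    exact ⟨_, Submodule.smul_mem _ _ h,
      coboundary_smoothRep_cochainHomotopy hρ hφ hφ1 hφc hc hc0 hs⟩

end Vanishing

end EquivCoh

end

theorem mainTheorem1
    -- the Lie group `G`
    {EG HG G : Type*} [NormedAddCommGroup EG] [NormedSpace ℝ EG] [FiniteDimensional ℝ EG]
    [TopologicalSpace HG] (IG : ModelWithCorners ℝ EG HG) [IG.Boundaryless]
    [TopologicalSpace G] [T2Space G] [ChartedSpace HG G] [Group G] [LieGroup IG ∞ G]
    -- the manifold `X` with its smooth and proper action
    {EX HX X : Type*} [NormedAddCommGroup EX] [NormedSpace ℝ EX] [FiniteDimensional ℝ EX]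
    [TopologicalSpace HX] (IX : ModelWithCorners ℝ EX HX) [IX.Boundaryless]
    [TopologicalSpace X] [T2Space X] [ParacompactSpace X] [ChartedSpace HX X] [IsManifold IX ∞ X]
    [MulAction G X] [ContMDiffSMul IG IX ∞ G X] [ProperSMul G X]
    -- the differentiable `G`-module `V`
    {V : Type*} [AddCommGroup V] [Module ℝ V] [UniformSpace V] [IsUniformAddGroup V]
    [ContinuousSMul ℝ V] [LocallyConvexSpace ℝ V] [T2Space V] [QuasiCompleteSpace ℝ V]
    (ρ : Representation ℝ G V) (hρ : EquivCoh.IsDifferentiableModule IG ρ) :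
    (∀ r : ℕ, 1 ≤ r →
      Subsingleton (EquivCoh.DifferentiableCohomology IG
        (EquivCoh.smoothRep IG IX X ρ hρ.continuous) r) ∧
      Subsingleton (EquivCoh.ContinuousCohomology
        (EquivCoh.smoothRep IG IX X ρ hρ.continuous) r)) ∧
    ∀ r : ℕ, 1 ≤ r →
      Subsingleton (EquivCoh.DifferentiableCohomology IG
        (EquivCoh.smoothRep IG IX X (Representation.trivial ℝ G ℝ)
          (EquivCoh.isContinuousModule_trivial G)) r) :=
  ⟨fun r hr => EquivCoh.subsingleton_cohomology_smoothRep hρ.continuous r hr, fun r hr =>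
    (EquivCoh.subsingleton_cohomology_smoothRep
      (EquivCoh.isContinuousModule_trivial G) r hr).1⟩
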